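/- **Setting.** For $\lambda>1$ let $\mathbb T_\lambda=\mathbb R/2\pi\lambda\mathbb Z$. For a function $u(x,y,t)$ on $\mathbb R\times\mathbb T_\lambda\times\mathbb R$ write $$\widehat u(\xi,q,\tau)=\int_{\mathbb R^2}\int_0^{2\pi\lambda}e^{-i(t\tau+x\xi+yq)}u(x,y,t)\,dy\,dx\,dt,\qquad (\xi,q,\tau)\in\mathbb R\times\lambda^{-1}\mathbb Z\times\mathbb R$$ (extended to $L^2$ as usual), $|(\xi,q)|=(3\xi^2+q^2)^{1/2}$, $\sigma(\xi,q)=\xi^3+\xi q^2$, $\langle a\rangle=1+|a|$, and $$\|u\|_{X^{r,b}_\lambda}=\Big(\frac1\lambda\sum_{q\in\lambda^{-1}\mathbb Z}\int_{\mathbb R^2}\langle\tau-\sigma(\xi,q)\rangle^{2b}\,\langle|(\xi,q)|\rangle^{2r}\,|\widehat u(\xi,q,\tau)|^2\,d\xi\,d\tau\Big)^{1/2}\in[0,\infty].$$ Let $s>9/10$ and let $\mu$ be a smooth non-increasing function with $\mu(r)=1$ for $r\le 1$ and $\mu(r)=r^{s-1}$ for $r\ge 2$ (so that $s\le 1$).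 For $N\in\{1,2,4,8,\dots\}$ let $I=I_{N}$ be the Fourier multiplier operator on $\mathbb R\times\mathbb T_\lambda\times\mathbb R$ given by $$\widehat{Iu}(\xi,q,\tau)=m(\xi,q)\,\widehat u(\xi,q,\tau),\qquad m(\xi,q)=\mu\big(|(\xi,q)|/N\big).$$ **Lemma.** For every $\varepsilon>0$ there is $\delta_0>0$, depending only on $s$, $\mu$ and $\varepsilon$, such that for all $\delta_1,\delta_2\in(0,\delta_0]$ there is a constant $C>0$, depending only on $s,\mu,\varepsilon,\delta_1,\delta_2$, such that for all $\lambda>1$, all $N\in\{1,2,4,8,\dots\}$ and all complex-valued $u,v\in L^2(\mathbb R\times\mathbb T_\lambda\times\mathbb R)$, $$\big\|\partial_x\big(Iu\,Iv-I(uv)\big)\big\|_{X^{1,-1/2+\delta_1}_\lambda}\le C\,N^{-1/10+\varepsilon}\,\|Iu\|_{X^{1,1/2+\delta_2}_\lambda}\,\|Iv\|_{X^{1,1/2+\delta_2}_\lambda}.$$ -/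

import Mathlib

open MeasureTheory FourierTransform Real
open scoped ENNReal ContDiff

noncomputable section

namespace ZKCylinder

/-! ## Physical space -/

/-- The torus `𝕋_λ = ℝ / 2πλℤ`. -/
abbrev Torus (lam : ℝ) : Type := AddCircle (2 * π * lam)

instance torusPeriodPos (lam : ℝ) [h : Fact (0 < lam)] : Fact (0 < 2 * π * lam) :=
  ⟨by have := h.out; positivity⟩

/-- The plane of the two non-periodic variables. In physical space a point is `z = (x, t)`,
that is `z 0 = x` and `z 1 = t`; in frequency space it is `w = (ξ, τ)`, that is `w 0 = ξ` and
`w 1 = τ`. -/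
abbrev Plane : Type := EuclideanSpace ℝ (Fin 2)

/-- Space-time `ℝ_x × 𝕋_λ × ℝ_t`; its points are written `(z, y)` with `z = (x, t)`. Its volume is
`dx dt dy`, of total mass `2πλ` in `y`. -/
abbrev SpaceTime (lam : ℝ) : Type := Plane × Torus lam

/-- The space `L²(ℝ × 𝕋_λ × ℝ)` of complex-valued functions of `(x, y, t)`. -/
abbrev L2 (lam : ℝ) [Fact (0 < lam)] : Type := Lp ℂ 2 (volume : Measure (SpaceTime lam))

/-- The space `L²(ℝ²)` of functions of two non-periodic variables. -/
abbrev L2Plane : Type := Lp ℂ 2 (volume : Measure Plane)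

/-! ## Fourier transform

The frequencies are `(ξ, q, τ)` with `q = k / λ ∈ ℤ / λ`; they are written as pairs `(w, k)` with
`w = (ξ, τ) ∈ ℝ²` and `k ∈ ℤ`. -/

/-- The Fourier transform of an integrable function on `ℝ × 𝕋_λ × ℝ`:
`∫∫∫ exp (-i (t τ + x ξ + y q)) f (x, y, t) dy dx dt` with `q = k / λ`.
The factor `fourier (-k) y` is `exp (-i k y / λ)`. -/
def fourierInt (lam : ℝ) [Fact (0 < lam)] (f : SpaceTime lam → ℂ) (w : Plane) (k : ℤ) : ℂ :=
  ∫ p : SpaceTime lam,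
    Complex.exp (-Complex.I * ((p.1 0 * w 0 + p.1 1 * w 1 : ℝ) : ℂ)) *
      (fourier (-k) p.2 : ℂ) * f p

/-- The partial Fourier transform in `y`:
`(x, t) ↦ ∫_{𝕋_λ} exp (-i k y / λ) f (x, y, t) dy`. -/
def modeFun (lam : ℝ) [Fact (0 < lam)] (f : SpaceTime lam → ℂ) (k : ℤ) (z : Plane) : ℂ :=
  ∫ y : Torus lam, (fourier (-k) y : ℂ) * f (z, y)

theorem norm_fourier_apply {T : ℝ} (k : ℤ) (y : AddCircle T) : ‖(fourier k y : ℂ)‖ = 1 := by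
  rw [fourier_apply]; exact Circle.norm_coe _

theorem memLp_modeFun (lam : ℝ) [Fact (0 < lam)] {f : SpaceTime lam → ℂ} (hf : MemLp f 2 volume)
    (k : ℤ) : MemLp (modeFun lam f k) 2 (volume : Measure Plane) := by
  have hmeas : AEStronglyMeasurable (fun p : SpaceTime lam => (fourier (-k) p.2 : ℂ) * f p)
      volume := by
    refine AEStronglyMeasurable.mul ?_ hf.1
    exact ((map_continuous (fourier (T := 2 * π * lam) (-k))).comp
      continuous_snd).aestronglyMeasurable
  have hg : MemLp (fun p : SpaceTime lam => (fourier (-k) p.2 : ℂ) * f p) 2 volume :=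
    hf.of_le hmeas (Filter.Eventually.of_forall fun p => by
      rw [norm_mul, norm_fourier_apply, one_mul])
  refine ⟨AEStronglyMeasurable.integral_prod_right' hmeas, ?_⟩
  rw [eLpNorm_lt_top_iff_lintegral_rpow_enorm_lt_top (by norm_num) (by norm_num)]
  have h2 := hg.2
  rw [eLpNorm_lt_top_iff_lintegral_rpow_enorm_lt_top (by norm_num) (by norm_num)] at h2
  have h3 : ∫⁻ z : Plane, ∫⁻ y : Torus lam,
      ‖(fourier (-k) y : ℂ) * f (z, y)‖ₑ ^ (2 : ℝ≥0∞).toReal < ⊤ := by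
    rw [Measure.volume_eq_prod, lintegral_prod] at h2
    · exact h2
    · exact hmeas.enorm.pow_const _
  have hfib : ∀ᵐ z : Plane, AEStronglyMeasurable
      (fun y : Torus lam => (fourier (-k) y : ℂ) * f (z, y)) volume := by
    rw [Measure.volume_eq_prod] at hmeas
    exact hmeas.prodMk_left
  have hM : (volume (Set.univ : Set (Torus lam))) < ⊤ := measure_lt_top _ _
  refine lt_of_le_of_lt (lintegral_mono_ae (g := fun z => volume (Set.univ : Set (Torus lam)) *
    ∫⁻ y : Torus lam, ‖(fourier (-k) y : ℂ) * f (z, y)‖ₑ ^ (2 : ℝ≥0∞).toReal) ?_) ?_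
  · filter_upwards [hfib] with z hz
    have h4 := eLpNorm_le_eLpNorm_mul_rpow_measure_univ (p := 1) (q := 2) (by norm_num) hz
    have h5 : ‖modeFun lam f k z‖ₑ ≤ _ := (enorm_integral_le_lintegral_enorm _).trans
      ((eLpNorm_one_eq_lintegral_enorm (μ := volume)
        (f := fun y : Torus lam => (fourier (-k) y : ℂ) * f (z, y))).symm.le.trans h4)
    refine (ENNReal.rpow_le_rpow h5 (by norm_num)).trans ?_
    rw [eLpNorm_eq_lintegral_rpow_enorm_toReal (by norm_num) (by norm_num),
      ENNReal.mul_rpow_of_nonneg _ _ (by norm_num), ← ENNReal.rpow_mul, ← ENNReal.rpow_mul,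
      mul_comm]
    norm_num
  · rw [lintegral_const_mul' _ _ hM.ne]
    exact ENNReal.mul_lt_top hM h3

/-- The `k`-th partial Fourier coefficient in `y` of `u ∈ L²(ℝ × 𝕋_λ × ℝ)`, an element of
`L²(ℝ²)`. -/
def mode (lam : ℝ) [Fact (0 < lam)] (u : L2 lam) (k : ℤ) : L2Plane :=
  (memLp_modeFun lam (Lp.memLp u) k).toLp

/-- The Fourier transform `û(ξ, q, τ)` of `u ∈ L²(ℝ × 𝕋_λ × ℝ)`, with `w = (ξ, τ)`, `q = k / λ` and
the normalization of `fourierInt`. The `L²(ℝ²)` Fourier transform `𝓕` in `(x, t)` has the phase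
`exp (-2πi ⟨z, η⟩)`, so it is evaluated at `η = w / 2π`. -/
def fourierL2 (lam : ℝ) [Fact (0 < lam)] (u : L2 lam) (w : Plane) (k : ℤ) : ℂ :=
  (𝓕 (mode lam u k) : L2Plane) ((2 * π)⁻¹ • w)

/-! ## Bourgain norms -/

/-- `|(ξ, q)| = (3 ξ² + q²)^{1/2}`. -/
def absZ (ξ q : ℝ) : ℝ := √(3 * ξ ^ 2 + q ^ 2)

/-- `σ(ξ, q) = ξ³ + ξ q²`. -/
def sigma (ξ q : ℝ) : ℝ := ξ ^ 3 + ξ * q ^ 2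

/-- `⟨x⟩ = 1 + |x|`. -/
def bracket (x : ℝ) : ℝ := 1 + |x|

/-- The `X^{s,b}_λ` norm of the object whose Fourier transform is `W`:
`(λ⁻¹ ∑_{q ∈ ℤ/λ} ∫∫ ⟨τ - σ(ξ,q)⟩^{2b} ⟨|(ξ,q)|⟩^{2s} |W(ξ,q,τ)|² dξ dτ)^{1/2} ∈ [0, ∞]`. -/
def xNormHat (lam s b : ℝ) (W : Plane → ℤ → ℂ) : ℝ≥0∞ :=
  (ENNReal.ofReal lam⁻¹ * ∑' k : ℤ, ∫⁻ w : Plane,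
    ENNReal.ofReal (bracket (w 1 - sigma (w 0) (k / lam)) ^ (2 * b) *
      bracket (absZ (w 0) (k / lam)) ^ (2 * s)) * ‖W w k‖ₑ ^ 2) ^ (1 / 2 : ℝ)

/-- The `X^{s,b}_λ` norm of `u ∈ L²(ℝ × 𝕋_λ × ℝ)`. -/
def xNorm (lam : ℝ) [Fact (0 < lam)] (s b : ℝ) (u : L2 lam) : ℝ≥0∞ :=
  xNormHat lam s b (fourierL2 lam u)

/-! ## The multiplier `I` -/

/-- A radial profile `μ` of the symbol of `I`: smooth, non-increasing, equal to `1` on `r ≤ 1` and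
to `r ^ (s - 1)` on `r ≥ 2`. (Only the values at `r ≥ 0` matter.) -/
structure Profile (s : ℝ) where
  toFun : ℝ → ℝ
  smooth : ContDiff ℝ ∞ toFun
  antitone : Antitone toFun
  eq_one : ∀ r, r ≤ 1 → toFun r = 1
  eq_rpow : ∀ r, 2 ≤ r → toFun r = r ^ (s - 1)

/-- The symbol `m(ζ) = μ(|ζ| / N)`, `ζ = (ξ, q)`: it is `1` for `|ζ| ≤ N` and `(|ζ| / N) ^ (s - 1)`
for `|ζ| ≥ 2N`. -/
def symb {s : ℝ} (μ : Profile s) (N ξ q : ℝ) : ℝ := μ.toFun (absZ ξ q / N)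

theorem abs_symb_le_one {s : ℝ} (μ : Profile s) (N ξ q : ℝ) : |symb μ N ξ q| ≤ 1 := by
  have hpos : 0 < symb μ N ξ q := by
    have h1 := μ.antitone (le_max_left (absZ ξ q / N) 2)
    rw [μ.eq_rpow _ (le_max_right _ _)] at h1
    exact lt_of_lt_of_le (rpow_pos_of_pos (lt_of_lt_of_le two_pos (le_max_right _ _)) _) h1
  rw [abs_of_pos hpos]
  have h2 := μ.antitone (min_le_left (absZ ξ q / N) 1)
  rwa [μ.eq_one _ (min_le_right _ _)] at h2

/-- The symbol of `I` on the `k`-th mode in `y`, as a function of the frequency variable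
`η = (ξ, τ) / 2π` of `𝓕`. -/
def symbMode {s : ℝ} (μ : Profile s) (N lam : ℝ) (k : ℤ) (η : Plane) : ℂ :=
  (symb μ N (2 * π * η 0) (k / lam) : ℂ)

theorem continuous_symbMode {s : ℝ} (μ : Profile s) (N lam : ℝ) (k : ℤ) :
    Continuous (symbMode μ N lam k) := by
  have := μ.smooth.continuous
  unfold symbMode symb absZ
  fun_prop

theorem memLp_symbMode_mul {s : ℝ} (μ : Profile s) (N lam : ℝ) (k : ℤ) (g : L2Plane) :
    MemLp (fun η => symbMode μ N lam k η * g η) 2 (volume : Measure Plane) := by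
  refine (Lp.memLp g).of_le
    ((continuous_symbMode μ N lam k).aestronglyMeasurable.mul (Lp.memLp g).1)
    (Filter.Eventually.of_forall fun η => ?_)
  rw [norm_mul]
  refine mul_le_of_le_one_left (norm_nonneg _) ?_
  simpa [symbMode] using abs_symb_le_one μ N (2 * π * η 0) (k / lam)

/-- The action of `I` on the `k`-th mode in `y`: `f ↦ 𝓕⁻¹ (m(·, k/λ) 𝓕 f)` on `L²(ℝ²)`. -/
def opIMode {s : ℝ} (μ : Profile s) (N lam : ℝ) (k : ℤ) (f : L2Plane) : L2Plane :=
  𝓕⁻ ((memLp_symbMode_mul μ N lam k (𝓕 f)).toLp : L2Plane)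

theorem memLp_wave (lam : ℝ) [Fact (0 < lam)] (k : ℤ) (f : L2Plane) :
    MemLp (fun p : SpaceTime lam => ((2 * π * lam)⁻¹ : ℂ) * (fourier k p.2 : ℂ) * f p.1) 2
      volume := by
  have hf : MemLp (fun p : SpaceTime lam => f p.1) 2 volume :=
    (Lp.memLp f).comp_fst (volume : Measure (Torus lam))
  have hm : AEStronglyMeasurable (fun p : SpaceTime lam => (fourier k p.2 : ℂ)) volume :=
    ((map_continuous (fourier (T := 2 * π * lam) k)).comp continuous_snd).aestronglyMeasurable
  have h1 : MemLp (fun p : SpaceTime lam => (fourier k p.2 : ℂ) * f p.1) 2 volume :=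
    hf.of_le (hm.mul hf.1) (Filter.Eventually.of_forall fun p => by
      rw [norm_mul, norm_fourier_apply, one_mul])
  simpa [mul_assoc] using h1.const_mul ((2 * π * lam)⁻¹ : ℂ)

/-- The function `(x, y, t) ↦ (2πλ)⁻¹ exp (i k y / λ) f(x, t)`. -/
def wave (lam : ℝ) [Fact (0 < lam)] (k : ℤ) (f : L2Plane) : L2 lam :=
  (memLp_wave lam k f).toLp

/-- The Fourier multiplier `I` on `L²(ℝ × 𝕋_λ × ℝ)`, given by `(I u)^(ξ,q,τ) = m(ξ,q) û(ξ,q,τ)`: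
the Fourier series in `y` (convergent in `L²`) whose modes are `𝓕⁻¹ (m(·, k/λ) 𝓕 u_k)`, where `u_k`
are the modes of `u`. -/
def opI {s : ℝ} (μ : Profile s) (N lam : ℝ) [Fact (0 < lam)] (u : L2 lam) : L2 lam :=
  ∑' k : ℤ, wave lam k (opIMode μ N lam k (mode lam u k))

theorem inner_wave (lam : ℝ) [h : Fact (0 < lam)] (k : ℤ) (f : L2Plane) (u : L2 lam) :
    inner ℂ (wave lam k f) u = ((2 * π * lam)⁻¹ : ℂ) * inner ℂ f (mode lam u k) := by
  have hw : (wave lam k f : SpaceTime lam → ℂ) =ᵐ[volume] _ := (memLp_wave lam k f).coeFn_toLp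
  have hm : (mode lam u k : Plane → ℂ) =ᵐ[volume] _ :=
    (memLp_modeFun lam (Lp.memLp u) k).coeFn_toLp
  rw [L2.inner_def, L2.inner_def, ← integral_const_mul]
  have hint : Integrable (fun p : SpaceTime lam => inner ℂ (wave lam k f p) (u p)) volume :=
    L2.integrable_inner _ _
  have hint2 : Integrable (fun p : SpaceTime lam =>
      inner ℂ (((2 * π * lam)⁻¹ : ℂ) * (fourier k p.2 : ℂ) * f p.1) (u p)) volume :=
    hint.congr (by filter_upwards [hw] with p hp; rw [hp])
  rw [integral_congr_ae (g := fun p : SpaceTime lam =>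
      inner ℂ (((2 * π * lam)⁻¹ : ℂ) * (fourier k p.2 : ℂ) * f p.1) (u p))
      (by filter_upwards [hw] with p hp; rw [hp])]
  refine (integral_prod _ hint2).trans ?_
  refine integral_congr_ae ?_
  filter_upwards [hm] with z hz
  rw [hz, modeFun]
  simp only [RCLike.inner_apply]
  rw [mul_comm (∫ y, _), ← integral_const_mul, ← integral_const_mul]
  refine integral_congr_ae (Filter.Eventually.of_forall fun y => ?_)
  simp only [map_mul, fourier_neg, map_inv₀, Complex.conj_ofReal, map_ofNat]
  ring

theorem mode_wave (lam : ℝ) [h : Fact (0 < lam)] (k j : ℤ) (f : L2Plane) :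
    mode lam (wave lam k f) j = if j = k then f else 0 := by
  have hw : (wave lam k f : SpaceTime lam → ℂ) =ᵐ[volume] _ := (memLp_wave lam k f).coeFn_toLp
  have hm : (mode lam (wave lam k f) j : Plane → ℂ) =ᵐ[volume] _ :=
    (memLp_modeFun lam (Lp.memLp (wave lam k f)) j).coeFn_toLp
  have hw2 := Measure.ae_ae_of_ae_prod hw
  have hkey : (mode lam (wave lam k f) j : Plane → ℂ) =ᵐ[volume]
      fun z => (if j = k then 1 else 0) * f z := by
    filter_upwards [hm, hw2] with z hz hz2
    rw [hz, modeFun, integral_congr_ae (g := fun y : Torus lam =>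
      (((2 * π * lam)⁻¹ : ℂ) * f z) * (fourier (k - j) y : ℂ))
      (by filter_upwards [hz2] with y hy
          rw [hy, sub_eq_neg_add, fourier_add]; ring), integral_const_mul]
    have : ∫ y : Torus lam, (fourier (k - j) y : ℂ) = if j = k then (2 * π * lam : ℂ) else 0 := by
      rw [AddCircle.volume_eq_smul_haarAddCircle, integral_smul_measure,
        ENNReal.toReal_ofReal (torusPeriodPos lam).out.le]
      split_ifs with hjk
      · subst hjk; simp
      · have : (∫ y, (fourier (k - j) y : ℂ) ∂(@AddCircle.haarAddCircle (2 * π * lam) _)) = 0 := by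
          have := (orthonormal_iff_ite.1 (orthonormal_fourier (T := 2 * π * lam))) j k
          rw [ContinuousMap.inner_toLp (@AddCircle.haarAddCircle (2 * π * lam) _)
            (fourier j) (fourier k)] at this
          rw [if_neg hjk] at this
          rw [← this]
          refine integral_congr_ae (Filter.Eventually.of_forall fun y => ?_)
          simp only [sub_eq_add_neg, fourier_add, fourier_neg]
        rw [this, smul_zero]
    rw [this]
    have hne : (2 * π * lam : ℂ) ≠ 0 := by exact_mod_cast (torusPeriodPos lam).out.ne'
    split_ifs
    · rw [mul_right_comm, inv_mul_cancel₀ hne]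
    · simp
  apply Lp.ext
  split_ifs with hjk
  · filter_upwards [hkey] with z hz; rw [hz]; simp [hjk]
  · filter_upwards [hkey, Lp.coeFn_zero ℂ 2 (volume : Measure Plane)] with z hz h0
    rw [hz, h0]; simp [hjk]

/-- `wave`, normalized to be an isometry. -/
def waveIsometry (lam : ℝ) [h : Fact (0 < lam)] (k : ℤ) : L2Plane →ₗᵢ[ℂ] L2 lam where
  toFun f := ((√(2 * π * lam) : ℝ) : ℂ) • wave lam k f
  map_add' f g := by
    rw [← smul_add]; congr 1
    refine ext_inner_right ℂ fun u => ?_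
    rw [inner_add_left, inner_wave, inner_wave, inner_wave, inner_add_left, mul_add]
  map_smul' c f := by
    refine ext_inner_right ℂ fun u => ?_
    simp only [RingHom.id_apply, inner_smul_left, inner_wave]; ring
  norm_map' f := by
    have hT := (torusPeriodPos lam).out
    have h1 : inner ℂ (wave lam k f) (wave lam k f) =
      ((2 * π * lam)⁻¹ : ℂ) * inner ℂ f f := by rw [inner_wave, mode_wave, if_pos rfl]
    rw [inner_self_eq_norm_sq_to_K, inner_self_eq_norm_sq_to_K] at h1
    have h2 : ‖wave lam k f‖ ^ 2 = (2 * π * lam)⁻¹ * ‖f‖ ^ 2 := by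
      apply Complex.ofReal_injective; push_cast; exact h1
    show ‖((√(2 * π * lam) : ℝ) : ℂ) • wave lam k f‖ = ‖f‖
    rw [norm_smul, Complex.norm_real, norm_of_nonneg (sqrt_nonneg _)]
    have h3 : (√(2 * π * lam) * ‖wave lam k f‖) ^ 2 = ‖f‖ ^ 2 := by
      rw [mul_pow, sq_sqrt hT.le, h2, mul_inv_cancel_left₀ hT.ne']
    exact (sq_eq_sq₀ (by positivity) (by positivity)).1 h3

theorem orthogonalFamily_wave (lam : ℝ) [h : Fact (0 < lam)] :
    OrthogonalFamily ℂ (fun _ : ℤ => L2Plane) (waveIsometry lam) := by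
  intro k j hkj f g
  show inner ℂ (((√(2 * π * lam) : ℝ) : ℂ) • wave lam k f)
    (((√(2 * π * lam) : ℝ) : ℂ) • wave lam j g) = 0
  rw [inner_smul_left, inner_smul_right, inner_wave, mode_wave, if_neg hkj]
  simp

theorem summable_norm_sq_mode (lam : ℝ) [h : Fact (0 < lam)] (u : L2 lam) :
    Summable fun k => ‖mode lam u k‖ ^ 2 := by
  have hT := (torusPeriodPos lam).out
  refine summable_of_sum_le (c := (2 * π * lam) * ‖u‖ ^ 2) (fun k => by positivity) fun S => ?_
  set r : ℝ := √(2 * π * lam)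
  have hr : r ^ 2 = 2 * π * lam := sq_sqrt hT.le
  have hr0 : 0 < r := sqrt_pos.2 hT
  have hi : ∀ k f, inner ℂ (waveIsometry lam k f) u = ((r⁻¹ : ℝ) : ℂ) * inner ℂ f (mode lam u k) := by
    intro k f
    show inner ℂ ((r : ℂ) • wave lam k f) u = _
    rw [inner_smul_left, inner_wave, ← mul_assoc]
    congr 1
    have : ((2 * π * lam)⁻¹ : ℂ) = ((r ^ 2 : ℝ) : ℂ)⁻¹ := by rw [hr]; push_cast; rfl
    have hc : (r : ℂ) ≠ 0 := by exact_mod_cast hr0.ne'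
    rw [this, Complex.conj_ofReal]; push_cast; field_simp
  set v := ∑ k ∈ S, waveIsometry lam k (mode lam u k)
  have hv : ‖v‖ ^ 2 = ∑ k ∈ S, ‖mode lam u k‖ ^ 2 := (orthogonalFamily_wave lam).norm_sum _ _
  have hvu : inner ℂ v u = ((r⁻¹ * ∑ k ∈ S, ‖mode lam u k‖ ^ 2 : ℝ) : ℂ) := by
    rw [sum_inner, Finset.sum_congr rfl fun k _ => hi k (mode lam u k), ← Finset.mul_sum]
    push_cast
    congr 1
    exact Finset.sum_congr rfl fun k _ => inner_self_eq_norm_sq_to_K _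
  have hcs := norm_inner_le_norm (𝕜 := ℂ) v u
  rw [hvu, ← hv, Complex.norm_real, norm_of_nonneg (by positivity)] at hcs
  rw [← hv]
  refine le_of_le_of_eq ?_ ((mul_pow r ‖u‖ 2).trans (congrArg (· * ‖u‖ ^ 2) hr))
  refine pow_le_pow_left₀ (norm_nonneg _) ?_ 2
  rcases (norm_nonneg v).eq_or_lt with h0 | h0
  · rw [← h0]; positivity
  · have : r⁻¹ * ‖v‖ ≤ ‖u‖ := by
      refine le_of_mul_le_mul_right ?_ h0
      nlinarith
    rwa [inv_mul_le_iff₀ hr0] at this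

theorem norm_opIMode_le {s : ℝ} (μ : Profile s) (N lam : ℝ) (k : ℤ) (f : L2Plane) :
    ‖opIMode μ N lam k f‖ ≤ ‖f‖ := by
  have h1 : ‖opIMode μ N lam k f‖ = ‖((memLp_symbMode_mul μ N lam k (𝓕 f)).toLp : L2Plane)‖ :=
    (Lp.fourierTransformₗᵢ Plane ℂ).symm.norm_map _
  rw [h1, ← Lp.norm_fourier_eq f]
  refine Lp.norm_le_norm_of_ae_le ?_
  filter_upwards [(memLp_symbMode_mul μ N lam k (𝓕 f)).coeFn_toLp] with η hη
  rw [hη, norm_mul]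
  refine mul_le_of_le_one_left (norm_nonneg _) ?_
  simpa [symbMode] using abs_symb_le_one μ N (2 * π * η 0) (k / lam)

/-- The series defining `I u` converges in `L²`. -/
theorem hasSum_opI {s : ℝ} (μ : Profile s) (N lam : ℝ) [Fact (0 < lam)] (u : L2 lam) :
    HasSum (fun k : ℤ => wave lam k (opIMode μ N lam k (mode lam u k))) (opI μ N lam u) := by
  refine Summable.hasSum ?_
  have hT := (torusPeriodPos lam).out
  have h1 : Summable fun k : ℤ => ‖opIMode μ N lam k (mode lam u k)‖ ^ 2 :=
    (summable_norm_sq_mode lam u).of_nonneg_of_le (fun k => by positivity)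
      fun k => pow_le_pow_left₀ (norm_nonneg _) (norm_opIMode_le μ N lam k _) 2
  have h2 := ((orthogonalFamily_wave lam).summable_iff_norm_sq_summable _).2 h1
  have hc : ((√(2 * π * lam) : ℝ) : ℂ) ≠ 0 := by exact_mod_cast (sqrt_pos.2 hT).ne'
  have h3 := h2.const_smul (((√(2 * π * lam) : ℝ) : ℂ)⁻¹)
  refine h3.congr fun k => ?_
  exact (inv_smul_smul₀ hc (wave lam k (opIMode μ N lam k (mode lam u k))))

theorem mode_opI {s : ℝ} (μ : Profile s) (N lam : ℝ) [Fact (0 < lam)] (u : L2 lam) (j : ℤ) :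
    mode lam (opI μ N lam u) j = opIMode μ N lam j (mode lam u j) := by
  have hT := (torusPeriodPos lam).out
  refine ext_inner_left ℂ fun f => ?_
  have hne : ((2 * π * lam)⁻¹ : ℂ) ≠ 0 := by
    apply inv_ne_zero; exact_mod_cast hT.ne'
  apply mul_left_cancel₀ hne
  rw [← inner_wave]
  have h1 := (hasSum_opI μ N lam u).mapL (innerSL ℂ (wave lam j f))
  have h2 : HasSum (fun k : ℤ => if k = j then
      ((2 * π * lam)⁻¹ : ℂ) * inner ℂ f (opIMode μ N lam j (mode lam u j)) else 0) _ :=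
    hasSum_ite_eq j _
  refine h1.unique ?_
  refine (congrArg (fun F => HasSum F _) (funext fun k => ?_)).mpr h2
  rw [innerSL_apply_apply, inner_wave, mode_wave]
  by_cases hk : k = j
  · subst hk; simp
  · rw [if_neg (Ne.symm hk), if_neg hk]; simp

/-- The defining property of `I`: `(I u)^ = m û`. -/
theorem fourierL2_opI {s : ℝ} (μ : Profile s) (N lam : ℝ) [Fact (0 < lam)] (u : L2 lam) (k : ℤ) :
    (fun w => fourierL2 lam (opI μ N lam u) w k) =ᵐ[volume]
      fun w => (symb μ N (w 0) (k / lam) : ℂ) * fourierL2 lam u w k := by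
  have h1 : (𝓕 (mode lam (opI μ N lam u) k) : L2Plane) =
      (memLp_symbMode_mul μ N lam k (𝓕 (mode lam u k))).toLp := by
    rw [mode_opI, opIMode, FourierTransform.fourier_fourierInv_eq]
  have h2 : ((𝓕 (mode lam (opI μ N lam u) k) : L2Plane) : Plane → ℂ) =ᵐ[volume]
      fun η => symbMode μ N lam k η * (𝓕 (mode lam u k) : L2Plane) η := by
    rw [h1]; exact (memLp_symbMode_mul μ N lam k (𝓕 (mode lam u k))).coeFn_toLp
  have h3 : Measure.QuasiMeasurePreserving (fun w : Plane => (2 * π)⁻¹ • w) volume volume := by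
    refine ⟨by fun_prop, ?_⟩
    rw [Measure.map_addHaar_smul _ (by positivity)]
    exact Measure.smul_absolutelyContinuous
  filter_upwards [h3.ae h2] with w hw
  simp only [fourierL2]
  rw [hw]
  simp only [symbMode]
  congr 3
  simp
  field_simp

/-! ## The commutator -/

/-- The Fourier transform of `∂_x (I u · I v - I (u v))`, that is
`i ξ ((I u · I v)^ - m (u v)^)`. Both products are pointwise products of functions on
`ℝ × 𝕋_λ × ℝ`, and are integrable because all factors lie in `L²`. -/
def commutatorHat {s : ℝ} (μ : Profile s) (N lam : ℝ) [Fact (0 < lam)] (u v : L2 lam)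
    (w : Plane) (k : ℤ) : ℂ :=
  Complex.I * (w 0 : ℂ) *
    (fourierInt lam (fun p => opI μ N lam u p * opI μ N lam v p) w k -
      (symb μ N (w 0) (k / lam) : ℂ) * fourierInt lam (fun p => u p * v p) w k)

end ZKCylinder

end

/-! After Plancherel the estimate is a weighted convolution bound on frequency space (`ConvBound`).
Write ζ₀ = ζ₁ + ζ₂ for the output and input frequencies and m₀, m₁, m₂ for their symbols. The kernel
`kern` collects the ξ of the derivative, the Sobolev weights, the modulation weights and the
relative commutator |m₁m₂ - m₀| / (m₁m₂), which appears because the norms on the right are those of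
Iu and Iv. By Cauchy-Schwarz it is enough to bound the integral of the squared kernel with any one
of the three frequencies fixed. As σ is odd, all three choices give the same kind of fibre integral,
provided the output modulation carries the same exponent as the inputs. Integrating in τ leaves ⟨c -
phase⟩^{-p} with p = 1 + 2δ₂ > 1, to be integrated in ξ and summed in q.

Put M = 1 + |ζ₁| + |ζ₂|. The commutator vanishes when |ζ₁| + |ζ₂| ≤ N. Otherwise 1/m grows at most
like the power 1/10, because s > 9/10, and a mean value argument handles one very low input. The
square of the frequency weight is then O(M² N^{-1/5} (⟨ζ₁⟩^{-3/2} + ⟨ζ₂⟩^{-3/2})), see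
`exists_multWeight_sq_le`; its square root is the claimed gain N^{-1/10}.

Frequency space is cut into regions. If the output modulation exceeds M^10, its weight pays for
everything. If it does not, a factor M^{1/20} buys symmetric modulation weights
(`modulation_weight_le`). If two of the |ζᵢ|² differ by a multiple of M², the phase has ξ-derivative
of size M² along the fibre where their sum or difference is fixed, and each ξ-integral is O(M^{-2})
(`lintegral_jap_transversal`). For the two inputs the q-sum converges by the 3/2-decay. For the
output and one input, both inputs may be taken comparable to M, and the remaining M^{1/2} loses
against M^{-2} times about M values of q per unit of mesh weight.

In the remaining region the triangle of frequencies is nearly equilateral. The phase is a quadratic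
polynomial in (ξ, q), nondegenerate when the fixed frequency (X, Q) satisfies 3X² ≠ Q²
(`tsum_lintegral_jap_nondegenerate`). In the coordinates (√3 ξ, q) the quantity 3ξ² - q² is |ζ|² cos
2θ, and a turn by 60° cannot preserve smallness of cos 2θ. Hence either the output or the first
input is far from the degenerate cone (`nondegenerate_of_equilateral`), and that one is fixed. -/

noncomputable section

namespace ZKCylinder

/-! ### Convolution bounds from square integrable kernels. -/

section Schur

variable {G : Type*} [MeasurableSpace G]

/-- The Cauchy-Schwarz inequality for lower integrals, in squared form. -/
theorem sq_lintegral_mul_le (ν : Measure G) {f g : G → ℝ≥0∞} (hf : AEMeasurable f ν)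
    (hg : AEMeasurable g ν) :
    (∫⁻ x, f x * g x ∂ν) ^ 2 ≤ (∫⁻ x, f x ^ 2 ∂ν) * ∫⁻ x, g x ^ 2 ∂ν := by
  have h := ENNReal.lintegral_mul_le_Lp_mul_Lq ν Real.HolderConjugate.two_two hf hg
  have h2 : ∀ a : ℝ≥0∞, (a ^ (1 / (2 : ℝ))) ^ 2 = a := fun a => by
    rw [← ENNReal.rpow_natCast, ← ENNReal.rpow_mul]; norm_num
  calc (∫⁻ x, f x * g x ∂ν) ^ 2 ≤ _ := pow_le_pow_left' h 2
    _ = _ := by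
      rw [mul_pow, h2, h2]
      simp only [ENNReal.rpow_two]

/-- Duality: an `L²` bound can be tested against `L²` functions. -/
theorem lintegral_sq_le_of_forall (ν : Measure G) [SigmaFinite ν] {g : G → ℝ≥0∞}
    (hg : Measurable g) (A : ℝ≥0∞)
    (h : ∀ f : G → ℝ≥0∞, Measurable f → (∫⁻ x, f x * g x ∂ν) ^ 2 ≤ A * ∫⁻ x, f x ^ 2 ∂ν) :
    ∫⁻ x, g x ^ 2 ∂ν ≤ A := by
  set S := spanningSets ν
  -- Truncating in height and to a set of finite measure makes the test function square integrable,
  -- so that its norm can be cancelled; `g` itself might have infinite norm.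
  set f : ℕ → G → ℝ≥0∞ := fun n => (S n).indicator fun x => min (g x) n
  have hfm : ∀ n, Measurable (f n) := fun n =>
    (hg.min measurable_const).indicator (measurableSet_spanningSets ν n)
  have hfg : ∀ n x, f n x ≤ g x := fun n x => by
    by_cases hx : x ∈ S n
    · simp only [f, Set.indicator_of_mem hx]; exact min_le_left _ _
    · simp only [f, Set.indicator_of_notMem hx]; exact zero_le
  have hfin : ∀ n, ∫⁻ x, f n x ^ 2 ∂ν ≠ ⊤ := fun n => by
    have : ∫⁻ x, f n x ^ 2 ∂ν ≤ (n : ℝ≥0∞) ^ 2 * ν (S n) := by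
      rw [← lintegral_indicator_const (measurableSet_spanningSets ν n)]
      refine lintegral_mono fun x => ?_
      by_cases hx : x ∈ S n
      · rw [Set.indicator_of_mem (s := spanningSets ν n) hx]
        simp only [f, Set.indicator_of_mem hx]; exact pow_le_pow_left' (min_le_right (g x) n) 2
      · simp only [f, Set.indicator_of_notMem hx]; simp
    exact (this.trans_lt (ENNReal.mul_lt_top (by simp)
      (measure_spanningSets_lt_top ν n))).ne
  have hle : ∀ n, ∫⁻ x, f n x ^ 2 ∂ν ≤ A := fun n => by
    set X := ∫⁻ x, f n x ^ 2 ∂ν with hX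
    have h1 : X ^ 2 ≤ A * X :=
      (pow_le_pow_left' (lintegral_mono fun x => by
        rw [sq]; exact mul_le_mul_right (hfg n x) _) 2).trans (h (f n) (hfm n))
    rcases eq_or_ne X 0 with h0 | h0
    · rw [h0]; exact zero_le
    · rw [sq] at h1
      exact (ENNReal.mul_le_mul_iff_left h0 (hfin n)).1 h1
  have hsup : ∀ x, g x ^ 2 = ⨆ n, f n x ^ 2 := fun x => by
    refine le_antisymm ?_ (iSup_le fun n => pow_le_pow_left' (hfg n x) 2)
    have hmem : ∀ n, spanningSetsIndex ν x ≤ n → x ∈ S n := fun n hn =>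
      monotone_spanningSets ν hn (mem_spanningSetsIndex ν x)
    have ht : Filter.Tendsto (fun n : ℕ => f n x ^ 2) Filter.atTop (nhds (g x ^ 2)) := by
      refine (ENNReal.continuous_pow 2).continuousAt.tendsto.comp ?_
      have : Filter.Tendsto (fun n : ℕ => min (g x) (n : ℝ≥0∞)) Filter.atTop
          (nhds (min (g x) ⊤)) := tendsto_const_nhds.min ENNReal.tendsto_nat_nhds_top
      rw [min_eq_left le_top] at this
      refine this.congr' ?_
      filter_upwards [Filter.eventually_ge_atTop (spanningSetsIndex ν x)] with n hn
      simp only [f, Set.indicator_of_mem (hmem n hn)]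
    exact le_of_tendsto' ht fun n => le_iSup (fun n => f n x ^ 2) n
  simp only [hsup]
  rw [lintegral_iSup (fun n => (hfm n).pow_const 2)]
  · exact iSup_le hle
  · intro n m hnm x
    refine pow_le_pow_left' ?_ 2
    by_cases hx : x ∈ S n
    · have hx' : x ∈ S m := monotone_spanningSets ν hnm hx
      simp only [f, Set.indicator_of_mem hx, Set.indicator_of_mem hx']
      exact min_le_min le_rfl (by exact_mod_cast hnm)
    · simp only [f, Set.indicator_of_notMem hx]; exact zero_le

variable [AddCommGroup G] [MeasurableAdd₂ G] [MeasurableNeg G] (ν : Measure G) [SigmaFinite ν]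
  [ν.IsAddLeftInvariant] {K : G → G → ℝ≥0∞} {F₁ F₂ : G → ℝ≥0∞} {A : ℝ≥0∞}

/-- Weighted convolution bound, with the kernel square integrable in the inner variable. -/
theorem lintegral_sq_conv_le_of_fst (hK : Measurable fun x : G × G => K x.1 x.2)
    (h₁ : Measurable F₁) (h₂ : Measurable F₂) (hA : ∀ p, ∫⁻ p₁, K p p₁ ^ 2 ∂ν ≤ A) :
    ∫⁻ p, (∫⁻ p₁, K p p₁ * (F₁ p₁ * F₂ (p - p₁)) ∂ν) ^ 2 ∂ν ≤
      A * ((∫⁻ p, F₁ p ^ 2 ∂ν) * ∫⁻ p, F₂ p ^ 2 ∂ν) := by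
  have hm : Measurable fun x : G × G => F₁ x.2 * F₂ (x.1 - x.2) :=
    (h₁.comp measurable_snd).mul (h₂.comp (measurable_fst.sub measurable_snd))
  calc _ ≤ ∫⁻ p, A * ∫⁻ p₁, (F₁ p₁ * F₂ (p - p₁)) ^ 2 ∂ν ∂ν := by
        refine lintegral_mono fun p => ?_
        refine (sq_lintegral_mul_le ν (hK.comp measurable_prodMk_left).aemeasurable
          (hm.comp measurable_prodMk_left).aemeasurable).trans ?_
        exact mul_le_mul_left (hA p) _
    _ = A * ∫⁻ p₁, F₁ p₁ ^ 2 * ∫⁻ p, F₂ (p - p₁) ^ 2 ∂ν ∂ν := by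
        rw [lintegral_const_mul _ (hm.pow_const 2).lintegral_prod_right',
          lintegral_lintegral_swap (hm.pow_const 2).aemeasurable]
        congr 1
        refine lintegral_congr fun p₁ => ?_
        simp only [mul_pow]
        rw [lintegral_const_mul _ (by fun_prop)]
    _ = _ := by
        congr 1
        have : ∀ p₁, ∫⁻ p, F₂ (p - p₁) ^ 2 ∂ν = ∫⁻ p, F₂ p ^ 2 ∂ν := fun p₁ =>
          lintegral_sub_right_eq_self (fun p => F₂ p ^ 2) p₁
        simp only [this]
        rw [lintegral_mul_const _ (h₁.pow_const 2)]

/-- Weighted convolution bound, with the kernel square integrable in the output variable. -/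
theorem lintegral_sq_conv_le_of_snd [ν.IsNegInvariant] (hK : Measurable fun x : G × G => K x.1 x.2)
    (h₁ : Measurable F₁) (h₂ : Measurable F₂) (hA : ∀ p₁, ∫⁻ p, K p p₁ ^ 2 ∂ν ≤ A) :
    ∫⁻ p, (∫⁻ p₁, K p p₁ * (F₁ p₁ * F₂ (p - p₁)) ∂ν) ^ 2 ∂ν ≤
      A * ((∫⁻ p, F₁ p ^ 2 ∂ν) * ∫⁻ p, F₂ p ^ 2 ∂ν) := by
  have hm : Measurable fun x : G × G => K x.1 x.2 * (F₁ x.2 * F₂ (x.1 - x.2)) :=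
    hK.mul ((h₁.comp measurable_snd).mul (h₂.comp (measurable_fst.sub measurable_snd)))
  -- Tested against `f` the form becomes trilinear, and Cauchy-Schwarz may be used in `p₁` first and
  -- in `p` afterwards, so that the kernel is squared at fixed `p₁`.
  refine lintegral_sq_le_of_forall ν hm.lintegral_prod_right' _ fun f hf => ?_
  have hm2 : Measurable fun x : G × G => f x.1 * (K x.1 x.2 * (F₁ x.2 * F₂ (x.1 - x.2))) :=
    (hf.comp measurable_fst).mul hm
  have hm3 : Measurable fun x : G × G => f x.1 * F₂ (x.1 - x.2) :=
    (hf.comp measurable_fst).mul (h₂.comp (measurable_fst.sub measurable_snd))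
  have hK' : ∀ p₁, Measurable fun p => K p p₁ := fun p₁ => hK.comp measurable_prodMk_right
  have hm4 : ∀ p₁, Measurable fun p => f p * F₂ (p - p₁) := fun p₁ =>
    hm3.comp measurable_prodMk_right
  have hin : Measurable fun p₁ => ∫⁻ p, K p p₁ * (f p * F₂ (p - p₁)) ∂ν :=
    (hK.mul hm3).lintegral_prod_left'
  calc (∫⁻ p, f p * ∫⁻ p₁, K p p₁ * (F₁ p₁ * F₂ (p - p₁)) ∂ν ∂ν) ^ 2
      = (∫⁻ p, ∫⁻ p₁, f p * (K p p₁ * (F₁ p₁ * F₂ (p - p₁))) ∂ν ∂ν) ^ 2 := by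
        congr 1
        refine lintegral_congr fun p => ?_
        exact (lintegral_const_mul _ (hm.comp measurable_prodMk_left)).symm
    _ = (∫⁻ p₁, F₁ p₁ * ∫⁻ p, K p p₁ * (f p * F₂ (p - p₁)) ∂ν ∂ν) ^ 2 := by
        rw [lintegral_lintegral_swap hm2.aemeasurable]
        congr 1
        refine lintegral_congr fun p₁ => ?_
        refine Eq.trans ?_ (lintegral_const_mul _ ((hK' p₁).mul (hm4 p₁)))
        refine lintegral_congr fun p => ?_
        exact mul_left_comm _ _ _ |>.trans (by ring)
    _ ≤ (∫⁻ p, F₁ p ^ 2 ∂ν) *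
        ∫⁻ p₁, (∫⁻ p, K p p₁ * (f p * F₂ (p - p₁)) ∂ν) ^ 2 ∂ν :=
        sq_lintegral_mul_le ν h₁.aemeasurable hin.aemeasurable
    _ ≤ (∫⁻ p, F₁ p ^ 2 ∂ν) * ∫⁻ p₁, A * ∫⁻ p, (f p * F₂ (p - p₁)) ^ 2 ∂ν ∂ν := by
        refine mul_le_mul_right (lintegral_mono fun p₁ => ?_) _
        refine (sq_lintegral_mul_le ν (hK' p₁).aemeasurable (hm4 p₁).aemeasurable).trans ?_
        exact mul_le_mul_left (hA p₁) _
    _ = (∫⁻ p, F₁ p ^ 2 ∂ν) * (A * ∫⁻ p, f p ^ 2 * ∫⁻ p₁, F₂ (p - p₁) ^ 2 ∂ν ∂ν) := by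
        rw [lintegral_const_mul _ (hm3.pow_const 2).lintegral_prod_left',
          ← lintegral_lintegral_swap (hm3.pow_const 2).aemeasurable]
        congr 2
        refine lintegral_congr fun p => ?_
        simp only [mul_pow]
        rw [lintegral_const_mul _ (by fun_prop)]
    _ = A * ((∫⁻ p, F₁ p ^ 2 ∂ν) * ∫⁻ p, F₂ p ^ 2 ∂ν) * ∫⁻ p, f p ^ 2 ∂ν := by
        have : ∀ p, ∫⁻ p₁, F₂ (p - p₁) ^ 2 ∂ν = ∫⁻ p, F₂ p ^ 2 ∂ν := fun p =>
          lintegral_sub_left_eq_self (fun p => F₂ p ^ 2) p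
        simp only [this]
        rw [lintegral_mul_const _ (hf.pow_const 2)]
        ring

/-- Weighted convolution bound, with the kernel square integrable along `p - p₁ = const`. -/
theorem lintegral_sq_conv_le_of_sub [ν.IsNegInvariant] (hK : Measurable fun x : G × G => K x.1 x.2)
    (h₁ : Measurable F₁) (h₂ : Measurable F₂) (hA : ∀ p₂, ∫⁻ p, K p (p - p₂) ^ 2 ∂ν ≤ A) :
    ∫⁻ p, (∫⁻ p₁, K p p₁ * (F₁ p₁ * F₂ (p - p₁)) ∂ν) ^ 2 ∂ν ≤
      A * ((∫⁻ p, F₁ p ^ 2 ∂ν) * ∫⁻ p, F₂ p ^ 2 ∂ν) := by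
  have hK' : Measurable fun x : G × G => K x.1 (x.1 - x.2) :=
    hK.comp (measurable_fst.prodMk (measurable_fst.sub measurable_snd))
  have h := lintegral_sq_conv_le_of_snd ν hK' h₂ h₁ hA
  rw [mul_comm (∫⁻ p, F₁ p ^ 2 ∂ν)]
  convert h using 4 with p
  -- The reflection `p₁ ↦ p - p₁` exchanges the two factors, reducing to the preceding bound.
  rw [← lintegral_sub_left_eq_self _ p]
  refine lintegral_congr fun p₁ => ?_
  rw [sub_sub_cancel, mul_comm (F₁ _)]

end Schur

/-! ### Integrals of ⟨·⟩^{-p} along lines, expanding maps and parabolas. -/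

/-- The weight `⟨x⟩^{-p}`. -/
def jap (p x : ℝ) : ℝ≥0∞ := ENNReal.ofReal (bracket x ^ (-p))

/-- The total mass of `⟨x⟩^{-p}`. -/
def japInt (p : ℝ) : ℝ≥0∞ := ∫⁻ x : ℝ, jap p x

theorem one_le_bracket (x : ℝ) : 1 ≤ bracket x := by
  unfold bracket; linarith [abs_nonneg x]

theorem bracket_pos (x : ℝ) : 0 < bracket x := one_pos.trans_le (one_le_bracket x)

@[fun_prop]
theorem continuous_bracket : Continuous bracket := by
  unfold bracket; fun_prop

@[fun_prop]
theorem measurable_bracket : Measurable bracket := continuous_bracket.measurable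

@[fun_prop]
theorem measurable_jap (p : ℝ) : Measurable (jap p) := by
  unfold jap; fun_prop

theorem japInt_lt_top {p : ℝ} (hp : 1 < p) : japInt p < ⊤ := by
  have := finite_integral_one_add_norm (E := ℝ) (μ := volume) (r := p) (by simpa using hp)
  simpa [japInt, jap, bracket] using this

theorem jap_le_one {p : ℝ} (hp : 0 ≤ p) (x : ℝ) : jap p x ≤ 1 := by
  rw [jap, ← ENNReal.ofReal_one]
  exact ENNReal.ofReal_le_ofReal (rpow_le_one_of_one_le_of_nonpos (one_le_bracket x) (by linarith))

theorem jap_le_mul {p C x y : ℝ} (hp : 0 ≤ p) (hC : 0 < C) (h : bracket y ≤ C * bracket x) :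
    jap p x ≤ ENNReal.ofReal (C ^ p) * jap p y := by
  rw [jap, jap, ← ENNReal.ofReal_mul (by positivity)]
  refine ENNReal.ofReal_le_ofReal ?_
  have hx := bracket_pos x
  have hy := bracket_pos y
  rw [rpow_neg hx.le, rpow_neg hy.le, ← div_eq_mul_inv, le_div_iff₀ (by positivity),
    inv_mul_le_iff₀ (by positivity), mul_comm, ← mul_rpow hC.le hx.le]
  exact rpow_le_rpow hy.le h hp

theorem jap_neg (p x : ℝ) : jap p (-x) = jap p x := by simp [jap, bracket]

theorem lintegral_jap_affine (p : ℝ) {a : ℝ} (ha : a ≠ 0) (b : ℝ) :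
    ∫⁻ x : ℝ, jap p (a * x + b) = ENNReal.ofReal |a|⁻¹ * japInt p := by
  have h1 : ∫⁻ x : ℝ, jap p (a * x + b) =
      ∫⁻ y, jap p (y + b) ∂(Measure.map (a * ·) volume) := by
    rw [lintegral_map (by fun_prop) (by fun_prop)]
  rw [h1, Real.map_volume_mul_left ha, lintegral_smul_measure, abs_inv, smul_eq_mul,
    lintegral_add_right_eq_self (fun y => jap p y) b, japInt]

/-- If `h` expands distances by `B` on `S` then `⟨h - c⟩^{-p}` has mass `O(1/B)` on `S`. -/
theorem lintegral_jap_expanding {p : ℝ} (hp : 0 ≤ p) {S : Set ℝ} {h : ℝ → ℝ} {B : ℝ} (hB : 0 < B)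
    (hS : ∀ x ∈ S, ∀ y ∈ S, B * |x - y| ≤ |h x - h y|) (c : ℝ) :
    ∫⁻ x, S.indicator (fun x => jap p (c - h x)) x ≤
      ENNReal.ofReal (2 ^ p) * (ENNReal.ofReal B⁻¹ * japInt p) := by
  rcases S.eq_empty_or_nonempty with rfl | hne
  · simp
  have hbdd : BddBelow ((fun x => |c - h x|) '' S) := ⟨0, by
    rintro _ ⟨x, -, rfl⟩; exact abs_nonneg _⟩
  -- A minimizer of |c - h| on `S` need not exist; a point within 1 of the infimum suffices, since
  -- the 1 in the bracket absorbs the error. Then B|x - y| ≤ 2|c - h x| + 1 on `S`.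
  obtain ⟨_, ⟨y, hy, rfl⟩, hlt⟩ := exists_lt_of_csInf_lt (hne.image fun x => |c - h x|)
    (lt_add_one (sInf ((fun x => |c - h x|) '' S)))
  calc _ ≤ ∫⁻ x, ENNReal.ofReal (2 ^ p) * jap p (B * x + -(B * y)) := by
        refine lintegral_mono fun x => ?_
        by_cases hx : x ∈ S
        · rw [Set.indicator_of_mem hx]
          refine jap_le_mul hp two_pos ?_
          have h1 : sInf ((fun x => |c - h x|) '' S) ≤ |c - h x| :=
            csInf_le hbdd ⟨x, hx, rfl⟩
          have h2 := hS x hx y hy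
          have h3 : |h x - h y| ≤ |c - h x| + |c - h y| := by
            have := abs_sub (c - h y) (c - h x)
            rw [show c - h y - (c - h x) = h x - h y by ring] at this
            linarith
          have h4 : |B * x + -(B * y)| = B * |x - y| := by
            rw [← mul_neg, ← mul_add, abs_mul, abs_of_pos hB, sub_eq_add_neg]
          simp only at hlt
          unfold bracket
          rw [h4]
          linarith
        · rw [Set.indicator_of_notMem hx]; exact zero_le
    _ = _ := by
        rw [lintegral_const_mul _ (by fun_prop), lintegral_jap_affine p hB.ne', abs_of_pos hB]

/-- The convolution of `⟨x⟩^{-p}` with itself is `O(⟨x⟩^{-p})`. -/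
theorem lintegral_jap_mul_jap {p : ℝ} (hp : 0 ≤ p) (a b : ℝ) :
    ∫⁻ t : ℝ, jap p (t - a) * jap p (b - t) ≤
      ENNReal.ofReal (2 ^ p) * (2 * japInt p) * jap p (b - a) := by
  have hpt : ∀ t, jap p (t - a) * jap p (b - t) ≤
      ENNReal.ofReal (2 ^ p) * jap p (b - a) *
        (jap p (1 * t + -a) + jap p (-1 * t + b)) := fun t => by
    have e1 : 1 * t + -a = t - a := by ring
    have e2 : -1 * t + b = b - t := by ring
    rw [e1, e2]
    have htri : |b - a| ≤ |t - a| + |b - t| := by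
      have := abs_add_le (t - a) (b - t)
      rwa [show t - a + (b - t) = b - a by ring] at this
    -- The larger of the two distances is at least |b - a| / 2: its factor supplies the decay, the
    -- other one the integrability in `t`.
    rcases le_total |t - a| |b - t| with h | h
    · have : jap p (b - t) ≤ ENNReal.ofReal (2 ^ p) * jap p (b - a) :=
        jap_le_mul hp two_pos (by unfold bracket; linarith)
      calc _ ≤ jap p (t - a) * (ENNReal.ofReal (2 ^ p) * jap p (b - a)) :=
            mul_le_mul_right this _
        _ ≤ _ := by rw [mul_comm]; exact mul_le_mul_right le_self_add _
    · have : jap p (t - a) ≤ ENNReal.ofReal (2 ^ p) * jap p (b - a) :=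
        jap_le_mul hp two_pos (by unfold bracket; linarith)
      calc _ ≤ (ENNReal.ofReal (2 ^ p) * jap p (b - a)) * jap p (b - t) :=
            mul_le_mul_left this _
        _ ≤ _ := mul_le_mul_right le_add_self _
  refine (lintegral_mono hpt).trans ?_
  rw [lintegral_const_mul _ (by fun_prop), lintegral_add_left (by fun_prop),
    lintegral_jap_affine p one_ne_zero, lintegral_jap_affine p (neg_ne_zero.2 one_ne_zero)]
  simp only [abs_neg, abs_one, inv_one, ENNReal.ofReal_one, one_mul]
  rw [← two_mul]
  exact le_of_eq (by ring)

theorem lintegral_jap_abs_le (p : ℝ) {a : ℝ} (ha : 0 < a) (x₀ θ : ℝ) :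
    ∫⁻ x : ℝ, jap p (a * |x - x₀| - θ) ≤ 2 * (ENNReal.ofReal a⁻¹ * japInt p) := by
  calc _ ≤ ∫⁻ x : ℝ, (jap p (a * x + (-(a * x₀) - θ)) + jap p (-a * x + (a * x₀ - θ))) := by
        refine lintegral_mono fun x => ?_
        rcases abs_choice (x - x₀) with h | h
        · simp only [h]
          rw [show a * (x - x₀) - θ = a * x + (-(a * x₀) - θ) by ring]
          exact le_self_add
        · simp only [h]
          rw [show a * -(x - x₀) - θ = -a * x + (a * x₀ - θ) by ring]
          exact le_add_self
    _ = _ := by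
        rw [lintegral_add_left (by fun_prop), lintegral_jap_affine p ha.ne',
          lintegral_jap_affine p (neg_ne_zero.2 ha.ne'), abs_neg, abs_of_pos ha, two_mul]

/-- For a quadratic polynomial `A (x - x₀)² + Γ` the mass of `⟨·⟩^{-p}` is `O(|A|^{-1/2})` and
`O(|A Γ|^{-1/2})`. -/
theorem lintegral_jap_quadratic {p : ℝ} (hp : 0 ≤ p) {A : ℝ} (hA : A ≠ 0) (x₀ Γ : ℝ) :
    (∫⁻ x : ℝ, jap p (A * (x - x₀) ^ 2 + Γ) ≤
      ENNReal.ofReal (2 ^ p) * (2 * (ENNReal.ofReal (√|A|)⁻¹ * japInt p))) ∧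
    (Γ ≠ 0 → ∫⁻ x : ℝ, jap p (A * (x - x₀) ^ 2 + Γ) ≤
      2 * (ENNReal.ofReal (√|A| * √|Γ|)⁻¹ * japInt p)) := by
  have hA' : 0 < √|A| := sqrt_pos.2 (abs_pos.2 hA)
  -- With y = |x - x₀| the polynomial vanishes at √|A| y = √|Γ| if A and Γ have opposite signs, and
  -- θ is √|Γ|. For equal signs θ = 0 works. The first inequality is the behaviour at a double root,
  -- the second that at a simple root of slope √|A Γ|.
  obtain ⟨θ, hθ, h1, h2⟩ : ∃ θ : ℝ, 0 ≤ θ ∧ (∀ y, 0 ≤ y → (√|A| * y - θ) ^ 2 ≤ |A * y ^ 2 + Γ|) ∧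
      ∀ y, 0 ≤ y → √|Γ| * |√|A| * y - θ| ≤ |A * y ^ 2 + Γ| := by
    have hsA : √|A| ^ 2 = |A| := sq_sqrt (abs_nonneg A)
    have hsG : √|Γ| ^ 2 = |Γ| := sq_sqrt (abs_nonneg Γ)
    set a := √|A|
    set g := √|Γ|
    have hg : 0 ≤ g := sqrt_nonneg _
    have hfac : ∀ y, 0 ≤ y → (a * y - g) ^ 2 ≤ |a ^ 2 * y ^ 2 - g ^ 2| ∧
        g * |a * y - g| ≤ |a ^ 2 * y ^ 2 - g ^ 2| := fun y hy => by
      have hay : 0 ≤ a * y := by positivity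
      have e : |a ^ 2 * y ^ 2 - g ^ 2| = |a * y - g| * (a * y + g) := by
        rw [show a ^ 2 * y ^ 2 - g ^ 2 = (a * y - g) * (a * y + g) by ring, abs_mul,
          abs_of_nonneg (add_nonneg hay hg)]
      rw [e, ← sq_abs]
      have h3 : |a * y - g| ≤ a * y + g := abs_le.2 ⟨by linarith, by linarith⟩
      constructor
      · rw [sq]; exact mul_le_mul_of_nonneg_left h3 (abs_nonneg _)
      · rw [mul_comm]; exact mul_le_mul_of_nonneg_left (by linarith) (abs_nonneg _)
    rcases le_total 0 A with hA0 | hA0 <;> rcases le_total 0 Γ with hG0 | hG0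
    · refine ⟨0, le_rfl, fun y hy => ?_, fun y hy => ?_⟩
      all_goals
        rw [abs_of_nonneg hA0] at hsA
        rw [abs_of_nonneg hG0] at hsG
        rw [sub_zero, ← hsA, ← hsG, abs_of_nonneg (by positivity : 0 ≤ a ^ 2 * y ^ 2 + g ^ 2)]
      · nlinarith [sq_nonneg g]
      · rw [abs_of_nonneg (by positivity)]
        nlinarith [sq_nonneg (g - a * y), mul_nonneg hg (mul_nonneg hA'.le hy)]
    · refine ⟨g, hg, fun y hy => ?_, fun y hy => ?_⟩
      all_goals
        rw [abs_of_nonneg hA0] at hsA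
        rw [abs_of_nonpos hG0] at hsG
        rw [← hsA, show Γ = -g ^ 2 by linarith, ← sub_eq_add_neg]
      · exact (hfac y hy).1
      · exact (hfac y hy).2
    · refine ⟨g, hg, fun y hy => ?_, fun y hy => ?_⟩
      all_goals
        rw [abs_of_nonpos hA0] at hsA
        rw [abs_of_nonneg hG0] at hsG
        rw [show A = -a ^ 2 by linarith, ← hsG, ← abs_neg (_ + _),
          show -(-a ^ 2 * y ^ 2 + g ^ 2) = a ^ 2 * y ^ 2 - g ^ 2 by ring]
      · exact (hfac y hy).1
      · exact (hfac y hy).2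
    · refine ⟨0, le_rfl, fun y hy => ?_, fun y hy => ?_⟩
      all_goals
        rw [abs_of_nonpos hA0] at hsA
        rw [abs_of_nonpos hG0] at hsG
        rw [sub_zero, show A = -a ^ 2 by linarith, show Γ = -g ^ 2 by linarith, ← abs_neg (_ + _),
          show -(-a ^ 2 * y ^ 2 + -g ^ 2) = a ^ 2 * y ^ 2 + g ^ 2 by ring,
          abs_of_nonneg (by positivity : 0 ≤ a ^ 2 * y ^ 2 + g ^ 2)]
      · nlinarith [sq_nonneg g]
      · rw [abs_of_nonneg (by positivity)]
        nlinarith [sq_nonneg (g - a * y), mul_nonneg hg (mul_nonneg hA'.le hy)]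
  have habs : ∀ x, A * (x - x₀) ^ 2 + Γ = A * |x - x₀| ^ 2 + Γ := fun x => by rw [sq_abs]
  constructor
  · calc _ ≤ ∫⁻ x : ℝ, ENNReal.ofReal (2 ^ p) * jap p (√|A| * |x - x₀| - θ) := by
          refine lintegral_mono fun x => jap_le_mul hp two_pos ?_
          rw [habs]
          have := h1 |x - x₀| (abs_nonneg _)
          unfold bracket
          rw [← sq_abs] at this
          nlinarith [sq_nonneg (|√|A| * |x - x₀| - θ| - 1), sq_nonneg |√|A| * |x - x₀| - θ|]
      _ ≤ _ := by
          rw [lintegral_const_mul _ (by fun_prop)]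
          exact mul_le_mul_right (lintegral_jap_abs_le p hA' x₀ θ) _
  · intro hG
    have hG' : 0 < √|Γ| := sqrt_pos.2 (abs_pos.2 hG)
    calc _ ≤ ∫⁻ x : ℝ, jap p ((√|A| * √|Γ|) * |x - x₀| - √|Γ| * θ) := by
          refine lintegral_mono fun x => ?_
          refine (jap_le_mul (C := 1) (y := (√|A| * √|Γ|) * |x - x₀| - √|Γ| * θ) hp one_pos ?_).trans
            (by simp)
          rw [habs]
          have := h2 |x - x₀| (abs_nonneg _)
          unfold bracket
          rw [one_mul, show (√|A| * √|Γ|) * |x - x₀| - √|Γ| * θ =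
            √|Γ| * (√|A| * |x - x₀| - θ) by ring, abs_mul, abs_of_pos hG']
          linarith
      _ ≤ _ := lintegral_jap_abs_le p (by positivity) x₀ _

/-! ### Riemann sums in q and fibre integrals of the phase. -/

/-- Comparison of a Riemann sum of mesh `1/λ < 1` with an integral. -/
theorem tsum_div_le_lintegral {lam : ℝ} (hlam : 1 < lam) {f g : ℝ → ℝ≥0∞} {C : ℝ≥0∞}
    (hg : Measurable g) (h : ∀ x y, |x - y| ≤ 1 → f x ≤ C * g y) :
    ENNReal.ofReal lam⁻¹ * ∑' k : ℤ, f (k / lam) ≤ C * ∫⁻ x, g x := by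
  have h0 : 0 < lam := one_pos.trans hlam
  set I : ℤ → Set ℝ := fun k => Set.Ico (k • lam⁻¹) ((k + 1) • lam⁻¹)
  have hd : Pairwise (Function.onFun Disjoint I) := Set.pairwise_disjoint_Ico_zsmul lam⁻¹
  rw [← ENNReal.tsum_mul_left, ← lintegral_const_mul _ hg]
  calc _ ≤ ∑' k : ℤ, ∫⁻ x in I k, C * g x := by
        refine ENNReal.tsum_le_tsum fun k => ?_
        have hv : volume (I k) = ENNReal.ofReal lam⁻¹ := by
          simp only [I, Real.volume_Ico, add_smul, one_smul]
          congr 1; ring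
        calc _ = ∫⁻ _ in I k, f (k / lam) := by
              rw [setLIntegral_const, hv, mul_comm]
          _ ≤ _ := by
              refine setLIntegral_mono (by fun_prop) fun x hx => h _ _ ?_
              simp only [I, Set.mem_Ico, zsmul_eq_mul] at hx
              push_cast at hx
              have hl : lam⁻¹ ≤ 1 := inv_le_one_of_one_le₀ hlam.le
              rw [div_eq_mul_inv, abs_le]
              constructor <;> nlinarith [hx.1, hx.2]
    _ = ∫⁻ x in ⋃ k, I k, C * g x := (lintegral_iUnion (fun _ => measurableSet_Ico) hd _).symm
    _ ≤ _ := setLIntegral_le_lintegral _ _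

/-- Mesh cells are shorter than 1, so those meeting the interval stay inside its enlargement by 1 on
each side. This is the source of the `R + 1`. -/
theorem tsum_indicator_abs_le {lam : ℝ} (hlam : 1 < lam) (β R : ℝ) :
    ENNReal.ofReal lam⁻¹ * ∑' k : ℤ, {x : ℝ | |x - β| ≤ R}.indicator 1 (k / lam : ℝ) ≤
      ENNReal.ofReal (2 * (R + 1)) := by
  refine (tsum_div_le_lintegral hlam (f := {x : ℝ | |x - β| ≤ R}.indicator 1)
    (g := (Set.Icc (β - (R + 1)) (β + (R + 1))).indicator 1)
    (C := 1) (measurable_one.indicator measurableSet_Icc) fun x y hxy => ?_).trans ?_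
  · by_cases hx : |x - β| ≤ R
    · rw [Set.indicator_of_mem (s := {x : ℝ | |x - β| ≤ R}) hx, Set.indicator_of_mem]
      · simp
      · rw [abs_le] at hx hxy
        constructor <;> linarith [hx.1, hx.2, hxy.1, hxy.2]
    · rw [Set.indicator_of_notMem (s := {x : ℝ | |x - β| ≤ R}) hx]; exact zero_le
  · rw [lintegral_indicator_one measurableSet_Icc, Real.volume_Icc, one_mul]
    exact ENNReal.ofReal_le_ofReal (by linarith)

theorem tsum_jap_le {lam : ℝ} (hlam : 1 < lam) {p : ℝ} (hp : 0 ≤ p) (β : ℝ) :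
    ENNReal.ofReal lam⁻¹ * ∑' k : ℤ, jap p (k / lam - β) ≤
      ENNReal.ofReal (2 ^ p) * japInt p := by
  refine (tsum_div_le_lintegral hlam (f := fun x => jap p (x - β)) (g := fun x => jap p (x - β))
    (C := ENNReal.ofReal (2 ^ p)) (by fun_prop) fun x y hxy => ?_).trans ?_
  · refine jap_le_mul hp two_pos ?_
    have : |y - β| ≤ |x - β| + |x - y| := by
      have := abs_sub (x - β) (x - y)
      rwa [show x - β - (x - y) = y - β by ring] at this
    unfold bracket
    linarith [abs_nonneg (x - β)]
  · rw [lintegral_sub_right_eq_self (fun x => jap p x) β, japInt]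

theorem absZ_sq (x r : ℝ) : absZ x r ^ 2 = 3 * x ^ 2 + r ^ 2 := by
  rw [absZ, sq_sqrt (by positivity)]

theorem absZ_nonneg (x r : ℝ) : 0 ≤ absZ x r := sqrt_nonneg _

/-- The phase `σ(ζ) + σ(ζ' - ζ)` with `ζ = (x, r)`, `ζ' = (X, Q)`. -/
def phase (X Q x r : ℝ) : ℝ := sigma x r + sigma (X - x) (Q - r)

/-- The set of `x` with `||ζ|² - |ζ' - ζ|²| ≥ B`, where `ζ = (x, r)`, `ζ' = (X, Q)`. -/
def transversalSet (B X Q r : ℝ) : Set ℝ :=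
  {x | B ≤ |absZ x r ^ 2 - absZ (X - x) (Q - r) ^ 2|}

/-- The ξ-derivative of the phase is D = |ζ|² - |ζ' - ζ|². The cubic terms cancel, so the phase is
quadratic in `x` and its divided differences are exactly the averages of D at the two endpoints.
Hence it expands by B on each of the sets D ≥ B and D ≤ -B. -/
theorem lintegral_jap_transversal {p : ℝ} (hp : 0 ≤ p) {B : ℝ} (hB : 0 < B) (X Q r c : ℝ) :
    ∫⁻ x, (transversalSet B X Q r).indicator (fun x => jap p (c - phase X Q x r)) x ≤
      ENNReal.ofReal (2 * 2 ^ p * B⁻¹) * japInt p := by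
  set D : ℝ → ℝ := fun x => 3 * x ^ 2 + r ^ 2 - (3 * (X - x) ^ 2 + (Q - r) ^ 2)
  have hD : ∀ x y, phase X Q x r - phase X Q y r = (x - y) * ((D x + D y) / 2) := fun x y => by
    simp only [phase, sigma, D]; ring
  have hcont : Continuous fun x => jap p (c - phase X Q x r) := by
    have hpos : ∀ x : ℝ, bracket (c - phase X Q x r) ≠ 0 := fun x => (bracket_pos _).ne'
    unfold jap phase sigma
    refine ENNReal.continuous_ofReal.comp (Continuous.rpow_const ?_ fun x => Or.inl (hpos x))
    exact continuous_bracket.comp (by fun_prop)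
  have h1 := lintegral_jap_expanding hp (S := {x | B ≤ D x}) (h := fun x => phase X Q x r) hB
    (fun x hx y hy => by
      rw [hD, abs_mul, mul_comm]
      refine mul_le_mul_of_nonneg_left ?_ (abs_nonneg _)
      refine le_trans ?_ (le_abs_self _)
      simp only [Set.mem_ofPred_eq] at hx hy
      linarith) c
  have h2 := lintegral_jap_expanding hp (S := {x | B ≤ -D x}) (h := fun x => phase X Q x r) hB
    (fun x hx y hy => by
      rw [hD, abs_mul, mul_comm]
      refine mul_le_mul_of_nonneg_left ?_ (abs_nonneg _)
      refine le_trans ?_ (neg_le_abs _)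
      simp only [Set.mem_ofPred_eq] at hx hy
      linarith) c
  have hm : Measurable ({x | B ≤ D x}.indicator fun x => jap p (c - phase X Q x r)) := by
    refine hcont.measurable.indicator (measurableSet_le measurable_const ?_)
    fun_prop
  calc _ ≤ ∫⁻ x, ({x | B ≤ D x}.indicator (fun x => jap p (c - phase X Q x r)) x +
        {x | B ≤ -D x}.indicator (fun x => jap p (c - phase X Q x r)) x) := by
        refine lintegral_mono fun x => ?_
        by_cases hx : x ∈ transversalSet B X Q r
        · rw [Set.indicator_of_mem hx]
          have hx' : B ≤ |D x| := by
            simpa only [transversalSet, Set.mem_ofPred_eq, absZ_sq] using hx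
          rcases le_abs.1 hx' with h | h
          · rw [Set.indicator_of_mem (s := {x | B ≤ D x}) h]; exact le_self_add
          · rw [Set.indicator_of_mem (s := {x | B ≤ -D x}) h]; exact le_add_self
        · rw [Set.indicator_of_notMem hx]; exact zero_le
    _ ≤ _ := by
        rw [lintegral_add_left hm]
        refine (add_le_add h1 h2).trans (le_of_eq ?_)
        rw [← two_mul, ENNReal.ofReal_mul (by positivity), ENNReal.ofReal_mul (by positivity)]
        simp only [ENNReal.ofReal_ofNat]
        ring

/-- Sum over the lattice of the nondegenerate fibre integrals. -/
theorem tsum_lintegral_jap_nondegenerate {p : ℝ} (hp : 0 ≤ p) {lam : ℝ} (hlam : 1 < lam)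
    {X Q : ℝ} (hX : X ≠ 0) (hE : 3 * X ^ 2 - Q ^ 2 ≠ 0) {R M : ℝ} (hR : 0 < R) (hM : 0 ≤ M)
    (c : ℝ) :
    ENNReal.ofReal lam⁻¹ * ∑' k : ℤ, {r : ℝ | |r| ≤ M}.indicator 1 (k / lam : ℝ) *
        ∫⁻ x, jap p (c - phase X Q x (k / lam)) ≤
      ENNReal.ofReal (8 * 2 ^ p * ((R + 1) * (√|X|)⁻¹) +
        4 * ((M + 1) * (√|3 * X ^ 2 - Q ^ 2| * R)⁻¹)) * japInt p := by
  set E := 3 * X ^ 2 - Q ^ 2 with hEdef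
  have hX' : 0 < √|X| := sqrt_pos.2 (abs_pos.2 hX)
  have hE' : 0 < √|E| := sqrt_pos.2 (abs_pos.2 hE)
  -- Completing the square first in `x`, then in `r`, writes c - phase as -3X (x - x₀(r))² + D (e -
  -- (r - Q/2)²). For e ≥ 0 the constant term Γ vanishes at r = Q/2 ± β; for e < 0 it never does,
  -- and β = 0 still gives the lower bound on |Γ|.
  set D : ℝ := E / (3 * X) with hDdef
  have hD : D ≠ 0 := div_ne_zero hE (by positivity)
  set e : ℝ := (c - 2 * (X / 2) ^ 3 - X * (Q / 2) ^ 2) / D with he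
  set β : ℝ := √(max e 0) with hβ
  set x₀ : ℝ → ℝ := fun r => X / 2 - Q * (r - Q / 2) / (3 * X)
  set Γ : ℝ → ℝ := fun r => D * (e - (r - Q / 2) ^ 2)
  have hphase : ∀ x r, c - phase X Q x r = -(3 * X) * (x - x₀ r) ^ 2 + Γ r := fun x r => by
    have h1 : Γ r = (c - 2 * (X / 2) ^ 3 - X * (Q / 2) ^ 2) - D * (r - Q / 2) ^ 2 := by
      simp only [Γ, he]; field_simp
    rw [h1]
    simp only [phase, sigma, x₀, hDdef, hEdef]
    field_simp
    ring
  have hΓ : ∀ r, |D| * (|r - Q / 2| - β) ^ 2 ≤ |Γ r| := fun r => by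
    simp only [Γ]
    rw [abs_mul]
    refine mul_le_mul_of_nonneg_left ?_ (abs_nonneg _)
    rw [← sq_abs (r - Q / 2)]
    set b := |r - Q / 2|
    have hb : 0 ≤ b := abs_nonneg _
    rcases le_total 0 e with h | h
    · have hβ2 : β ^ 2 = e := by rw [hβ, max_eq_left h, sq_sqrt h]
      have hβ0 : 0 ≤ β := sqrt_nonneg _
      rw [← hβ2, show β ^ 2 - b ^ 2 = -((b - β) * (b + β)) by ring, abs_neg, abs_mul,
        abs_of_nonneg (add_nonneg hb hβ0), ← sq_abs, sq]
      exact mul_le_mul_of_nonneg_left (abs_le.2 ⟨by linarith, by linarith⟩) (abs_nonneg _)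
    · have hβ0 : β = 0 := by rw [hβ, max_eq_right h, sqrt_zero]
      rw [hβ0, sub_zero]
      refine le_trans ?_ (neg_le_abs _)
      linarith
  have hA : -(3 * X) ≠ 0 := neg_ne_zero.2 (by positivity)
  have hsA : √|X| ≤ √|(-(3 * X))| := by
    refine sqrt_le_sqrt ?_
    rw [abs_neg, abs_mul, abs_of_pos (by norm_num : (0:ℝ) < 3)]
    linarith [abs_nonneg X]
  have hnear : ∀ r, ∫⁻ x, jap p (c - phase X Q x r) ≤
      ENNReal.ofReal (2 * 2 ^ p * (√|X|)⁻¹) * japInt p := fun r => by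
    simp only [hphase]
    refine (lintegral_jap_quadratic hp hA (x₀ r) (Γ r)).1.trans ?_
    rw [ENNReal.ofReal_mul (by positivity), ENNReal.ofReal_mul (by positivity),
      ENNReal.ofReal_ofNat]
    calc _ = 2 * ENNReal.ofReal (2 ^ p) * ENNReal.ofReal (√|(-(3 * X))|)⁻¹ * japInt p := by ring
      _ ≤ _ := by gcongr
  have hfar : ∀ r, R < |(|r - Q / 2| - β)| → ∫⁻ x, jap p (c - phase X Q x r) ≤
      ENNReal.ofReal (2 * (√|E| * R)⁻¹) * japInt p := fun r hr => by
    have hD' : 0 < |D| := abs_pos.2 hD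
    have hlow : (√|D| * R) ^ 2 ≤ |Γ r| := by
      refine le_trans ?_ (hΓ r)
      rw [mul_pow, sq_sqrt hD'.le, ← sq_abs (|r - Q / 2| - β)]
      gcongr
    have hsq : √|D| * R ≤ √|Γ r| := le_sqrt_of_sq_le hlow
    have hΓ0 : Γ r ≠ 0 := by
      rw [← abs_pos]
      exact lt_of_lt_of_le (by positivity) hlow
    simp only [hphase]
    refine ((lintegral_jap_quadratic hp hA (x₀ r) (Γ r)).2 hΓ0).trans ?_
    have hprod : √|E| = √|(-(3 * X))| * √|D| := by
      rw [← sqrt_mul (abs_nonneg _), ← abs_mul]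
      congr 1
      rw [hDdef, neg_mul, abs_neg]
      congr 1
      field_simp
    rw [ENNReal.ofReal_mul (by positivity), ENNReal.ofReal_ofNat, mul_assoc]
    refine mul_le_mul_right (mul_le_mul_left (ENNReal.ofReal_le_ofReal ?_) _) _
    have hle : √|E| * R ≤ √|(-(3 * X))| * √|Γ r| := by
      rw [hprod, mul_assoc]
      exact mul_le_mul_of_nonneg_left hsq (sqrt_nonneg _)
    exact inv_anti₀ (by positivity) hle
  have hterm : ∀ r : ℝ, {r : ℝ | |r| ≤ M}.indicator 1 r * ∫⁻ x, jap p (c - phase X Q x r) ≤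
      ({r : ℝ | |r - (Q / 2 + β)| ≤ R}.indicator 1 r +
        {r : ℝ | |r - (Q / 2 - β)| ≤ R}.indicator 1 r) *
          (ENNReal.ofReal (2 * 2 ^ p * (√|X|)⁻¹) * japInt p) +
      {r : ℝ | |r - 0| ≤ M}.indicator 1 r *
        (ENNReal.ofReal (2 * (√|E| * R)⁻¹) * japInt p) := fun r => by
    -- Within R of a zero of Γ only the leading coefficient 3X helps. Elsewhere the size of Γ gives
    -- the better bound, uniformly over the |r| ≤ M.
    by_cases hr : |(|r - Q / 2| - β)| ≤ R
    · refine le_trans ?_ le_self_add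
      have hone : (1 : ℝ≥0∞) ≤ {r : ℝ | |r - (Q / 2 + β)| ≤ R}.indicator 1 r +
          {r : ℝ | |r - (Q / 2 - β)| ≤ R}.indicator 1 r := by
        rcases abs_choice (r - Q / 2) with h | h
        · rw [Set.indicator_of_mem (s := {r : ℝ | |r - (Q / 2 + β)| ≤ R})]
          · exact le_self_add
          · rw [h] at hr; rw [Set.mem_ofPred_eq]; convert hr using 2; ring
        · rw [Set.indicator_of_mem (s := {r : ℝ | |r - (Q / 2 - β)| ≤ R})]
          · exact le_add_self
          · rw [h, ← abs_neg] at hr; rw [Set.mem_ofPred_eq]; convert hr using 2; ring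
      refine mul_le_mul' (le_trans ?_ hone) (hnear r)
      by_cases hM : r ∈ {r : ℝ | |r| ≤ M}
      · rw [Set.indicator_of_mem hM]; rfl
      · rw [Set.indicator_of_notMem hM]; exact zero_le
    · refine le_trans ?_ le_add_self
      simp only [sub_zero]
      exact mul_le_mul_right (hfar r (not_le.1 hr)) _
  refine (mul_le_mul_right (ENNReal.tsum_le_tsum fun k : ℤ => hterm (k / lam)) _).trans ?_
  rw [ENNReal.tsum_add, ENNReal.tsum_mul_right, ENNReal.tsum_mul_right, ENNReal.tsum_add, mul_add,
    ← mul_assoc (ENNReal.ofReal lam⁻¹) (_ + _), ← mul_assoc (ENNReal.ofReal lam⁻¹) (∑' _, _),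
    mul_add]
  calc _ ≤ (ENNReal.ofReal (2 * (R + 1)) + ENNReal.ofReal (2 * (R + 1))) *
          (ENNReal.ofReal (2 * 2 ^ p * (√|X|)⁻¹) * japInt p) +
        ENNReal.ofReal (2 * (M + 1)) * (ENNReal.ofReal (2 * (√|E| * R)⁻¹) * japInt p) := by
        exact add_le_add (mul_le_mul' (add_le_add (tsum_indicator_abs_le hlam _ _)
          (tsum_indicator_abs_le hlam _ _)) le_rfl)
          (mul_le_mul' (tsum_indicator_abs_le hlam _ _) le_rfl)
    _ = _ := by
        rw [← ENNReal.ofReal_add (by positivity) (by positivity), ← mul_assoc, ← mul_assoc,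
          ← ENNReal.ofReal_mul (by positivity), ← ENNReal.ofReal_mul (by positivity),
          ← add_mul, ← ENNReal.ofReal_add (by positivity) (by positivity)]
        congr 2
        ring

/-! ## The symbol of the commutator -/

section Symbol

variable {s : ℝ} (μ : Profile s)

theorem Profile.le_one {s : ℝ} (μ : Profile s) : s ≤ 1 := by
  by_contra! h
  have h1 := μ.antitone (show (2 : ℝ) ≤ 3 by norm_num)
  rw [μ.eq_rpow 3 (by norm_num), μ.eq_rpow 2 le_rfl] at h1
  have := rpow_lt_rpow (by norm_num : (0 : ℝ) ≤ 2) (by norm_num : (2 : ℝ) < 3)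
    (by linarith : 0 < s - 1)
  linarith

theorem Profile.toFun_pos (r : ℝ) : 0 < μ.toFun r := by
  have h1 := μ.antitone (le_max_left r 2)
  rw [μ.eq_rpow _ (le_max_right _ _)] at h1
  exact lt_of_lt_of_le (rpow_pos_of_pos (lt_of_lt_of_le two_pos (le_max_right _ _)) _) h1

theorem Profile.toFun_le_one (r : ℝ) : μ.toFun r ≤ 1 := by
  have h2 := μ.antitone (min_le_left r 1)
  rwa [μ.eq_one _ (min_le_right _ _)] at h2

/-- The condition s > 9/10 turns into the growth exponent 1/10 of 1/μ here. Doubling `X` reaches the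
range where μ is an explicit power. -/
theorem Profile.inv_toFun_le (hs : 9 / 10 < s) {r X : ℝ} (hX : 1 ≤ X) (hr : r ≤ X) :
    (μ.toFun r)⁻¹ ≤ 2 * X ^ (1 / 10 : ℝ) := by
  have h1 : (2 * X) ^ (s - 1) ≤ μ.toFun r := by
    rw [← μ.eq_rpow _ (by linarith)]
    exact μ.antitone (by linarith)
  have h2 : (μ.toFun r)⁻¹ ≤ (2 * X) ^ (1 - s) := by
    refine (inv_anti₀ (by positivity) h1).trans (le_of_eq ?_)
    rw [← rpow_neg (by positivity)]; congr 1; ring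
  refine h2.trans ((rpow_le_rpow_of_exponent_le (by linarith)
    (by linarith : 1 - s ≤ 1 / 10)).trans ?_)
  rw [mul_rpow (by norm_num) (by linarith)]
  gcongr
  exact (rpow_le_rpow_of_exponent_le (by norm_num) (by norm_num : (1 : ℝ) / 10 ≤ 1)).trans
    (by norm_num)

/-- Beyond 2 a dilation by 6 costs at most 6; below 2 one has μ(a) ≤ 1 and μ(b) ≥ μ(12) ≥ 1/12. So
frequencies comparable in this sense have comparable symbols. -/
theorem Profile.toFun_le_of_le_mul (hs : 9 / 10 < s) {a b : ℝ} (h : b ≤ 6 * a) :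
    μ.toFun a ≤ 12 * μ.toFun b := by
  have hpow : ∀ t : ℝ, 1 ≤ t → t⁻¹ ≤ t ^ (s - 1) := fun t ht => by
    rw [← rpow_neg_one]
    exact rpow_le_rpow_of_exponent_le ht (by linarith)
  have h1 := μ.antitone h
  rcases le_total 2 a with ha | ha
  · rw [μ.eq_rpow _ ha]
    rw [μ.eq_rpow _ (by linarith), mul_rpow (by norm_num) (by linarith)] at h1
    have h6 := hpow 6 (by norm_num)
    have hpos : 0 < a ^ (s - 1) := by positivity
    nlinarith
  · have h2 := μ.antitone (show 6 * a ≤ 12 by linarith)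
    rw [μ.eq_rpow 12 (by norm_num)] at h2
    have h12 := hpow 12 (by norm_num)
    have := μ.toFun_le_one a
    linarith

/-- The function r μ'(r) is bounded: by compactness on [0, 3], and beyond 3 because it equals (s -
1) r^{s-1}. The mean value inequality on [t, ∞) then yields the gain |a - b| / t. -/
theorem Profile.exists_abs_sub_le :
    ∃ C : ℝ, 0 < C ∧ ∀ t a b : ℝ, 0 < t → t ≤ a → t ≤ b →
      |μ.toFun a - μ.toFun b| ≤ C * |a - b| / t := by
  have hdiff : Differentiable ℝ μ.toFun := μ.smooth.differentiable (by norm_num)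
  have hcont : Continuous fun r => r * deriv μ.toFun r :=
    continuous_id.mul (μ.smooth.continuous_deriv (by norm_num))
  obtain ⟨C, hC⟩ := isCompact_Icc (a := (0 : ℝ)) (b := 3) |>.exists_bound_of_continuousOn
    hcont.continuousOn
  have hC0 : 0 ≤ C := (norm_nonneg _).trans (hC 0 (by norm_num))
  have hs1 : s ≤ 1 := μ.le_one
  have hderiv : ∀ r, 0 < r → |deriv μ.toFun r| ≤ (C + |s - 1|) / r := fun r hr => by
    rw [le_div_iff₀ hr, mul_comm, ← abs_of_pos hr, ← abs_mul, abs_of_pos hr]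
    rcases le_or_gt r 3 with h | h
    · have := hC r ⟨hr.le, h⟩
      rw [norm_eq_abs] at this
      linarith [abs_nonneg (s - 1)]
    · have he : μ.toFun =ᶠ[nhds r] fun r => r ^ (s - 1) := by
        filter_upwards [lt_mem_nhds (show 2 < r by linarith)] with x hx
        exact μ.eq_rpow x hx.le
      rw [he.deriv_eq, Real.deriv_rpow_const, abs_mul, abs_mul]
      have h1 : |r| * |r ^ (s - 1 - 1)| = r ^ (s - 1) := by
        rw [abs_of_pos hr, abs_of_pos (by positivity), mul_comm, ← rpow_add_one hr.ne']
        congr 1; ring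
      have h2 : r ^ (s - 1) ≤ 1 := rpow_le_one_of_one_le_of_nonpos (by linarith) (by linarith)
      nlinarith [abs_nonneg (s - 1)]
  refine ⟨C + |s - 1| + 1, by positivity, fun t a b ht hta htb => ?_⟩
  have h := Convex.norm_image_sub_le_of_norm_deriv_le (f := μ.toFun) (C := (C + |s - 1|) / t)
    (s := Set.Ici t) (x := b) (y := a) (fun x _ => hdiff x) (fun x hx => ?_) (convex_Ici t) htb hta
  · rw [norm_eq_abs, norm_eq_abs] at h
    refine h.trans ?_
    rw [div_mul_eq_mul_div]
    exact div_le_div_of_nonneg_right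
      (mul_le_mul_of_nonneg_right (by linarith) (abs_nonneg _)) ht.le
  · have hx' : t ≤ x := hx
    refine (hderiv x (ht.trans_le hx')).trans ?_
    gcongr

/-- The relative size of the commutator symbol for frequencies of modulus `n₁`, `n₂` whose sum has
modulus `n₀`. -/
def commSymb (N n₀ n₁ n₂ : ℝ) : ℝ :=
  |μ.toFun (n₁ / N) * μ.toFun (n₂ / N) - μ.toFun (n₀ / N)| /
    (μ.toFun (n₁ / N) * μ.toFun (n₂ / N))

theorem commSymb_nonneg (N n₀ n₁ n₂ : ℝ) : 0 ≤ commSymb μ N n₀ n₁ n₂ :=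
  div_nonneg (abs_nonneg _) (mul_pos (μ.toFun_pos _) (μ.toFun_pos _)).le

theorem commSymb_comm (N n₀ n₁ n₂ : ℝ) : commSymb μ N n₀ n₁ n₂ = commSymb μ N n₀ n₂ n₁ := by
  simp only [commSymb, mul_comm]

theorem commSymb_eq_zero {N n₀ n₁ n₂ : ℝ} (hN : 0 < N) (h₀ : n₀ ≤ N) (h₁ : n₁ ≤ N) (h₂ : n₂ ≤ N) :
    commSymb μ N n₀ n₁ n₂ = 0 := by
  rw [commSymb, μ.eq_one _ ((div_le_one hN).2 h₀), μ.eq_one _ ((div_le_one hN).2 h₁),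
    μ.eq_one _ ((div_le_one hN).2 h₂)]
  simp

/-- No cancellation is used: the quotient is at most 1 + 1/(m₁m₂), and each inverse costs
(M/N)^{1/10}. -/
theorem commSymb_le (hs : 9 / 10 < s) {N n₀ n₁ n₂ M : ℝ} (hN : 0 < N) (hM : N ≤ M) (h₁ : n₁ ≤ M)
    (h₂ : n₂ ≤ M) : commSymb μ N n₀ n₁ n₂ ≤ 5 * (M / N) ^ (1 / 5 : ℝ) := by
  have hX : 1 ≤ M / N := (one_le_div hN).2 hM
  have i1 := μ.inv_toFun_le hs hX (div_le_div_of_nonneg_right h₁ hN.le)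
  have i2 := μ.inv_toFun_le hs hX (div_le_div_of_nonneg_right h₂ hN.le)
  have p1 := μ.toFun_pos (n₁ / N)
  have p2 := μ.toFun_pos (n₂ / N)
  have p0 := μ.toFun_pos (n₀ / N)
  have e0 := μ.toFun_le_one (n₀ / N)
  have hnum : |μ.toFun (n₁ / N) * μ.toFun (n₂ / N) - μ.toFun (n₀ / N)| ≤
      μ.toFun (n₁ / N) * μ.toFun (n₂ / N) + 1 := by
    rw [abs_le]; constructor <;> nlinarith [mul_pos p1 p2]
  have hsq : (M / N) ^ (1 / 5 : ℝ) = (M / N) ^ (1 / 10 : ℝ) * (M / N) ^ (1 / 10 : ℝ) := by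
    rw [← rpow_add (by positivity)]; norm_num
  have h1X : 1 ≤ (M / N) ^ (1 / 5 : ℝ) := one_le_rpow hX (by norm_num)
  calc commSymb μ N n₀ n₁ n₂ ≤ 1 + (μ.toFun (n₁ / N))⁻¹ * (μ.toFun (n₂ / N))⁻¹ := by
        rw [commSymb, div_le_iff₀ (mul_pos p1 p2)]
        refine hnum.trans (le_of_eq ?_)
        field_simp
    _ ≤ 1 + (2 * (M / N) ^ (1 / 10 : ℝ)) * (2 * (M / N) ^ (1 / 10 : ℝ)) := by gcongr
    _ ≤ _ := by rw [hsq] at h1X ⊢; linarith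

/-- When the output is not much smaller than the first input, m₀ is O(m₁), so m₁ drops out and only
the inverse symbol of the second input is paid for. -/
theorem commSymb_le_inv (hs : 9 / 10 < s) {N n₀ n₁ n₂ : ℝ} (hN : 0 < N) (h : n₁ ≤ 6 * n₀) :
    commSymb μ N n₀ n₁ n₂ ≤ 13 * (μ.toFun (n₂ / N))⁻¹ := by
  have p1 := μ.toFun_pos (n₁ / N)
  have p2 := μ.toFun_pos (n₂ / N)
  have p0 := μ.toFun_pos (n₀ / N)
  have e2 := μ.toFun_le_one (n₂ / N)
  have hd : μ.toFun (n₀ / N) ≤ 12 * μ.toFun (n₁ / N) := by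
    refine μ.toFun_le_of_le_mul hs ?_
    rw [← mul_div_assoc]; gcongr
  rw [commSymb, div_le_iff₀ (mul_pos p1 p2)]
  have : 13 * (μ.toFun (n₂ / N))⁻¹ * (μ.toFun (n₁ / N) * μ.toFun (n₂ / N)) =
      13 * μ.toFun (n₁ / N) := by field_simp
  rw [this, abs_le]
  constructor <;> nlinarith [mul_pos p1 p2]

end Symbol

/-! ### The commutator weight in powers of the input size and of N. -/

section Weight

variable {s : ℝ} (μ : Profile s)

theorem sq_rpow_tenth {x : ℝ} (hx : 0 ≤ x) : (x ^ (1 / 10 : ℝ)) ^ 2 = x ^ (1 / 5 : ℝ) := by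
  rw [← rpow_natCast, ← rpow_mul hx]; norm_num

theorem sq_rpow_fifth {x : ℝ} (hx : 0 ≤ x) : (x ^ (1 / 5 : ℝ)) ^ 2 = x ^ (2 / 5 : ℝ) := by
  rw [← rpow_natCast, ← rpow_mul hx]; norm_num

/-- Three regimes, `n₂` being the smaller input: comparable inputs, where (1 + n₂)^{-1/2} beats
M^{2/5}; `n₂ ≤ N`, where m₂ = 1 and m₁ - m₀ gains n₂/M; and `n₂` between N and M/8, where only 1/m₂
is lost. -/
theorem exists_commSymb_sq_le_of_le (hs : 9 / 10 < s) :
    ∃ C : ℝ, 0 < C ∧ ∀ N n₀ n₁ n₂ : ℝ, 1 ≤ N → 0 ≤ n₂ → n₂ ≤ n₁ → N < n₁ + n₂ →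
      |n₀ - n₁| ≤ n₂ →
      ((1 + n₁ + n₂) ^ 2 * commSymb μ N n₀ n₁ n₂ / ((1 + n₁) * (1 + n₂))) ^ 2 ≤
        C * ((1 + n₁ + n₂) ^ 2 * N ^ (-(1 / 5) : ℝ) * (1 + n₂) ^ (-(3 / 2) : ℝ)) := by
  obtain ⟨L, hL0, hL⟩ := μ.exists_abs_sub_le
  refine ⟨10000 + (16 * L) ^ 2, by positivity, fun N n₀ n₁ n₂ hN h2 h21 hN12 h01 => ?_⟩
  set M := 1 + n₁ + n₂ with hM
  set c := commSymb μ N n₀ n₁ n₂ with hc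
  have hN0 : 0 < N := by linarith
  have hM1 : 1 ≤ M := by linarith
  have hNM : N ≤ M := by linarith
  have hM0 : 0 < M := by linarith
  have hc0 : 0 ≤ c := commSymb_nonneg μ _ _ _ _
  have hn2 : 0 < 1 + n₂ := by linarith
  -- Since `n₁` is the larger input, M ≤ 2 (1 + n₁), and one power of M cancels.
  have hW : M ^ 2 * c / ((1 + n₁) * (1 + n₂)) ≤ 2 * M * c / (1 + n₂) := by
    rw [div_le_div_iff₀ (by nlinarith) hn2]
    have : M * (1 + n₂) ≤ 2 * ((1 + n₁) * (1 + n₂)) := by nlinarith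
    nlinarith [mul_nonneg hM0.le hc0, mul_le_mul_of_nonneg_left this (mul_nonneg hM0.le hc0)]
  have hW0 : 0 ≤ M ^ 2 * c / ((1 + n₁) * (1 + n₂)) := by
    have : 0 < 1 + n₁ := by linarith
    positivity
  have hR0 : 0 ≤ M ^ 2 * N ^ (-(1 / 5) : ℝ) * (1 + n₂) ^ (-(3 / 2) : ℝ) := by positivity
  have hXe : ∀ Y e : ℝ, 0 < Y → (Y / N) ^ e = Y ^ e * N ^ (-e) := fun Y e hY => by
    rw [div_rpow hY.le hN0.le, rpow_neg hN0.le, div_eq_mul_inv]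
  have hsplit : (1 + n₂) ^ (-(3 / 2) : ℝ) * (1 + n₂) ^ (-(1 / 2) : ℝ) = ((1 + n₂) ^ 2)⁻¹ := by
    rw [← rpow_add hn2, ← rpow_natCast, ← rpow_neg hn2.le]; norm_num
  obtain ⟨a0, a1⟩ := abs_le.1 h01
  rcases le_or_gt (M / 8) n₂ with hA | hB
  · have hcle : c ≤ 5 * (M / N) ^ (1 / 5 : ℝ) :=
      commSymb_le μ hs hN0 hNM (by linarith) (by linarith)
    have h1 : (M ^ 2 * c / ((1 + n₁) * (1 + n₂))) ^ 2 ≤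
        100 * (M ^ 2 * (M / N) ^ (2 / 5 : ℝ) * ((1 + n₂) ^ 2)⁻¹) := by
      have : M ^ 2 * c / ((1 + n₁) * (1 + n₂)) ≤ 10 * M * (M / N) ^ (1 / 5 : ℝ) * (1 + n₂)⁻¹ := by
        refine hW.trans ?_
        rw [div_eq_mul_inv]
        refine mul_le_mul_of_nonneg_right ?_ (inv_pos.2 hn2).le
        have := mul_le_mul_of_nonneg_left hcle hM0.le
        linarith
      refine (pow_le_pow_left₀ hW0 this 2).trans (le_of_eq ?_)
      rw [mul_pow, mul_pow, mul_pow, sq_rpow_fifth (by positivity), inv_pow]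
      ring
    have h2 : (M / N) ^ (2 / 5 : ℝ) * (1 + n₂) ^ (-(1 / 2) : ℝ) ≤ 3 * N ^ (-(1 / 5) : ℝ) := by
      have e1 : (1 + n₂) ^ (-(1 / 2) : ℝ) ≤ (M / 8) ^ (-(1 / 2) : ℝ) :=
        rpow_le_rpow_of_nonpos (by positivity) (by linarith) (by norm_num)
      have e2 : (M / 8) ^ (-(1 / 2) : ℝ) ≤ 3 * M ^ (-(1 / 2) : ℝ) := by
        rw [div_rpow hM0.le (by norm_num), rpow_neg (by norm_num : (0 : ℝ) ≤ 8), div_inv_eq_mul,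
          mul_comm]
        gcongr
        rw [← sqrt_eq_rpow, sqrt_le_left (by norm_num)]; norm_num
      have e3 : M ^ (2 / 5 : ℝ) * M ^ (-(1 / 2) : ℝ) ≤ 1 := by
        rw [← rpow_add hM0]
        exact rpow_le_one_of_one_le_of_nonpos hM1 (by norm_num)
      have e4 : N ^ (-(2 / 5) : ℝ) ≤ N ^ (-(1 / 5) : ℝ) :=
        rpow_le_rpow_of_exponent_le hN (by norm_num)
      rw [hXe M _ hM0]
      calc _ ≤ M ^ (2 / 5 : ℝ) * N ^ (-(2 / 5) : ℝ) * (3 * M ^ (-(1 / 2) : ℝ)) := by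
            gcongr; exact e1.trans e2
        _ = 3 * (M ^ (2 / 5 : ℝ) * M ^ (-(1 / 2) : ℝ)) * N ^ (-(2 / 5) : ℝ) := by ring
        _ ≤ 3 * 1 * N ^ (-(1 / 5) : ℝ) := by gcongr
        _ = _ := by ring
    calc _ ≤ _ := h1
      _ = 100 * (M ^ 2 * ((M / N) ^ (2 / 5 : ℝ) * (1 + n₂) ^ (-(1 / 2) : ℝ)) *
          (1 + n₂) ^ (-(3 / 2) : ℝ)) := by rw [← hsplit]; ring
      _ ≤ 100 * (M ^ 2 * (3 * N ^ (-(1 / 5) : ℝ)) * (1 + n₂) ^ (-(3 / 2) : ℝ)) := by gcongr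
      _ = 300 * (M ^ 2 * N ^ (-(1 / 5) : ℝ) * (1 + n₂) ^ (-(3 / 2) : ℝ)) := by ring
      _ ≤ _ := by gcongr; nlinarith [sq_nonneg (16 * L)]
  · have hn1 : M / 4 ≤ n₁ := by linarith
    have hn0 : M / 4 ≤ n₀ := by linarith
    rcases le_or_gt n₂ N with hlo | hhi
    · have hf2 : μ.toFun (n₂ / N) = 1 := μ.eq_one _ ((div_le_one hN0).2 hlo)
      have hX : 1 ≤ M / N := (one_le_div hN0).2 hNM
      have hi1 := μ.inv_toFun_le hs hX (div_le_div_of_nonneg_right (by linarith : n₁ ≤ M) hN0.le)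
      have hsub := hL (M / 4 / N) (n₁ / N) (n₀ / N) (by positivity)
        (by gcongr) (by gcongr)
      have hsub' : |μ.toFun (n₁ / N) - μ.toFun (n₀ / N)| ≤ L * (4 * n₂ / M) := by
        refine hsub.trans ?_
        rw [← sub_div, abs_div, abs_of_pos hN0]
        have : L * (|n₁ - n₀| / N) / (M / 4 / N) = L * (4 * |n₁ - n₀| / M) := by field_simp
        rw [this, abs_sub_comm]
        gcongr
      have hcle : c ≤ L * (4 * n₂ / M) * (2 * (M / N) ^ (1 / 10 : ℝ)) := by
        rw [hc, commSymb, hf2, mul_one, div_eq_mul_inv]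
        gcongr
        exact (inv_pos.2 (μ.toFun_pos _)).le
      have h1 : M ^ 2 * c / ((1 + n₁) * (1 + n₂)) ≤ 16 * L * (M / N) ^ (1 / 10 : ℝ) := by
        refine hW.trans ?_
        rw [div_le_iff₀ hn2]
        calc 2 * M * c ≤ 2 * M * (L * (4 * n₂ / M) * (2 * (M / N) ^ (1 / 10 : ℝ))) := by gcongr
          _ = 16 * L * (M / N) ^ (1 / 10 : ℝ) * n₂ := by field_simp; ring
          _ ≤ _ := by gcongr; linarith
      calc _ ≤ _ := pow_le_pow_left₀ hW0 h1 2
        _ = (16 * L) ^ 2 * (M ^ (1 / 5 : ℝ) * N ^ (-(1 / 5) : ℝ)) := by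
            rw [mul_pow, sq_rpow_tenth (by positivity), hXe M _ hM0]
        _ ≤ (16 * L) ^ 2 * (M ^ 2 * N ^ (-(1 / 5) : ℝ) * (1 + n₂) ^ (-(3 / 2) : ℝ)) := by
            refine mul_le_mul_of_nonneg_left ?_ (by positivity)
            rw [mul_right_comm]
            refine mul_le_mul_of_nonneg_right ?_ (by positivity)
            rw [rpow_neg hn2.le, ← div_eq_mul_inv, le_div_iff₀ (by positivity)]
            calc M ^ (1 / 5 : ℝ) * (1 + n₂) ^ (3 / 2 : ℝ) ≤ M ^ (1 / 2 : ℝ) * M ^ (3 / 2 : ℝ) := by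
                  refine mul_le_mul (rpow_le_rpow_of_exponent_le hM1 (by norm_num))
                    (rpow_le_rpow hn2.le (by linarith) (by norm_num)) (by positivity)
                    (by positivity)
              _ = _ := by rw [← rpow_add hM0, ← rpow_natCast]; norm_num
        _ ≤ _ := by gcongr; linarith
    -- After squaring, the loss ((1 + n₂)/N)^{1/5} and the factor (1 + n₂)^{-2} combine to an
    -- exponent below -3/2.
    · have hcle : c ≤ 13 * (μ.toFun (n₂ / N))⁻¹ := commSymb_le_inv μ hs hN0 (by linarith)
      have hi2 := μ.inv_toFun_le hs (X := (1 + n₂) / N) ((one_le_div hN0).2 (by linarith))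
        (div_le_div_of_nonneg_right (by linarith : n₂ ≤ 1 + n₂) hN0.le)
      have h1 : M ^ 2 * c / ((1 + n₁) * (1 + n₂)) ≤
          52 * M * ((1 + n₂) / N) ^ (1 / 10 : ℝ) * (1 + n₂)⁻¹ := by
        refine hW.trans ?_
        rw [div_eq_mul_inv]
        refine mul_le_mul_of_nonneg_right ?_ (inv_pos.2 hn2).le
        have := mul_le_mul_of_nonneg_left (hcle.trans (mul_le_mul_of_nonneg_left hi2
          (by norm_num))) hM0.le
        linarith
      calc _ ≤ _ := pow_le_pow_left₀ hW0 h1 2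
        _ = 2704 * (M ^ 2 * N ^ (-(1 / 5) : ℝ) * ((1 + n₂) ^ (1 / 5 : ℝ) *
            ((1 + n₂) ^ (-(3 / 2) : ℝ) * (1 + n₂) ^ (-(1 / 2) : ℝ)))) := by
            rw [mul_pow, mul_pow, mul_pow, sq_rpow_tenth (by positivity), hXe _ _ hn2, hsplit,
              inv_pow]
            ring
        _ ≤ 2704 * (M ^ 2 * N ^ (-(1 / 5) : ℝ) * (1 + n₂) ^ (-(3 / 2) : ℝ)) := by
            gcongr
            rw [← rpow_add hn2, ← rpow_add hn2]
            exact rpow_le_rpow_of_exponent_le (by linarith) (by norm_num)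
        _ ≤ _ := by gcongr; nlinarith [sq_nonneg (16 * L)]

end Weight

/-! ## Geometry of the frequencies -/

/-- In the coordinates (√3 ξ, q) the modulus is Euclidean, so the triangle inequality is inherited
from ℂ. -/
theorem absZ_eq_norm (x r : ℝ) : absZ x r = ‖(⟨√3 * x, r⟩ : ℂ)‖ := by
  rw [absZ, Complex.norm_def, Complex.normSq_mk, ← sq, ← sq, mul_pow,
    sq_sqrt (by norm_num : (0 : ℝ) ≤ 3)]

theorem absZ_add_le (x r y t : ℝ) : absZ (x + y) (r + t) ≤ absZ x r + absZ y t := by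
  simp only [absZ_eq_norm]
  refine le_trans (le_of_eq ?_) (norm_add_le _ _)
  congr 1
  apply Complex.ext <;> simp [mul_add]

theorem absZ_neg (x r : ℝ) : absZ (-x) (-r) = absZ x r := by simp [absZ]

theorem abs_le_absZ_left (x r : ℝ) : |x| ≤ absZ x r := by
  rw [absZ]; refine abs_le_sqrt ?_; nlinarith [sq_nonneg x, sq_nonneg r]

theorem abs_le_absZ_right (x r : ℝ) : |r| ≤ absZ x r := by
  rw [absZ]; refine abs_le_sqrt ?_; nlinarith [sq_nonneg x]

/-- In a nearly equilateral triangle of frequencies one of two given sides is far from the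
degenerate cone `q² = 3ξ²`. -/
theorem nondegenerate_of_equilateral {x₀ q₀ x₁ q₁ : ℝ}
    (hb : |3 * x₁ ^ 2 + q₁ ^ 2 - (3 * x₀ ^ 2 + q₀ ^ 2)| ≤ (3 * x₀ ^ 2 + q₀ ^ 2) / 100)
    (hc : |3 * (x₀ - x₁) ^ 2 + (q₀ - q₁) ^ 2 - (3 * x₀ ^ 2 + q₀ ^ 2)| ≤
      (3 * x₀ ^ 2 + q₀ ^ 2) / 100)
    (h₀ : |3 * x₀ ^ 2 - q₀ ^ 2| ≤ (3 * x₀ ^ 2 + q₀ ^ 2) / 10)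
    (ha : 0 < 3 * x₀ ^ 2 + q₀ ^ 2) :
    (3 * x₀ ^ 2 + q₀ ^ 2) / 2 ≤ |3 * x₁ ^ 2 - q₁ ^ 2| ∧
      (3 * x₀ ^ 2 + q₀ ^ 2) / 100 ≤ 3 * x₁ ^ 2 := by
  set a := 3 * x₀ ^ 2 + q₀ ^ 2 with haDef
  set b := 3 * x₁ ^ 2 + q₁ ^ 2 with hbDef
  set A₀ := 3 * x₀ ^ 2 - q₀ ^ 2 with hA0
  set A₁ := 3 * x₁ ^ 2 - q₁ ^ 2 with hA1
  -- In the coordinates (√3 ξ, q), with ζ₀ at angle θ and ζ₁ at angle θ + φ: S is the inner product,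
  -- `T2` the squared cross product, A₀ = a cos 2θ, A₁ = b cos 2(θ + φ), and `B2` = (a sin 2θ)².
  -- Nearly equal sides force cos φ close to 1/2.
  set S := 3 * x₀ * x₁ + q₀ * q₁ with hS
  obtain ⟨b1, b2⟩ := abs_le.1 hb
  obtain ⟨c1, c2⟩ := abs_le.1 hc
  obtain ⟨d1, d2⟩ := abs_le.1 h₀
  have hSlow : 49 / 100 * a ≤ S := by
    have : 2 * S = a + b - (3 * (x₀ - x₁) ^ 2 + (q₀ - q₁) ^ 2) := by
      simp only [hS, haDef, hbDef]; ring
    linarith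
  have hSup : S ≤ 51 / 100 * a := by
    have : 2 * S = a + b - (3 * (x₀ - x₁) ^ 2 + (q₀ - q₁) ^ 2) := by
      simp only [hS, haDef, hbDef]; ring
    linarith
  set T2 := 3 * (x₀ * q₁ - q₀ * x₁) ^ 2 with hT2
  have hST : S ^ 2 + T2 = a * b := by simp only [hS, hT2, haDef, hbDef]; ring
  set B2 := 12 * x₀ ^ 2 * q₀ ^ 2 with hB2
  have hAB : A₀ ^ 2 + B2 = a ^ 2 := by simp only [hA0, hB2, haDef]; ring
  -- This is the addition formula for cos(2θ + 2φ), squared so that the sign of the sine term does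
  -- not matter. With A₀ small, |A₁| is about (√3/2) a.
  have hid : (A₁ * a ^ 2 - A₀ * (S ^ 2 - T2)) ^ 2 = 4 * B2 * S ^ 2 * T2 := by
    simp only [hA1, hA0, haDef, hS, hT2, hB2]; ring
  have hS2l := pow_le_pow_left₀ (by positivity) hSlow 2
  have hS2u := pow_le_pow_left₀ (le_trans (by positivity) hSlow) hSup 2
  rw [mul_pow] at hS2l hS2u
  have habl := mul_le_mul_of_nonneg_left (show 99 / 100 * a ≤ b by linarith) ha.le
  have habu := mul_le_mul_of_nonneg_left (show b ≤ 101 / 100 * a by linarith) ha.le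
  have hA0sq : A₀ ^ 2 ≤ (a / 10) ^ 2 := sq_le_sq' (by linarith) (by linarith)
  have hT2l : (7299 / 10000) * a ^ 2 ≤ T2 := by linarith
  have hT2u : T2 ≤ (7699 / 10000) * a ^ 2 := by linarith
  have hB2l : (99 / 100) * a ^ 2 ≤ B2 := by linarith
  have hB2u : B2 ≤ a ^ 2 := by linarith [sq_nonneg A₀]
  have ha2 : 0 < a ^ 2 := by positivity
  set P := A₁ * a ^ 2 - A₀ * (S ^ 2 - T2) with hP
  have hP2u : P ^ 2 ≤ (9 / 10 * a ^ 3) ^ 2 := by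
    rw [hid]
    calc 4 * B2 * S ^ 2 * T2 ≤ 4 * a ^ 2 * ((51 / 100) ^ 2 * a ^ 2) * (7699 / 10000 * a ^ 2) := by
          gcongr
      _ = (4 * (51 / 100) ^ 2 * (7699 / 10000)) * a ^ 6 := by ring
      _ ≤ (81 / 100) * a ^ 6 := by gcongr; norm_num
      _ = _ := by ring
  have hP2l : (8 / 10 * a ^ 3) ^ 2 ≤ P ^ 2 := by
    rw [hid]
    calc (8 / 10 * a ^ 3) ^ 2 ≤
          4 * (99 / 100 * a ^ 2) * ((49 / 100) ^ 2 * a ^ 2) * (7299 / 10000 * a ^ 2) := by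
          rw [show 4 * (99 / 100 * a ^ 2) * ((49 / 100) ^ 2 * a ^ 2) * (7299 / 10000 * a ^ 2) =
            (4 * (99 / 100) * (49 / 100) ^ 2 * (7299 / 10000)) * a ^ 6 by ring,
            show (8 / 10 * a ^ 3) ^ 2 = (64 / 100) * a ^ 6 by ring]
          gcongr
          norm_num
      _ ≤ _ := by gcongr
  have hPu : |P| ≤ 9 / 10 * a ^ 3 := abs_le_of_sq_le_sq hP2u (by positivity)
  have hPl : 8 / 10 * a ^ 3 ≤ |P| := by
    have := sq_le_sq.1 hP2l
    rwa [abs_of_pos (by positivity : 0 < 8 / 10 * a ^ 3)] at this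
  have hcorr : |A₀ * (S ^ 2 - T2)| ≤ 54 / 1000 * a ^ 3 := by
    rw [abs_mul]
    have h2 : |S ^ 2 - T2| ≤ 54 / 100 * a ^ 2 := abs_le.2 ⟨by linarith, by linarith⟩
    calc _ ≤ a / 10 * (54 / 100 * a ^ 2) := by gcongr
      _ = _ := by ring
  have hA1a : |A₁| * a ^ 2 = |P + A₀ * (S ^ 2 - T2)| := by
    rw [hP, sub_add_cancel, abs_mul, abs_of_pos ha2]
  have hu : |A₁| * a ^ 2 ≤ 954 / 1000 * a ^ 3 := by
    rw [hA1a]; exact (abs_add_le _ _).trans (by linarith)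
  have hl : 746 / 1000 * a ^ 3 ≤ |A₁| * a ^ 2 := by
    rw [hA1a]
    have := abs_sub_abs_le_abs_sub P (-(A₀ * (S ^ 2 - T2)))
    rw [abs_neg, sub_neg_eq_add] at this
    linarith
  have hu' : |A₁| ≤ 954 / 1000 * a := by
    refine le_of_mul_le_mul_right (hu.trans (le_of_eq (by ring))) ha2
  have hl' : 746 / 1000 * a ≤ |A₁| := by
    refine le_of_mul_le_mul_right (le_trans (le_of_eq (by ring)) hl) ha2
  refine ⟨by linarith, ?_⟩
  have h6 : 6 * x₁ ^ 2 = b + A₁ := by simp only [hbDef, hA1]; ring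
  have := neg_le_of_abs_le hu'
  linarith

/-! ### The frequency factor of the kernel. -/

section Multiplier

variable {s : ℝ} (μ : Profile s)

/-- The frequency part of the kernel of the bilinear estimate: `ξ` times the commutator symbol,
with the Sobolev weights. -/
def multWeight (N x n₀ n₁ n₂ : ℝ) : ℝ :=
  |x| * (1 + n₀) * commSymb μ N n₀ n₁ n₂ / ((1 + n₁) * (1 + n₂))

theorem multWeight_nonneg {N x n₀ n₁ n₂ : ℝ} (h₀ : 0 ≤ n₀) (h₁ : 0 ≤ n₁) (h₂ : 0 ≤ n₂) :
    0 ≤ multWeight μ N x n₀ n₁ n₂ := by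
  have := commSymb_nonneg μ N n₀ n₁ n₂
  unfold multWeight; positivity

/-- The conditions satisfied by `|ζ₀|, |ζ₁|, |ζ₂|` and `ξ₀` when `ζ₀ = ζ₁ + ζ₂`. -/
structure IsTriangle (x n₀ n₁ n₂ : ℝ) : Prop where
  nonneg₀ : 0 ≤ n₀
  nonneg₁ : 0 ≤ n₁
  nonneg₂ : 0 ≤ n₂
  le₀ : n₀ ≤ n₁ + n₂
  le₁ : n₁ ≤ n₀ + n₂
  le₂ : n₂ ≤ n₀ + n₁
  abs_le : |x| ≤ n₀

variable {μ} {N x n₀ n₁ n₂ : ℝ}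

theorem IsTriangle.multWeight_eq_zero (h : IsTriangle x n₀ n₁ n₂) (hN : 0 < N)
    (hn : n₁ + n₂ ≤ N) : multWeight μ N x n₀ n₁ n₂ = 0 := by
  rw [multWeight, commSymb_eq_zero μ hN (h.le₀.trans hn) (by linarith [h.nonneg₂])
    (by linarith [h.nonneg₁])]
  simp

variable (μ)

theorem exists_multWeight_sq_le (hs : 9 / 10 < s) :
    ∃ C : ℝ, 0 < C ∧ ∀ N x n₀ n₁ n₂ : ℝ, 1 ≤ N → IsTriangle x n₀ n₁ n₂ →
      multWeight μ N x n₀ n₁ n₂ ^ 2 ≤ C * ((1 + n₁ + n₂) ^ 2 * N ^ (-(1 / 5) : ℝ) *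
        ((1 + n₁) ^ (-(3 / 2) : ℝ) + (1 + n₂) ^ (-(3 / 2) : ℝ))) := by
  obtain ⟨C, hC, h⟩ := exists_commSymb_sq_le_of_le μ hs
  refine ⟨C, hC, fun N x n₀ n₁ n₂ hN ht => ?_⟩
  have h0 := ht.nonneg₀
  have h1 := ht.nonneg₁
  have h2 := ht.nonneg₂
  have hN0 : 0 < N := by linarith
  have p1 : 0 ≤ (1 + n₁) ^ (-(3 / 2) : ℝ) := by positivity
  have p2 : 0 ≤ (1 + n₂) ^ (-(3 / 2) : ℝ) := by positivity
  rcases le_or_gt (n₁ + n₂) N with hn | hn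
  · rw [ht.multWeight_eq_zero hN0 hn]; simp only [ne_eq, OfNat.ofNat_ne_zero, not_false_eq_true,
      zero_pow]; positivity
  have hle : multWeight μ N x n₀ n₁ n₂ ≤
      (1 + n₁ + n₂) ^ 2 * commSymb μ N n₀ n₁ n₂ / ((1 + n₁) * (1 + n₂)) := by
    have := commSymb_nonneg μ N n₀ n₁ n₂
    rw [multWeight, sq]
    have hx : |x| ≤ 1 + n₁ + n₂ := ht.abs_le.trans (ht.le₀.trans (by linarith))
    have hn' : 1 + n₀ ≤ 1 + n₁ + n₂ := by linarith [ht.le₀]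
    gcongr
  refine (pow_le_pow_left₀ (multWeight_nonneg μ h0 h1 h2) hle 2).trans ?_
  rcases le_total n₂ n₁ with h21 | h12
  · refine (h N n₀ n₁ n₂ hN h2 h21 hn (abs_le.2 ⟨by linarith [ht.le₁], by linarith [ht.le₀]⟩)).trans
      ?_
    gcongr
    linarith
  · have := h N n₀ n₂ n₁ hN h1 h12 (by linarith)
      (abs_le.2 ⟨by linarith [ht.le₂], by linarith [ht.le₀]⟩)
    rw [commSymb_comm, show 1 + n₂ + n₁ = 1 + n₁ + n₂ by ring, mul_comm (1 + n₂)] at this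
    refine this.trans ?_
    gcongr
    linarith

/-- With both inputs of size M the Sobolev weights cancel the derivative and the output weight
completely. Only the crude commutator bound remains. -/
theorem multWeight_sq_le (hs : 9 / 10 < s) (hN : 1 ≤ N) (ht : IsTriangle x n₀ n₁ n₂)
    (h₁ : 1 + n₁ + n₂ ≤ 6 * n₁) (h₂ : 1 + n₁ + n₂ ≤ 6 * n₂) :
    multWeight μ N x n₀ n₁ n₂ ^ 2 ≤ 180 ^ 2 * ((1 + n₁ + n₂) / N) ^ (2 / 5 : ℝ) := by
  have h0 := ht.nonneg₀
  have h1 := ht.nonneg₁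
  have h2 := ht.nonneg₂
  have hN0 : 0 < N := by linarith
  rcases le_or_gt (n₁ + n₂) N with hn | hn
  · rw [ht.multWeight_eq_zero hN0 hn, zero_pow two_ne_zero]; positivity
  set M := 1 + n₁ + n₂ with hM
  have hc := commSymb_le μ hs hN0 (n₀ := n₀) (show N ≤ M by linarith) (show n₁ ≤ M by linarith)
    (show n₂ ≤ M by linarith)
  have hM0 : 0 < M := by linarith
  have hle : multWeight μ N x n₀ n₁ n₂ ≤ 180 * (M / N) ^ (1 / 5 : ℝ) := by
    have hc0 := commSymb_nonneg μ N n₀ n₁ n₂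
    calc multWeight μ N x n₀ n₁ n₂ ≤ M * M * (5 * (M / N) ^ (1 / 5 : ℝ)) / (M / 6 * (M / 6)) := by
          have hx : |x| ≤ M := ht.abs_le.trans (ht.le₀.trans (by linarith))
          have hn' : 1 + n₀ ≤ M := by linarith [ht.le₀]
          unfold multWeight
          gcongr <;> linarith
      _ = _ := by field_simp; ring
  refine (pow_le_pow_left₀ (multWeight_nonneg μ h0 h1 h2) hle 2).trans (le_of_eq ?_)
  rw [mul_pow, sq_rpow_fifth (by positivity)]

/-- With the output also of size M, only one inverse symbol is lost, which halves the exponent of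
M/N. The factor x² is kept because the nondegenerate fibre integral is singular at x = 0. -/
theorem multWeight_sq_le' (hs : 9 / 10 < s) (hN : 1 ≤ N) (ht : IsTriangle x n₀ n₁ n₂)
    (h₀ : 1 + n₁ + n₂ ≤ 6 * n₀) (h₁ : 1 + n₁ + n₂ ≤ 6 * n₁) (h₂ : 1 + n₁ + n₂ ≤ 6 * n₂) :
    multWeight μ N x n₀ n₁ n₂ ^ 2 ≤
      936 ^ 2 * (x ^ 2 / (1 + n₁ + n₂) ^ 2 * ((1 + n₁ + n₂) / N) ^ (1 / 5 : ℝ)) := by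
  have h0 := ht.nonneg₀
  have h1 := ht.nonneg₁
  have h2 := ht.nonneg₂
  have hN0 : 0 < N := by linarith
  rcases le_or_gt (n₁ + n₂) N with hn | hn
  · rw [ht.multWeight_eq_zero hN0 hn, zero_pow two_ne_zero]; positivity
  set M := 1 + n₁ + n₂ with hM
  have hM0 : 0 < M := by linarith
  have hc : commSymb μ N n₀ n₁ n₂ ≤ 13 * (2 * (M / N) ^ (1 / 10 : ℝ)) :=
    (commSymb_le_inv μ hs hN0 (by linarith)).trans (mul_le_mul_of_nonneg_left
      (μ.inv_toFun_le hs ((one_le_div hN0).2 (by linarith))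
        (div_le_div_of_nonneg_right (by linarith) hN0.le)) (by norm_num))
  have hle : multWeight μ N x n₀ n₁ n₂ ≤ 936 * (|x| / M * (M / N) ^ (1 / 10 : ℝ)) := by
    have hc0 := commSymb_nonneg μ N n₀ n₁ n₂
    calc multWeight μ N x n₀ n₁ n₂ ≤
          |x| * M * (13 * (2 * (M / N) ^ (1 / 10 : ℝ))) / (M / 6 * (M / 6)) := by
          have hn' : 1 + n₀ ≤ M := by linarith [ht.le₀]
          unfold multWeight
          gcongr <;> linarith
      _ = _ := by field_simp; ring
  refine (pow_le_pow_left₀ (multWeight_nonneg μ h0 h1 h2) hle 2).trans (le_of_eq ?_)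
  rw [mul_pow, mul_pow, sq_rpow_tenth (by positivity), div_pow, sq_abs]

/-! ### Pointwise bounds in the different frequency regions

`L` is the modulation weight of the output. -/

/-- The output weight is at most M^{-9}, while the squared frequency weight costs only M². Part of
the surplus becomes decay in the first input, enough for ξ and q separately, so the oscillation of
the phase is not needed. -/
theorem exists_mult_le_high_modulation (hs : 9 / 10 < s) :
    ∃ C : ℝ, 0 < C ∧ ∀ N x n₀ n₁ n₂ L δ : ℝ, 1 ≤ N → IsTriangle x n₀ n₁ n₂ → δ ≤ 1 / 1000 →
      (1 + n₁ + n₂) ^ 10 ≤ L →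
      multWeight μ N x n₀ n₁ n₂ ^ 2 * L ^ (-1 + 2 * δ) ≤
        C * N ^ (-(1 / 5) : ℝ) * ((1 + n₁) ^ (-(3 / 2) : ℝ) * (1 + n₁) ^ (-(3 / 2) : ℝ)) := by
  obtain ⟨C, hC, h⟩ := exists_multWeight_sq_le μ hs
  refine ⟨C * 2, by positivity, fun N x n₀ n₁ n₂ L δ hN ht hδ hL => ?_⟩
  have h1 := ht.nonneg₁
  have h2 := ht.nonneg₂
  set M := 1 + n₁ + n₂ with hM
  have hM1 : 1 ≤ M := by linarith
  have hM0 : 0 < M := by linarith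
  have hL1 : 1 ≤ L := (one_le_pow₀ hM1).trans hL
  have hLe : L ^ (-1 + 2 * δ) ≤ (M ^ 9)⁻¹ := by
    calc L ^ (-1 + 2 * δ) ≤ L ^ (-(9 / 10) : ℝ) :=
          rpow_le_rpow_of_exponent_le hL1 (by linarith)
      _ ≤ (M ^ 10) ^ (-(9 / 10) : ℝ) :=
          rpow_le_rpow_of_nonpos (by positivity) hL (by norm_num)
      _ = _ := by
          rw [← rpow_natCast, ← rpow_mul hM0.le, ← rpow_natCast, ← rpow_neg hM0.le]; norm_num
  have hone : ∀ y : ℝ, 0 ≤ y → (1 + y) ^ (-(3 / 2) : ℝ) ≤ 1 := fun y hy =>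
    rpow_le_one_of_one_le_of_nonpos (by linarith) (by norm_num)
  have hn1 : (M ^ 3)⁻¹ ≤ (1 + n₁) ^ (-(3 / 2) : ℝ) * (1 + n₁) ^ (-(3 / 2) : ℝ) := by
    rw [← rpow_add (by linarith), ← rpow_natCast, ← rpow_neg hM0.le]
    refine le_trans (le_of_eq (by norm_num)) (rpow_le_rpow_of_nonpos (by linarith)
      (show 1 + n₁ ≤ M by linarith) (by norm_num))
  calc _ ≤ C * (M ^ 2 * N ^ (-(1 / 5) : ℝ) * (1 + 1)) * (M ^ 9)⁻¹ := by
        refine mul_le_mul ((h N x n₀ n₁ n₂ hN ht).trans ?_) hLe (by positivity) (by positivity)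
        gcongr
        · exact hone _ h1
        · exact hone _ h2
    _ = C * 2 * N ^ (-(1 / 5) : ℝ) * ((M ^ 3)⁻¹ * (M ^ 4)⁻¹) := by field_simp; ring
    _ ≤ C * 2 * N ^ (-(1 / 5) : ℝ) * ((1 + n₁) ^ (-(3 / 2) : ℝ) * (1 + n₁) ^ (-(3 / 2) : ℝ)) := by
        refine mul_le_mul_of_nonneg_left ?_ (by positivity)
        refine le_trans (mul_le_of_le_one_right (by positivity) ?_) hn1
        exact inv_le_one_of_one_le₀ (one_le_pow₀ hM1)

theorem exists_mult_le_transversal (hs : 9 / 10 < s) :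
    ∃ C : ℝ, 0 < C ∧ ∀ N x n₀ n₁ n₂ L δ : ℝ, 1 ≤ N → IsTriangle x n₀ n₁ n₂ → δ ≤ 1 / 1000 → 1 ≤ L →
      (1 + n₁ + n₂) ^ 2 / 2000 ≤ |n₁ ^ 2 - n₂ ^ 2| →
      multWeight μ N x n₀ n₁ n₂ ^ 2 * L ^ (-1 + 2 * δ) ≤
        C * ((1 + n₀) ^ 2 * N ^ (-(1 / 5) : ℝ)) *
          ((1 + n₁) ^ (-(3 / 2) : ℝ) + (1 + n₂) ^ (-(3 / 2) : ℝ)) := by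
  obtain ⟨C, hC, h⟩ := exists_multWeight_sq_le μ hs
  refine ⟨C * 2000 ^ 2, by positivity, fun N x n₀ n₁ n₂ L δ hN ht hδ hL htr => ?_⟩
  have h0 := ht.nonneg₀
  have h1 := ht.nonneg₁
  have h2 := ht.nonneg₂
  have hL' : L ^ (-1 + 2 * δ) ≤ 1 := rpow_le_one_of_one_le_of_nonpos hL (by linarith)
  -- The difference of the squares is at most n₀ (n₁ + n₂), so transversal inputs force the output
  -- to be comparable to M. The bound can then be expressed through the output alone.
  have hMn : 1 + n₁ + n₂ ≤ 2000 * (1 + n₀) := by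
    have hM0 : 0 < 1 + n₁ + n₂ := by linarith
    have e : |n₁ ^ 2 - n₂ ^ 2| ≤ n₀ * (1 + n₁ + n₂) := by
      rw [sq_sub_sq, abs_mul, abs_of_nonneg (add_nonneg h1 h2), mul_comm]
      exact mul_le_mul (abs_le.2 ⟨by linarith [ht.le₂], by linarith [ht.le₁]⟩) (by linarith)
        (by positivity) h0
    nlinarith
  have := multWeight_nonneg μ (N := N) (x := x) h0 h1 h2
  calc _ ≤ C * ((1 + n₁ + n₂) ^ 2 * N ^ (-(1 / 5) : ℝ) *
        ((1 + n₁) ^ (-(3 / 2) : ℝ) + (1 + n₂) ^ (-(3 / 2) : ℝ))) * 1 :=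
        mul_le_mul (h N x n₀ n₁ n₂ hN ht) hL' (by positivity) (by positivity)
    _ ≤ C * ((2000 * (1 + n₀)) ^ 2 * N ^ (-(1 / 5) : ℝ) *
        ((1 + n₁) ^ (-(3 / 2) : ℝ) + (1 + n₂) ^ (-(3 / 2) : ℝ))) * 1 := by gcongr
    _ = _ := by ring

/-- If `|ζ₁|² - |ζ₂|²` is small then both are comparable to their sum. -/
theorem IsTriangle.comparable (ht : IsTriangle x n₀ n₁ n₂) (hn : 1 ≤ n₁ + n₂)
    (h : |n₁ ^ 2 - n₂ ^ 2| < (1 + n₁ + n₂) ^ 2 / 2000) :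
    1 + n₁ + n₂ ≤ 6 * n₁ ∧ 1 + n₁ + n₂ ≤ 6 * n₂ := by
  obtain ⟨a, b⟩ := abs_lt.1 h
  have h1 := ht.nonneg₁
  have h2 := ht.nonneg₂
  have hM : (1 + n₁ + n₂) ^ 2 ≤ 4 * (n₁ + n₂) ^ 2 := by nlinarith
  have hp : (n₁ + n₂) ^ 2 ≤ 2 * (n₁ ^ 2 + n₂ ^ 2) := by nlinarith [sq_nonneg (n₁ - n₂)]
  constructor
  · exact (sq_le_sq₀ (by linarith) (by linarith)).1 (by linarith [mul_pow 6 n₁ 2])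
  · exact (sq_le_sq₀ (by linarith) (by linarith)).1 (by linarith [mul_pow 6 n₂ 2])

/-- Away from very high output modulation one may trade powers of the frequency for a symmetric
modulation weight. -/
theorem modulation_weight_le {L M δ₁ δ₂ : ℝ} (hL : 1 ≤ L) (hM : 1 ≤ M) (hLM : L ≤ M ^ 10)
    (h₁ : δ₁ ≤ 1 / 1000) (h₂ : δ₂ ≤ 1 / 1000) :
    L ^ (-1 + 2 * δ₁) ≤ M ^ (1 / 20 : ℝ) * L ^ (-(1 + 2 * δ₂)) := by
  have hL0 : 0 < L := by linarith
  have e : L ^ (-1 + 2 * δ₁) = L ^ (2 * δ₁ + 2 * δ₂) * L ^ (-(1 + 2 * δ₂)) := by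
    rw [← rpow_add hL0]; congr 1; ring
  rw [e]
  gcongr
  calc L ^ (2 * δ₁ + 2 * δ₂) ≤ L ^ (1 / 200 : ℝ) := rpow_le_rpow_of_exponent_le hL (by linarith)
    _ ≤ (M ^ 10) ^ (1 / 200 : ℝ) := rpow_le_rpow hL0.le hLM (by norm_num)
    _ = _ := by rw [← rpow_natCast, ← rpow_mul (by linarith)]; norm_num

end Multiplier

/-! ## Frequency space -/

/-- Frequency space: a point is `(w, k)` with `w = (ξ, τ)` and `q = k / λ`. -/
abbrev Freq : Type := Plane × ℤ

/-- The measure `λ⁻¹ ∑_q dξ dτ` on frequency space. -/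
def freqMeasure (lam : ℝ) : Measure Freq :=
  lam⁻¹.toNNReal • (volume : Measure Plane).prod Measure.count

instance (lam : ℝ) : SigmaFinite (freqMeasure lam) := by
  unfold freqMeasure; infer_instance

instance (lam : ℝ) : (freqMeasure lam).IsAddLeftInvariant := by
  unfold freqMeasure; infer_instance

instance (lam : ℝ) : (freqMeasure lam).IsNegInvariant := by
  have h : ((volume : Measure Plane).prod (Measure.count : Measure ℤ)).IsNegInvariant := by
    refine ⟨?_⟩
    have : (Neg.neg : Freq → Freq) = Prod.map Neg.neg Neg.neg := rfl
    rw [Measure.neg, this, ← Measure.map_prod_map _ _ measurable_neg measurable_neg]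
    congr 1
    · exact Measure.neg_eq_self volume
    · exact Measure.neg_eq_self Measure.count
  refine ⟨?_⟩
  rw [freqMeasure, Measure.neg, Measure.map_smul]
  congr 1
  exact h.neg_eq_self

/-- `|ζ|` at a point of frequency space. -/
def modulus (lam : ℝ) (p : Freq) : ℝ := absZ (p.1 0) (p.2 / lam)

/-- `τ - σ(ζ)` at a point of frequency space. -/
def modulation (lam : ℝ) (p : Freq) : ℝ := p.1 1 - sigma (p.1 0) (p.2 / lam)

@[fun_prop]
theorem measurable_modulus (lam : ℝ) : Measurable (modulus lam) := by
  unfold modulus absZ; fun_prop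

@[fun_prop]
theorem measurable_modulation (lam : ℝ) : Measurable (modulation lam) := by
  unfold modulation sigma; fun_prop

theorem modulation_neg (lam : ℝ) (p : Freq) : modulation lam (-p) = -modulation lam p := by
  simp only [modulation, sigma, Prod.fst_neg, Prod.snd_neg, PiLp.neg_apply, Int.cast_neg]
  ring

theorem modulus_neg (lam : ℝ) (p : Freq) : modulus lam (-p) = modulus lam p := by
  simp only [modulus, Prod.fst_neg, Prod.snd_neg, PiLp.neg_apply, Int.cast_neg, neg_div, absZ_neg]

theorem isTriangle (lam : ℝ) (p p₁ : Freq) :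
    IsTriangle (p.1 0) (modulus lam p) (modulus lam p₁) (modulus lam (p - p₁)) := by
  have hadd : ∀ a b : Freq, modulus lam (a + b) ≤ modulus lam a + modulus lam b := fun a b => by
    simp only [modulus, Prod.fst_add, Prod.snd_add, PiLp.add_apply, Int.cast_add, add_div]
    exact absZ_add_le _ _ _ _
  refine ⟨absZ_nonneg _ _, absZ_nonneg _ _, absZ_nonneg _ _, ?_, ?_, ?_, abs_le_absZ_left _ _⟩
  · simpa using hadd p₁ (p - p₁)
  · have := hadd p (-(p - p₁))
    rwa [modulus_neg, neg_sub, add_sub_cancel] at this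
  · have := hadd p (-p₁)
    rwa [modulus_neg, ← sub_eq_add_neg] at this

theorem lintegral_plane {f : Plane → ℝ≥0∞} (hf : Measurable f) :
    ∫⁻ w, f w = ∫⁻ x : ℝ, ∫⁻ t : ℝ, f !₂[x, t] := by
  have h1 := ((EuclideanSpace.volume_preserving_symm_measurableEquiv_toLp (Fin 2)).symm).lintegral_comp hf
  have h2 := ((volume_preserving_finTwoArrow ℝ).symm).lintegral_comp
    (hf.comp (MeasurableEquiv.measurable (MeasurableEquiv.toLp 2 (Fin 2 → ℝ))))
  rw [← h1]
  refine h2.symm.trans ?_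
  rw [Measure.volume_eq_prod, lintegral_prod]
  · rfl
  · refine Measurable.aemeasurable ?_
    exact (hf.comp (MeasurableEquiv.measurable (MeasurableEquiv.toLp 2 (Fin 2 → ℝ)))).comp
      (MeasurableEquiv.measurable _)

theorem lintegral_freqMeasure (lam : ℝ) {f : Freq → ℝ≥0∞} (hf : Measurable f) :
    ∫⁻ p, f p ∂freqMeasure lam = ENNReal.ofReal lam⁻¹ * ∑' k : ℤ, ∫⁻ w, f (w, k) := by
  rw [freqMeasure, ← Measure.coe_nnreal_smul, lintegral_smul_measure, lintegral_prod_symm _ hf.aemeasurable,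
    lintegral_count]
  rfl

/-- The `τ`-integration in the fibre integrals. -/
theorem lintegral_fibre_le {p : ℝ} (hp : 0 ≤ p) (lam : ℝ) (P : Freq) {Y : ℝ → ℤ → ℝ≥0∞}
    (hY : Measurable fun z : ℝ × ℤ => Y z.1 z.2) :
    ∫⁻ p', Y (p'.1 0) p'.2 * (jap p (modulation lam p') * jap p (modulation lam (P - p')))
        ∂freqMeasure lam ≤
      ENNReal.ofReal (2 ^ p) * (2 * japInt p) * (ENNReal.ofReal lam⁻¹ * ∑' k : ℤ, ∫⁻ x : ℝ,
        Y x k * jap p (P.1 1 - phase (P.1 0) (P.2 / lam) x (k / lam))) := by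
  have hYm : Measurable fun p' : Freq => Y (p'.1 0) p'.2 :=
    hY.comp ((by fun_prop : Measurable fun p' : Freq => p'.1 0).prodMk measurable_snd)
  have hm : Measurable fun p' : Freq =>
      Y (p'.1 0) p'.2 * (jap p (modulation lam p') * jap p (modulation lam (P - p'))) := by
    fun_prop
  rw [lintegral_freqMeasure lam hm, mul_left_comm]
  refine mul_le_mul_right ?_ _
  rw [← ENNReal.tsum_mul_left]
  refine ENNReal.tsum_le_tsum fun k => ?_
  have hmk : Measurable fun w : Plane => Y (w 0) k *
      (jap p (modulation lam (w, k)) * jap p (modulation lam (P - (w, k)))) :=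
    hm.comp measurable_prodMk_right
  refine (lintegral_plane hmk).trans_le ?_
  have hYk : Measurable fun x => Y x k := hY.comp measurable_prodMk_right
  have hphase : Measurable fun x =>
      jap p (P.1 1 - phase (P.1 0) (P.2 / lam) x (k / lam)) := by
    unfold phase sigma; fun_prop
  refine le_trans ?_ (lintegral_const_mul _ (hYk.mul hphase)).le
  refine lintegral_mono fun x => ?_
  have e1 : ∀ t : ℝ, modulation lam (!₂[x, t], k) = t - sigma x (k / lam) := fun t => by
    simp [modulation]
  have e2 : ∀ t : ℝ, modulation lam (P - (!₂[x, t], k)) =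
      (P.1 1 - sigma (P.1 0 - x) (P.2 / lam - k / lam)) - t := fun t => by
    simp [modulation, sub_div]; ring
  simp only [e1, e2]
  rw [show (∫⁻ t : ℝ, Y ((!₂[x, t] : Plane) 0) k * _) = _ from
    lintegral_const_mul (Y x k) (by fun_prop)]
  simp only [Pi.mul_apply]
  rw [mul_left_comm]
  refine mul_le_mul_right ((lintegral_jap_mul_jap hp _ _).trans (le_of_eq ?_)) _
  congr 2
  unfold phase
  ring

theorem lintegral_fibre_transversal {p : ℝ} (hp : 0 ≤ p) (lam : ℝ) (P : Freq) {B : ℝ} (hB : 0 < B)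
    (w : ℤ → ℝ≥0∞) :
    ∫⁻ p', (w p'.2 * (transversalSet B (P.1 0) (P.2 / lam) (p'.2 / lam)).indicator 1 (p'.1 0)) *
        (jap p (modulation lam p') * jap p (modulation lam (P - p'))) ∂freqMeasure lam ≤
      ENNReal.ofReal (2 ^ p) * (2 * japInt p) * (ENNReal.ofReal (2 * 2 ^ p * B⁻¹) * japInt p) *
        (ENNReal.ofReal lam⁻¹ * ∑' k : ℤ, w k) := by
  refine (lintegral_fibre_le hp lam P (Y := fun x k =>
    w k * (transversalSet B (P.1 0) (P.2 / lam) (k / lam)).indicator 1 x) ?_).trans ?_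
  · refine ((measurable_from_top (f := w)).comp measurable_snd).mul ?_
    have hS : MeasurableSet {z : ℝ × ℤ | B ≤ |absZ z.1 (z.2 / lam) ^ 2 -
        absZ (P.1 0 - z.1) (P.2 / lam - z.2 / lam) ^ 2|} := by
      refine measurableSet_le measurable_const ?_
      unfold absZ; fun_prop
    exact measurable_one.indicator hS
  · rw [mul_assoc (ENNReal.ofReal (2 ^ p) * (2 * japInt p))]
    refine mul_le_mul_right ?_ _
    rw [mul_left_comm]
    refine mul_le_mul_right ?_ _
    rw [← ENNReal.tsum_mul_left]
    refine ENNReal.tsum_le_tsum fun k => ?_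
    have hS : MeasurableSet (transversalSet B (P.1 0) (P.2 / lam) (k / lam)) := by
      refine measurableSet_le measurable_const ?_
      unfold absZ; fun_prop
    have hphase : Measurable fun x =>
        jap p (P.1 1 - phase (P.1 0) (P.2 / lam) x (k / lam)) := by
      unfold phase sigma; fun_prop
    calc _ = ∫⁻ x, w k * (transversalSet B (P.1 0) (P.2 / lam) (k / lam)).indicator
          (fun x => jap p (P.1 1 - phase (P.1 0) (P.2 / lam) x (k / lam))) x := by
          refine lintegral_congr fun x => ?_
          rw [mul_assoc]
          congr 1
          by_cases hx : x ∈ transversalSet B (P.1 0) (P.2 / lam) (k / lam)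
          · simp [hx]
          · simp [hx]
      _ ≤ _ := by
          rw [lintegral_const_mul _ (hphase.indicator hS), mul_comm]
          exact mul_le_mul_left (lintegral_jap_transversal hp hB _ _ _ _) _

theorem lintegral_fibre_nondegenerate {p : ℝ} (hp : 0 ≤ p) {lam : ℝ} (hlam : 1 < lam) (P : Freq)
    (hX : P.1 0 ≠ 0) (hE : 3 * P.1 0 ^ 2 - (P.2 / lam) ^ 2 ≠ 0) {R M : ℝ} (hR : 0 < R)
    (hM : 0 ≤ M) :
    ∫⁻ p', {r : ℝ | |r| ≤ M}.indicator 1 (p'.2 / lam : ℝ) *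
        (jap p (modulation lam p') * jap p (modulation lam (P - p'))) ∂freqMeasure lam ≤
      ENNReal.ofReal (2 ^ p) * (2 * japInt p) * (ENNReal.ofReal (8 * 2 ^ p *
        ((R + 1) * (√|P.1 0|)⁻¹) + 4 * ((M + 1) *
          (√|3 * P.1 0 ^ 2 - (P.2 / lam) ^ 2| * R)⁻¹)) * japInt p) := by
  refine (lintegral_fibre_le hp lam P (Y := fun _ k =>
    {r : ℝ | |r| ≤ M}.indicator 1 (k / lam : ℝ)) ?_).trans ?_
  · exact (measurable_from_top (f := fun k : ℤ =>
      ({r : ℝ | |r| ≤ M}.indicator 1 (k / lam : ℝ) : ℝ≥0∞))).comp measurable_snd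
  · refine mul_le_mul_right ?_ _
    have hphase : ∀ k : ℤ, Measurable fun x =>
        jap p (P.1 1 - phase (P.1 0) (P.2 / lam) x (k / lam)) := fun k => by
      unfold phase sigma; fun_prop
    simp only [lintegral_const_mul _ (hphase _)]
    exact tsum_lintegral_jap_nondegenerate hp hlam hX hE hR hM _

theorem lintegral_fibre_decay {p : ℝ} (hp : 0 ≤ p) {lam : ℝ} (hlam : 1 < lam) (P : Freq)
    {a : ℝ} (ha : 0 ≤ a) :
    ∫⁻ p', (jap a (p'.1 0) * jap a (p'.2 / lam)) *
        (jap p (modulation lam p') * jap p (modulation lam (P - p'))) ∂freqMeasure lam ≤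
      ENNReal.ofReal (2 ^ p) * (2 * japInt p) *
        (japInt a * (ENNReal.ofReal (2 ^ a) * japInt a)) := by
  refine (lintegral_fibre_le hp lam P (Y := fun x k => jap a x * jap a (k / lam)) ?_).trans ?_
  · fun_prop
  · refine mul_le_mul_right ?_ _
    calc _ ≤ ENNReal.ofReal lam⁻¹ * ∑' k : ℤ, japInt a * jap a (k / lam - 0) := by
          refine mul_le_mul_right (ENNReal.tsum_le_tsum fun k => ?_) _
          rw [japInt, ← lintegral_mul_const _ (by fun_prop)]
          refine lintegral_mono fun x => ?_
          rw [sub_zero]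
          exact mul_le_of_le_one_right' (jap_le_one hp _)
      _ ≤ _ := by
          rw [ENNReal.tsum_mul_left, mul_left_comm]
          exact mul_le_mul_right (tsum_jap_le hlam ha 0) _

theorem modulus_nonneg (lam : ℝ) (p : Freq) : 0 ≤ modulus lam p := absZ_nonneg _ _

theorem modulus_sq (lam : ℝ) (p : Freq) :
    modulus lam p ^ 2 = 3 * p.1 0 ^ 2 + (p.2 / lam : ℝ) ^ 2 := absZ_sq _ _

theorem modulus_sub_sq (lam : ℝ) (p p' : Freq) :
    modulus lam (p - p') ^ 2 = absZ (p.1 0 - p'.1 0) (p.2 / lam - p'.2 / lam) ^ 2 := by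
  simp [modulus, sub_div]

theorem modulus_sub_comm (lam : ℝ) (p p' : Freq) :
    modulus lam (p - p') = modulus lam (p' - p) := by
  rw [← neg_sub, modulus_neg]

/-! ### Fibre integrals in terms of the modulus of the fixed frequency -/

/-- The constant of the fibre integrals. -/
def fibreConst (p : ℝ) : ℝ≥0∞ := ENNReal.ofReal (2 ^ p) * (2 * japInt p)

theorem fibreConst_ne_top {p : ℝ} (hp : 1 < p) : fibreConst p ≠ ⊤ :=
  ENNReal.mul_ne_top ENNReal.ofReal_ne_top
    (ENNReal.mul_ne_top (by simp) (japInt_lt_top hp).ne)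

/-- The ξ-integral gives (1 + |P|)^{-2}, exactly cancelling the weight. The q-sum converges without
any cutoff since 3/2 > 1, with the decay centred at either input. -/
theorem exists_fibre_le_decaying {p : ℝ} (hp : 1 < p) :
    ∃ A : ℝ≥0∞, A ≠ ⊤ ∧ ∀ lam : ℝ, 1 < lam → ∀ P : Freq,
      ∫⁻ p', ENNReal.ofReal ((1 + modulus lam P) ^ 2) *
        ((jap (3 / 2) (p'.2 / lam) + jap (3 / 2) (p'.2 / lam - P.2 / lam)) *
        (transversalSet ((1 + modulus lam P) ^ 2 / 2000) (P.1 0) (P.2 / lam)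
          (p'.2 / lam)).indicator 1 (p'.1 0)) *
        (jap p (modulation lam p') * jap p (modulation lam (P - p'))) ∂freqMeasure lam ≤ A := by
  have h32 : (1 : ℝ) < 3 / 2 := by norm_num
  refine ⟨fibreConst p * (ENNReal.ofReal (2 * 2 ^ p * 2000) * japInt p) *
    (ENNReal.ofReal (2 ^ (3 / 2 : ℝ)) * japInt (3 / 2) +
      ENNReal.ofReal (2 ^ (3 / 2 : ℝ)) * japInt (3 / 2)), ?_, fun lam hlam P => ?_⟩
  · have h1 := (japInt_lt_top hp).ne
    have h2 := (japInt_lt_top h32).ne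
    have h3 := fibreConst_ne_top hp
    finiteness
  · set T := 1 + modulus lam P with hT
    have hT1 : 1 ≤ T := by linarith [modulus_nonneg lam P]
    have hT0 : 0 < T := by linarith
    have h := lintegral_fibre_transversal (zero_lt_one.trans hp).le lam P
      (B := T ^ 2 / 2000) (by positivity)
      (fun k => jap (3 / 2) (k / lam) + jap (3 / 2) (k / lam - P.2 / lam))
    simp only [mul_assoc (ENNReal.ofReal (T ^ 2))]
    rw [lintegral_const_mul' _ _ ENNReal.ofReal_ne_top]
    refine (mul_le_mul_right h _).trans ?_
    rw [ENNReal.tsum_add, mul_add (ENNReal.ofReal lam⁻¹)]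
    have e0 := tsum_jap_le hlam (zero_lt_one.trans h32).le 0
    simp only [sub_zero] at e0
    have e1 := tsum_jap_le hlam (zero_lt_one.trans h32).le (P.2 / lam)
    refine (mul_le_mul_right (mul_le_mul_right (add_le_add e0 e1) _) _).trans (le_of_eq ?_)
    rw [← mul_assoc]
    congr 1
    rw [fibreConst, mul_left_comm]
    congr 1
    rw [← mul_assoc, ← ENNReal.ofReal_mul (by positivity)]
    congr 2
    field_simp

/-- With T = 1 + |P|, the normalized sum over |q| ≤ 6T costs a factor T and the ξ-integral gains
T^{-2}. Any weight up to T would therefore be admissible. -/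
theorem exists_fibre_le_transversal {p : ℝ} (hp : 1 < p) :
    ∃ A : ℝ≥0∞, A ≠ ⊤ ∧ ∀ lam : ℝ, 1 < lam → ∀ P : Freq,
      ∫⁻ p', ENNReal.ofReal ((1 + modulus lam P) ^ (1 / 2 : ℝ)) *
        ({r : ℝ | |r| ≤ 6 * (1 + modulus lam P)}.indicator 1 (p'.2 / lam : ℝ) *
        (transversalSet ((1 + modulus lam P) ^ 2 / 2000) (P.1 0) (P.2 / lam)
          (p'.2 / lam)).indicator 1 (p'.1 0)) *
        (jap p (modulation lam p') * jap p (modulation lam (P - p'))) ∂freqMeasure lam ≤ A := by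
  refine ⟨fibreConst p * japInt p * ENNReal.ofReal (2 * 2 ^ p * 2000 * 14), ?_,
    fun lam hlam P => ?_⟩
  · have h1 := (japInt_lt_top hp).ne
    have h3 := fibreConst_ne_top hp
    finiteness
  · set T := 1 + modulus lam P with hT
    have hT1 : 1 ≤ T := by linarith [modulus_nonneg lam P]
    have hT0 : 0 < T := by linarith
    have h := lintegral_fibre_transversal (zero_lt_one.trans hp).le lam P
      (B := T ^ 2 / 2000) (by positivity)
      (fun k => {r : ℝ | |r| ≤ 6 * T}.indicator 1 (k / lam : ℝ))
    simp only [mul_assoc (ENNReal.ofReal (T ^ (1 / 2 : ℝ)))]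
    rw [lintegral_const_mul' _ _ ENNReal.ofReal_ne_top]
    refine (mul_le_mul_right h _).trans ?_
    have e0 := tsum_indicator_abs_le hlam 0 (6 * T)
    simp only [sub_zero] at e0
    refine (mul_le_mul_right (mul_le_mul_right e0 _) _).trans ?_
    have e : ENNReal.ofReal (T ^ (1 / 2 : ℝ)) * (ENNReal.ofReal (2 ^ p) * (2 * japInt p) *
        (ENNReal.ofReal (2 * 2 ^ p * (T ^ 2 / 2000)⁻¹) * japInt p) *
          ENNReal.ofReal (2 * (6 * T + 1))) = fibreConst p * japInt p *
        ENNReal.ofReal (T ^ (1 / 2 : ℝ) * (2 * 2 ^ p * (T ^ 2 / 2000)⁻¹) *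
          (2 * (6 * T + 1))) := by
      rw [fibreConst, ENNReal.ofReal_mul (p := T ^ (1 / 2 : ℝ) * (2 * 2 ^ p * (T ^ 2 / 2000)⁻¹))
        (by positivity), ENNReal.ofReal_mul (p := T ^ (1 / 2 : ℝ)) (by positivity)]
      ring
    rw [e]
    refine mul_le_mul_right (ENNReal.ofReal_le_ofReal ?_) _
    have hTT : T ^ (1 / 2 : ℝ) ≤ T := by
      conv_rhs => rw [← rpow_one T]
      exact rpow_le_rpow_of_exponent_le hT1 (by norm_num)
    have hp0 : 0 < (2 : ℝ) ^ p := by positivity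
    calc _ ≤ T * (2 * 2 ^ p * (T ^ 2 / 2000)⁻¹) * (2 * (7 * T)) := by gcongr; linarith
      _ = _ := by field_simp; ring

theorem exists_fibre_le_nondegenerate {p : ℝ} (hp : 1 < p) :
    ∃ A : ℝ≥0∞, A ≠ ⊤ ∧ ∀ lam : ℝ, 1 < lam → ∀ P : Freq,
      (1 + modulus lam P) ^ 2 / 1000 ≤ |3 * P.1 0 ^ 2 - (P.2 / lam : ℝ) ^ 2| →
      ∫⁻ p', ENNReal.ofReal (P.1 0 ^ 2 * (1 + modulus lam P) ^ (-(7 / 4) : ℝ)) *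
        {r : ℝ | |r| ≤ 6 * (1 + modulus lam P)}.indicator 1 (p'.2 / lam : ℝ) *
        (jap p (modulation lam p') * jap p (modulation lam (P - p'))) ∂freqMeasure lam ≤ A := by
  refine ⟨fibreConst p * japInt p * ENNReal.ofReal (16 * 2 ^ p + 1120), ?_,
    fun lam hlam P hE => ?_⟩
  · have h1 := (japInt_lt_top hp).ne
    have h3 := fibreConst_ne_top hp
    finiteness
  -- At X = 0 the phase is no longer quadratic in ξ, but the weight X² vanishes.
  · rcases eq_or_ne (P.1 0) 0 with hX | hX
    · simp [hX]
    set T := 1 + modulus lam P with hT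
    have hT1 : 1 ≤ T := by linarith [modulus_nonneg lam P]
    have hT0 : 0 < T := by linarith
    set E := 3 * P.1 0 ^ 2 - (P.2 / lam : ℝ) ^ 2 with hEdef
    have hE0 : E ≠ 0 := by
      rw [← abs_pos]; exact lt_of_lt_of_le (by positivity) hE
    have hXT : |P.1 0| ≤ T := by
      have := abs_le_absZ_left (P.1 0) (P.2 / lam)
      rw [hT, modulus]; linarith
    -- R = T^{1/4} balances the two parts: near the zeros X² |X|^{-1/2} R T^{-7/4} is O(1), and away
    -- from them T² · T · (T R)^{-1} · T^{-7/4} is O(1), since |3X² - Q²| is at least T²/1000.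
    have h := lintegral_fibre_nondegenerate (zero_lt_one.trans hp).le hlam P hX hE0
      (R := T ^ (1 / 4 : ℝ)) (M := 6 * T) (by positivity) (by positivity)
    simp only [mul_assoc (ENNReal.ofReal (P.1 0 ^ 2 * T ^ (-(7 / 4) : ℝ)))]
    rw [lintegral_const_mul' _ _ ENNReal.ofReal_ne_top]
    refine (mul_le_mul_right h _).trans ?_
    rw [← fibreConst, mul_left_comm, ← mul_assoc (ENNReal.ofReal _),
      ← ENNReal.ofReal_mul (by positivity), mul_comm (ENNReal.ofReal _) (japInt p), ← mul_assoc]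
    refine mul_le_mul_right (ENNReal.ofReal_le_ofReal ?_) _
    have hX0 : 0 < |P.1 0| := abs_pos.2 hX
    have hR : 1 ≤ T ^ (1 / 4 : ℝ) := one_le_rpow hT1 (by norm_num)
    have hsE : T / 40 ≤ √|E| := by
      refine le_sqrt_of_sq_le (le_trans ?_ hE)
      nlinarith [sq_nonneg T]
    have hq : T ^ (-(7 / 4) : ℝ) * T ^ (1 / 4 : ℝ) * T ^ (3 / 2 : ℝ) = 1 := by
      rw [← rpow_add hT0, ← rpow_add hT0]; norm_num
    have hq2 : T ^ (-(7 / 4) : ℝ) * T ^ 2 * (T ^ (1 / 4 : ℝ))⁻¹ = 1 := by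
      rw [← rpow_natCast, ← rpow_neg hT0.le, ← rpow_add hT0, ← rpow_add hT0]; norm_num
    have hX32 : P.1 0 ^ 2 * (√|P.1 0|)⁻¹ ≤ T ^ (3 / 2 : ℝ) := by
      rw [← sq_abs, sqrt_eq_rpow, ← rpow_natCast, ← rpow_neg hX0.le, ← rpow_add hX0]
      refine le_trans (le_of_eq (by norm_num)) (rpow_le_rpow hX0.le hXT (by norm_num))
    have hX2 : P.1 0 ^ 2 ≤ T ^ 2 := by rw [← sq_abs]; gcongr
    rw [mul_add]
    refine add_le_add ?_ ?_
    · calc _ = 8 * 2 ^ p * (T ^ (-(7 / 4) : ℝ) * (T ^ (1 / 4 : ℝ) + 1) *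
            (P.1 0 ^ 2 * (√|P.1 0|)⁻¹)) := by ring
        _ ≤ 8 * 2 ^ p * (T ^ (-(7 / 4) : ℝ) * (2 * T ^ (1 / 4 : ℝ)) * T ^ (3 / 2 : ℝ)) := by
            gcongr; linarith
        _ = 16 * 2 ^ p * (T ^ (-(7 / 4) : ℝ) * T ^ (1 / 4 : ℝ) * T ^ (3 / 2 : ℝ)) := by ring
        _ = _ := by rw [hq, mul_one]
    · calc _ ≤ T ^ 2 * T ^ (-(7 / 4) : ℝ) * (4 * ((7 * T) * (T / 40 * T ^ (1 / 4 : ℝ))⁻¹)) := by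
            gcongr; linarith
        _ = 1120 * (T ^ (-(7 / 4) : ℝ) * T ^ 2 * (T ^ (1 / 4 : ℝ))⁻¹) := by field_simp; ring
        _ = _ := by rw [hq2, mul_one]

theorem exists_fibre_le_decay {p : ℝ} (hp : 1 < p) :
    ∃ A : ℝ≥0∞, A ≠ ⊤ ∧ ∀ lam : ℝ, 1 < lam → ∀ P : Freq,
      ∫⁻ p', (jap (3 / 2) (p'.1 0) * jap (3 / 2) (p'.2 / lam)) *
        (jap p (modulation lam p') * jap p (modulation lam (P - p'))) ∂freqMeasure lam ≤ A := by
  have h32 : (1 : ℝ) < 3 / 2 := by norm_num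
  refine ⟨_, ?_, fun lam hlam P => lintegral_fibre_decay (zero_lt_one.trans hp).le hlam P
    (zero_lt_one.trans h32).le⟩
  have h1 := (japInt_lt_top h32).ne
  have h3 := (japInt_lt_top hp).ne
  finiteness

/-! ### Weighted convolution estimates -/

/-- The bilinear estimate `‖∫ K(p, p₁) F₁(p₁) F₂(p - p₁)‖² ≤ A ‖F₁‖² ‖F₂‖²`. -/
def ConvBound (ν : Measure Freq) (K : Freq → Freq → ℝ≥0∞) (A : ℝ≥0∞) : Prop :=
  ∀ F₁ F₂ : Freq → ℝ≥0∞, Measurable F₁ → Measurable F₂ →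
    ∫⁻ p, (∫⁻ p₁, K p p₁ * (F₁ p₁ * F₂ (p - p₁)) ∂ν) ^ 2 ∂ν ≤
      A * ((∫⁻ p, F₁ p ^ 2 ∂ν) * ∫⁻ p, F₂ p ^ 2 ∂ν)

theorem ENNReal_add_sq_le (a b : ℝ≥0∞) : (a + b) ^ 2 ≤ 2 * (a ^ 2 + b ^ 2) := by
  have h := ENNReal.rpow_add_le_mul_rpow_add_rpow a b (p := 2) (by norm_num)
  simp only [ENNReal.rpow_two] at h
  refine h.trans (le_of_eq ?_)
  norm_num

theorem ConvBound.mono {ν : Measure Freq} {K K' : Freq → Freq → ℝ≥0∞} {A A' : ℝ≥0∞}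
    (h : ConvBound ν K A) (hK : ∀ p p₁, K' p p₁ ≤ K p p₁) (hA : A ≤ A') : ConvBound ν K' A' :=
  fun F₁ F₂ h₁ h₂ => le_trans (lintegral_mono fun p => pow_le_pow_left'
    (lintegral_mono fun p₁ => mul_le_mul_left (hK p p₁) _) 2)
    ((h F₁ F₂ h₁ h₂).trans (mul_le_mul_left hA _))

theorem ConvBound.add {ν : Measure Freq} [SigmaFinite ν] {K K' : Freq → Freq → ℝ≥0∞}
    {A A' : ℝ≥0∞} (h : ConvBound ν K A) (h' : ConvBound ν K' A')
    (hK : Measurable fun x : Freq × Freq => K x.1 x.2) :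
    ConvBound ν (fun p p₁ => K p p₁ + K' p p₁) (2 * (A + A')) := fun F₁ F₂ h₁ h₂ => by
  have hm : Measurable fun x : Freq × Freq => K x.1 x.2 * (F₁ x.2 * F₂ (x.1 - x.2)) :=
    hK.mul ((h₁.comp measurable_snd).mul (h₂.comp (measurable_fst.sub measurable_snd)))
  calc _ ≤ ∫⁻ p, 2 * ((∫⁻ p₁, K p p₁ * (F₁ p₁ * F₂ (p - p₁)) ∂ν) ^ 2 +
        (∫⁻ p₁, K' p p₁ * (F₁ p₁ * F₂ (p - p₁)) ∂ν) ^ 2) ∂ν := by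
        refine lintegral_mono fun p => ?_
        refine le_trans (le_of_eq ?_) (ENNReal_add_sq_le _ _)
        congr 1
        refine Eq.trans ?_ (lintegral_add_left (hm.comp measurable_prodMk_left) _)
        refine lintegral_congr fun p₁ => ?_
        simp only [Function.comp_apply]
        ring
    _ = 2 * ((∫⁻ p, (∫⁻ p₁, K p p₁ * (F₁ p₁ * F₂ (p - p₁)) ∂ν) ^ 2 ∂ν) +
        ∫⁻ p, (∫⁻ p₁, K' p p₁ * (F₁ p₁ * F₂ (p - p₁)) ∂ν) ^ 2 ∂ν) := by
        rw [lintegral_const_mul' _ _ (by simp), lintegral_add_left]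
        exact hm.lintegral_prod_right'.pow_const 2
    _ ≤ _ := by
        rw [mul_assoc, add_mul]
        exact mul_le_mul_right (add_le_add (h F₁ F₂ h₁ h₂) (h' F₁ F₂ h₁ h₂)) _

/-! ### The kernel and the regions of frequency space. -/

section Kernel

variable {s : ℝ} (μ : Profile s) (N lam δ₁ δ₂ : ℝ)

/-- The frequency factor of the kernel. -/
def kerWeight (p p₁ : Freq) : ℝ :=
  multWeight μ N (p.1 0) (modulus lam p) (modulus lam p₁) (modulus lam (p - p₁))

/-- The kernel of the bilinear estimate. -/
def kern (p p₁ : Freq) : ℝ≥0∞ :=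
  ENNReal.ofReal (kerWeight μ N lam p p₁) *
    ENNReal.ofReal (bracket (modulation lam p) ^ (-1 / 2 + δ₁)) *
    (jap (1 / 2 + δ₂) (modulation lam p₁) * jap (1 / 2 + δ₂) (modulation lam (p - p₁)))

theorem kerWeight_nonneg (p p₁ : Freq) : 0 ≤ kerWeight μ N lam p p₁ :=
  multWeight_nonneg μ (modulus_nonneg _ _) (modulus_nonneg _ _) (modulus_nonneg _ _)

theorem measurable_kerWeight : Measurable fun x : Freq × Freq => kerWeight μ N lam x.1 x.2 := by
  have hμ : Measurable μ.toFun := μ.smooth.continuous.measurable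
  unfold kerWeight multWeight commSymb
  fun_prop

theorem measurable_kern : Measurable fun x : Freq × Freq => kern μ N lam δ₁ δ₂ x.1 x.2 := by
  have := measurable_kerWeight μ N lam
  unfold kern
  fun_prop

theorem jap_sq (a x : ℝ) : jap a x ^ 2 = jap (2 * a) x := by
  rw [jap, jap, ← ENNReal.ofReal_pow (rpow_nonneg (bracket_pos x).le _), ← rpow_natCast,
    ← rpow_mul (bracket_pos x).le]
  congr 2; push_cast; ring

theorem kern_sq (p p₁ : Freq) :
    kern μ N lam δ₁ δ₂ p p₁ ^ 2 =
      ENNReal.ofReal (kerWeight μ N lam p p₁ ^ 2 * bracket (modulation lam p) ^ (-1 + 2 * δ₁)) *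
      (jap (1 + 2 * δ₂) (modulation lam p₁) * jap (1 + 2 * δ₂) (modulation lam (p - p₁))) := by
  have hb := (bracket_pos (modulation lam p)).le
  rw [kern, mul_pow, mul_pow, mul_pow, jap_sq, jap_sq, ← ENNReal.ofReal_pow
    (kerWeight_nonneg μ N lam p p₁), ← ENNReal.ofReal_pow (rpow_nonneg hb _),
    ← ENNReal.ofReal_mul (by positivity), ← rpow_natCast, ← rpow_natCast, ← rpow_mul hb]
  congr 3
  · congr 2; push_cast; ring
  · ring
  · ring

/-- The total size of the two input frequencies. -/
def inputSize (p p₁ : Freq) : ℝ := 1 + modulus lam p₁ + modulus lam (p - p₁)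

theorem one_le_inputSize (p p₁ : Freq) : 1 ≤ inputSize lam p p₁ := by
  unfold inputSize; linarith [modulus_nonneg lam p₁, modulus_nonneg lam (p - p₁)]

theorem le_inputSize (p p₁ : Freq) : 1 + modulus lam p ≤ inputSize lam p p₁ ∧
    1 + modulus lam p₁ ≤ inputSize lam p p₁ ∧ 1 + modulus lam (p - p₁) ≤ inputSize lam p p₁ := by
  unfold inputSize
  have h := (isTriangle lam p p₁).le₀
  refine ⟨?_, ?_, ?_⟩ <;> linarith [modulus_nonneg lam p₁, modulus_nonneg lam (p - p₁)]

@[fun_prop]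
theorem measurable_inputSize : Measurable fun x : Freq × Freq => inputSize lam x.1 x.2 := by
  unfold inputSize; fun_prop

/-- The modulation of the output dominates. -/
def regionHigh : Set (Freq × Freq) :=
  {x | inputSize lam x.1 x.2 ^ 10 ≤ bracket (modulation lam x.1)}

/-- The two inputs are transversal. -/
def regionInputs : Set (Freq × Freq) :=
  {x | inputSize lam x.1 x.2 ^ 2 / 2000 ≤ |modulus lam x.2 ^ 2 - modulus lam (x.1 - x.2) ^ 2|}

/-- The output and the first input are transversal. -/
def regionFst : Set (Freq × Freq) :=
  {x | inputSize lam x.1 x.2 ^ 2 / 2000 ≤ |modulus lam x.1 ^ 2 - modulus lam x.2 ^ 2|}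

/-- The output and the second input are transversal. -/
def regionSnd : Set (Freq × Freq) :=
  {x | inputSize lam x.1 x.2 ^ 2 / 2000 ≤ |modulus lam x.1 ^ 2 - modulus lam (x.1 - x.2) ^ 2|}

/-- The output frequency is nondegenerate. -/
def regionNondeg : Set (Freq × Freq) :=
  {x | modulus lam x.1 ^ 2 / 10 ≤ |3 * x.1.1 0 ^ 2 - (x.1.2 / lam : ℝ) ^ 2|}

theorem measurableSet_regionHigh : MeasurableSet (regionHigh lam) :=
  measurableSet_le (by fun_prop) (by fun_prop)

theorem measurableSet_regionInputs : MeasurableSet (regionInputs lam) :=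
  measurableSet_le (by fun_prop) (by fun_prop)

theorem measurableSet_regionFst : MeasurableSet (regionFst lam) :=
  measurableSet_le (by fun_prop) (by fun_prop)

theorem measurableSet_regionSnd : MeasurableSet (regionSnd lam) :=
  measurableSet_le (by fun_prop) (by fun_prop)

theorem measurableSet_regionNondeg : MeasurableSet (regionNondeg lam) :=
  measurableSet_le (by fun_prop) (by fun_prop)

/-- The restriction of a kernel to a region. -/
def cut (S : Set (Freq × Freq)) (K : Freq → Freq → ℝ≥0∞) (p p₁ : Freq) : ℝ≥0∞ :=
  S.indicator (fun x => K x.1 x.2) (p, p₁)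

theorem measurable_cut {S : Set (Freq × Freq)} (hS : MeasurableSet S) {K : Freq → Freq → ℝ≥0∞}
    (hK : Measurable fun x : Freq × Freq => K x.1 x.2) :
    Measurable fun x : Freq × Freq => cut S K x.1 x.2 := hK.indicator hS

theorem cut_sq_le {S : Set (Freq × Freq)} {K : Freq → Freq → ℝ≥0∞} {p p₁ : Freq} {a : ℝ≥0∞}
    (h : (p, p₁) ∈ S → K p p₁ ^ 2 ≤ a) : cut S K p p₁ ^ 2 ≤ a := by
  by_cases hx : (p, p₁) ∈ S
  · rw [cut, Set.indicator_of_mem hx]; exact h hx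
  · rw [cut, Set.indicator_of_notMem hx]; simp

end Kernel

/-! ### The bilinear estimate, region by region. -/

section Regions

variable {s : ℝ} (μ : Profile s)

theorem rpow_le_jap {a n x : ℝ} (ha : 0 ≤ a) (h : |x| ≤ n) :
    ENNReal.ofReal ((1 + n) ^ (-a)) ≤ jap a x :=
  ENNReal.ofReal_le_ofReal (rpow_le_rpow_of_nonpos (bracket_pos x)
    (by unfold bracket; linarith) (by linarith))

theorem abs_fst_le_modulus (lam : ℝ) (p : Freq) : |p.1 0| ≤ modulus lam p :=
  abs_le_absZ_left _ _

theorem abs_snd_le_modulus (lam : ℝ) (p : Freq) : |(p.2 / lam : ℝ)| ≤ modulus lam p :=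
  abs_le_absZ_right _ _

theorem kern_eq_zero {N lam δ₁ δ₂ : ℝ} (hN : 0 < N) {p p₁ : Freq}
    (h : modulus lam p₁ + modulus lam (p - p₁) ≤ N) : kern μ N lam δ₁ δ₂ p p₁ = 0 := by
  rw [kern, kerWeight, (isTriangle lam p p₁).multWeight_eq_zero hN h]
  simp

theorem exists_convBound_high (hs : 9 / 10 < s) {δ₁ δ₂ : ℝ} (h₁ : δ₁ ≤ 1 / 1000) (h₂ : 0 < δ₂) :
    ∃ A : ℝ≥0∞, A ≠ ⊤ ∧ ∀ lam N : ℝ, 1 < lam → 1 ≤ N →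
      ConvBound (freqMeasure lam) (cut (regionHigh lam) (kern μ N lam δ₁ δ₂))
        (A * ENNReal.ofReal (N ^ (-(1 / 5) : ℝ))) := by
  obtain ⟨C, hC, hmul⟩ := exists_mult_le_high_modulation μ hs
  obtain ⟨A, hA, hfib⟩ := exists_fibre_le_decay (p := 1 + 2 * δ₂) (by linarith)
  refine ⟨ENNReal.ofReal C * A, by finiteness, fun lam N hlam hN F₁ F₂ hF₁ hF₂ => ?_⟩
  refine lintegral_sq_conv_le_of_fst _ (measurable_cut (measurableSet_regionHigh lam)
    (measurable_kern μ N lam δ₁ δ₂)) hF₁ hF₂ fun P => ?_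
  calc _ ≤ ∫⁻ p', ENNReal.ofReal (C * N ^ (-(1 / 5) : ℝ)) *
        ((jap (3 / 2) (p'.1 0) * jap (3 / 2) (p'.2 / lam)) * (jap (1 + 2 * δ₂) (modulation lam p') *
          jap (1 + 2 * δ₂) (modulation lam (P - p')))) ∂freqMeasure lam := by
        refine lintegral_mono fun p' => cut_sq_le fun hx => ?_
        rw [kern_sq, ← mul_assoc (ENNReal.ofReal (C * _))]
        refine mul_le_mul_left ?_ _
        have h := hmul N (P.1 0) _ _ _ (bracket (modulation lam P)) δ₁ hN (isTriangle lam P p') h₁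
          hx
        refine (ENNReal.ofReal_le_ofReal h).trans ?_
        rw [ENNReal.ofReal_mul (by positivity)]
        refine mul_le_mul_right ?_ _
        have := modulus_nonneg lam p'
        rw [ENNReal.ofReal_mul (by positivity)]
        exact mul_le_mul' (rpow_le_jap (by norm_num) (abs_fst_le_modulus lam p'))
          (rpow_le_jap (by norm_num) (abs_snd_le_modulus lam p'))
    _ ≤ _ := by
        rw [lintegral_const_mul' _ _ ENNReal.ofReal_ne_top, ENNReal.ofReal_mul hC.le,
          mul_right_comm]
        exact mul_le_mul_left (mul_le_mul_right (hfib lam hlam P) _) _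

/-- The output is held fixed, so the fibre integral already contains the two input modulations. The
output weight is merely bounded by 1. -/
theorem exists_convBound_inputs (hs : 9 / 10 < s) {δ₁ δ₂ : ℝ} (h₁ : δ₁ ≤ 1 / 1000) (h₂ : 0 < δ₂) :
    ∃ A : ℝ≥0∞, A ≠ ⊤ ∧ ∀ lam N : ℝ, 1 < lam → 1 ≤ N →
      ConvBound (freqMeasure lam) (cut (regionInputs lam) (kern μ N lam δ₁ δ₂))
        (A * ENNReal.ofReal (N ^ (-(1 / 5) : ℝ))) := by
  obtain ⟨C, hC, hmul⟩ := exists_mult_le_transversal μ hs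
  obtain ⟨A, hA, hfib⟩ := exists_fibre_le_decaying (p := 1 + 2 * δ₂) (by linarith)
  refine ⟨ENNReal.ofReal C * A, by finiteness, fun lam N hlam hN F₁ F₂ hF₁ hF₂ => ?_⟩
  refine lintegral_sq_conv_le_of_fst _ (measurable_cut (measurableSet_regionInputs lam)
    (measurable_kern μ N lam δ₁ δ₂)) hF₁ hF₂ fun P => ?_
  have hP := modulus_nonneg lam P
  calc _ ≤ ∫⁻ p', ENNReal.ofReal (C * N ^ (-(1 / 5) : ℝ)) *
        (ENNReal.ofReal ((1 + modulus lam P) ^ 2) *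
        ((jap (3 / 2) (p'.2 / lam) + jap (3 / 2) (p'.2 / lam - P.2 / lam)) *
        (transversalSet ((1 + modulus lam P) ^ 2 / 2000) (P.1 0) (P.2 / lam)
          (p'.2 / lam)).indicator 1 (p'.1 0)) * (jap (1 + 2 * δ₂) (modulation lam p') *
          jap (1 + 2 * δ₂) (modulation lam (P - p')))) ∂freqMeasure lam := by
        refine lintegral_mono fun p' => cut_sq_le fun hx => ?_
        rw [kern_sq, ← mul_assoc (ENNReal.ofReal (C * _))]
        refine mul_le_mul_left ?_ _
        have h := hmul N (P.1 0) _ _ _ (bracket (modulation lam P)) δ₁ hN (isTriangle lam P p') h₁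
          (one_le_bracket _) hx
        have hmem : p'.1 0 ∈ transversalSet ((1 + modulus lam P) ^ 2 / 2000) (P.1 0) (P.2 / lam)
            (p'.2 / lam) := by
          have hx' : inputSize lam P p' ^ 2 / 2000 ≤
            |modulus lam p' ^ 2 - modulus lam (P - p') ^ 2| := hx
          rw [modulus_sub_sq] at hx'
          refine le_trans ?_ hx'
          have := (le_inputSize lam P p').1
          gcongr
        rw [Set.indicator_of_mem hmem, Pi.one_apply, mul_one]
        refine (ENNReal.ofReal_le_ofReal h).trans ?_
        have := modulus_nonneg lam p'
        have := modulus_nonneg lam (P - p')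
        rw [ENNReal.ofReal_mul (by positivity), ENNReal.ofReal_add (by positivity)
          (by positivity), ← mul_assoc (ENNReal.ofReal (C * _)),
          ← ENNReal.ofReal_mul (by positivity), mul_right_comm C, mul_assoc C]
        refine mul_le_mul' le_rfl (add_le_add ?_ ?_)
        · exact rpow_le_jap (by norm_num) (abs_snd_le_modulus lam p')
        · refine rpow_le_jap (by norm_num) ?_
          rw [modulus_sub_comm]
          have := abs_snd_le_modulus lam (p' - P)
          simpa [sub_div] using this
    _ ≤ _ := by
        rw [lintegral_const_mul' _ _ ENNReal.ofReal_ne_top, ENNReal.ofReal_mul hC.le,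
          mul_right_comm]
        exact mul_le_mul_left (mul_le_mul_right (hfib lam hlam P) _) _

/-- Oddness of σ in the form needed to reuse the fibre integrals with an input held fixed: reversing
a frequency only changes the sign of its modulation. -/
theorem jap_modulation_sub_comm (a lam : ℝ) (p p' : Freq) :
    jap a (modulation lam (p - p')) = jap a (modulation lam (p' - p)) := by
  rw [← neg_sub, modulation_neg, jap_neg]

/-- Outside the region of high output modulation the kernel is bounded by a kernel with symmetric
modulation weights. -/
theorem kern_sq_le_of_notMem_high {N lam δ₁ δ₂ a : ℝ} (h₁ : δ₁ ≤ 1 / 1000) (h₂ : 0 < δ₂)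
    (h₂' : δ₂ ≤ 1 / 1000) {p p₁ : Freq} (h : (p, p₁) ∉ regionHigh lam)
    (ha : kerWeight μ N lam p p₁ ^ 2 * inputSize lam p p₁ ^ (1 / 20 : ℝ) ≤ a) :
    kern μ N lam δ₁ δ₂ p p₁ ^ 2 ≤ ENNReal.ofReal a *
      (jap (1 + 2 * δ₂) (modulation lam p) * jap (1 + 2 * δ₂) (modulation lam p₁)) ∧
    kern μ N lam δ₁ δ₂ p p₁ ^ 2 ≤ ENNReal.ofReal a *
      (jap (1 + 2 * δ₂) (modulation lam p) * jap (1 + 2 * δ₂) (modulation lam (p - p₁))) := by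
  have hlt : bracket (modulation lam p) < inputSize lam p p₁ ^ 10 := not_le.1 h
  have hM := one_le_inputSize lam p p₁
  have hb := bracket_pos (modulation lam p)
  have hone : ∀ x, jap (1 + 2 * δ₂) x ≤ 1 := jap_le_one (by linarith)
  have hmain : ENNReal.ofReal (kerWeight μ N lam p p₁ ^ 2 *
      bracket (modulation lam p) ^ (-1 + 2 * δ₁)) ≤
      ENNReal.ofReal a * jap (1 + 2 * δ₂) (modulation lam p) := by
    have ha0 : 0 ≤ a := le_trans (by positivity) ha
    rw [jap, ← ENNReal.ofReal_mul ha0]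
    refine ENNReal.ofReal_le_ofReal ?_
    calc _ ≤ kerWeight μ N lam p p₁ ^ 2 * (inputSize lam p p₁ ^ (1 / 20 : ℝ) *
          bracket (modulation lam p) ^ (-(1 + 2 * δ₂))) :=
          mul_le_mul_of_nonneg_left
            (modulation_weight_le (one_le_bracket _) hM hlt.le h₁ h₂') (by positivity)
      _ ≤ _ := by
          rw [← mul_assoc]
          exact mul_le_mul_of_nonneg_right ha (by positivity)
  rw [kern_sq]
  constructor
  · rw [← mul_assoc (ENNReal.ofReal a)]
    exact mul_le_mul' hmain (mul_le_of_le_one_right' (hone _))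
  · rw [← mul_assoc (ENNReal.ofReal a)]
    exact mul_le_mul' hmain (mul_le_of_le_one_left' (hone _))

/-- The frequency weight when both inputs are comparable to their sum. -/
theorem kerWeight_sq_mul_le (hs : 9 / 10 < s) {N lam T : ℝ} (hN : 1 ≤ N) {p p₁ : Freq}
    (h₁ : inputSize lam p p₁ ≤ 6 * modulus lam p₁)
    (h₂ : inputSize lam p p₁ ≤ 6 * modulus lam (p - p₁)) (hT : inputSize lam p p₁ ≤ 6 * T) :
    kerWeight μ N lam p p₁ ^ 2 * inputSize lam p p₁ ^ (1 / 20 : ℝ) ≤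
      180 ^ 2 * 6 * N ^ (-(1 / 5) : ℝ) * T ^ (1 / 2 : ℝ) := by
  have h := multWeight_sq_le μ hs hN (isTriangle lam p p₁) h₁ h₂
  have hM := one_le_inputSize lam p p₁
  set M := inputSize lam p p₁ with hMdef
  change kerWeight μ N lam p p₁ ^ 2 ≤ 180 ^ 2 * (M / N) ^ (2 / 5 : ℝ) at h
  have hM0 : 0 < M := by linarith
  have hT0 : 0 < T := by linarith
  have hN0 : 0 < N := by linarith
  calc _ ≤ 180 ^ 2 * (M / N) ^ (2 / 5 : ℝ) * M ^ (1 / 20 : ℝ) := by gcongr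
    _ = 180 ^ 2 * N ^ (-(2 / 5) : ℝ) * (M ^ (2 / 5 : ℝ) * M ^ (1 / 20 : ℝ)) := by
        rw [div_rpow hM0.le hN0.le, rpow_neg hN0.le]; ring
    _ ≤ 180 ^ 2 * N ^ (-(1 / 5) : ℝ) * (6 * T ^ (1 / 2 : ℝ)) := by
        have e1 : N ^ (-(2 / 5) : ℝ) ≤ N ^ (-(1 / 5) : ℝ) :=
          rpow_le_rpow_of_exponent_le hN (by norm_num)
        have e2 : M ^ (2 / 5 : ℝ) * M ^ (1 / 20 : ℝ) ≤ 6 * T ^ (1 / 2 : ℝ) := by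
          rw [← rpow_add hM0]
          calc _ ≤ M ^ (1 / 2 : ℝ) := rpow_le_rpow_of_exponent_le hM (by norm_num)
            _ ≤ (6 * T) ^ (1 / 2 : ℝ) := rpow_le_rpow hM0.le hT (by norm_num)
            _ = 6 ^ (1 / 2 : ℝ) * T ^ (1 / 2 : ℝ) := mul_rpow (by norm_num) hT0.le
            _ ≤ _ := by
              gcongr
              calc (6 : ℝ) ^ (1 / 2 : ℝ) ≤ 6 ^ (1 : ℝ) :=
                    rpow_le_rpow_of_exponent_le (by norm_num) (by norm_num)
                _ = 6 := rpow_one 6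
        gcongr
    _ = _ := by ring

theorem comparable_of_notMem {N lam : ℝ} (hN : 1 ≤ N) {p p₁ : Freq}
    (hn : N < modulus lam p₁ + modulus lam (p - p₁)) (h : (p, p₁) ∉ regionInputs lam) :
    inputSize lam p p₁ ≤ 6 * modulus lam p₁ ∧ inputSize lam p p₁ ≤ 6 * modulus lam (p - p₁) :=
  (isTriangle lam p p₁).comparable (by linarith) (not_le.1 h)

/-- The second input is held fixed. The output and the first input then run along the fibre with
constant difference, and their transversality bounds the ξ-integral. Excluding transversal inputs
makes both inputs comparable to M. -/
theorem exists_convBound_fst (hs : 9 / 10 < s) {δ₁ δ₂ : ℝ} (h₁ : δ₁ ≤ 1 / 1000) (h₂ : 0 < δ₂)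
    (h₂' : δ₂ ≤ 1 / 1000) :
    ∃ A : ℝ≥0∞, A ≠ ⊤ ∧ ∀ lam N : ℝ, 1 < lam → 1 ≤ N →
      ConvBound (freqMeasure lam)
        (cut (((regionHigh lam)ᶜ ∩ (regionInputs lam)ᶜ) ∩ regionFst lam) (kern μ N lam δ₁ δ₂))
        (A * ENNReal.ofReal (N ^ (-(1 / 5) : ℝ))) := by
  obtain ⟨A, hA, hfib⟩ := exists_fibre_le_transversal (p := 1 + 2 * δ₂) (by linarith)
  refine ⟨ENNReal.ofReal (180 ^ 2 * 6) * A, by finiteness, fun lam N hlam hN F₁ F₂ hF₁ hF₂ => ?_⟩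
  refine lintegral_sq_conv_le_of_sub _ (measurable_cut (((measurableSet_regionHigh lam).compl.inter
    (measurableSet_regionInputs lam).compl).inter (measurableSet_regionFst lam))
    (measurable_kern μ N lam δ₁ δ₂)) hF₁ hF₂ fun P => ?_
  have hP := modulus_nonneg lam P
  calc _ ≤ ∫⁻ p', ENNReal.ofReal (180 ^ 2 * 6 * N ^ (-(1 / 5) : ℝ)) *
        (ENNReal.ofReal ((1 + modulus lam P) ^ (1 / 2 : ℝ)) *
        ({r : ℝ | |r| ≤ 6 * (1 + modulus lam P)}.indicator 1 (p'.2 / lam : ℝ) *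
        (transversalSet ((1 + modulus lam P) ^ 2 / 2000) (P.1 0) (P.2 / lam)
          (p'.2 / lam)).indicator 1 (p'.1 0)) * (jap (1 + 2 * δ₂) (modulation lam p') *
          jap (1 + 2 * δ₂) (modulation lam (P - p')))) ∂freqMeasure lam := by
        refine lintegral_mono fun p' => cut_sq_le fun hx => ?_
        obtain ⟨⟨hx1, hx2⟩, hx3⟩ := hx
        -- Here `P` is the second input, `p'` the output and `p' - P` the first input.
        rcases le_or_gt (modulus lam (p' - P) + modulus lam (p' - (p' - P))) N with hn | hn
        · rw [kern_eq_zero μ (by linarith) hn]; simp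
        obtain ⟨hc1, hc2⟩ := comparable_of_notMem hN hn hx2
        have hsize := le_inputSize lam p' (p' - P)
        have hTM := hsize.2.2
        rw [sub_sub_cancel] at hc2 hTM
        have hmem : p'.1 0 ∈ transversalSet ((1 + modulus lam P) ^ 2 / 2000) (P.1 0) (P.2 / lam)
            (p'.2 / lam) := by
          have hx' : inputSize lam p' (p' - P) ^ 2 / 2000 ≤
            |modulus lam p' ^ 2 - modulus lam (p' - P) ^ 2| := hx3
          rw [modulus_sub_comm, modulus_sub_sq] at hx'
          refine le_trans ?_ hx'
          gcongr
        have hmem2 : (p'.2 / lam : ℝ) ∈ {r : ℝ | |r| ≤ 6 * (1 + modulus lam P)} := by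
          have := abs_snd_le_modulus lam p'
          rw [Set.mem_ofPred_eq]
          linarith [hsize.1]
        rw [Set.indicator_of_mem hmem, Set.indicator_of_mem hmem2, Pi.one_apply, Pi.one_apply,
          mul_one, mul_one, ← mul_assoc, ← ENNReal.ofReal_mul (by positivity),
          jap_modulation_sub_comm _ _ P]
        refine (kern_sq_le_of_notMem_high μ h₁ h₂ h₂' hx1 ?_).1
        refine kerWeight_sq_mul_le μ hs hN hc1 ?_ (by linarith)
        rwa [sub_sub_cancel]
    _ ≤ _ := by
        rw [lintegral_const_mul' _ _ ENNReal.ofReal_ne_top, ENNReal.ofReal_mul (by norm_num),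
          mul_right_comm]
        exact mul_le_mul_left (mul_le_mul_right (hfib lam hlam P) _) _

end Regions

/-- All three squares agree up to M²/1000, while M² ≤ 8 (n₁² + n₂²); hence M² is about 16 times each
of them at most, and 20 leaves room. -/
theorem equilateral_bounds {n₀ n₁ n₂ : ℝ} (h1 : 0 ≤ n₁) (h2 : 0 ≤ n₂)
    (hn : 1 ≤ n₁ + n₂) (h₀₁ : |n₀ ^ 2 - n₁ ^ 2| < (1 + n₁ + n₂) ^ 2 / 2000)
    (h₀₂ : |n₀ ^ 2 - n₂ ^ 2| < (1 + n₁ + n₂) ^ 2 / 2000) :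
    (1 + n₁ + n₂) ^ 2 ≤ 20 * n₀ ^ 2 ∧ (1 + n₁ + n₂) ^ 2 ≤ 20 * n₁ ^ 2 ∧
      (1 + n₁ + n₂) ^ 2 ≤ 20 * n₂ ^ 2 := by
  obtain ⟨a, b⟩ := abs_lt.1 h₀₁
  obtain ⟨c, d⟩ := abs_lt.1 h₀₂
  have hM : (1 + n₁ + n₂) ^ 2 ≤ 4 * (n₁ + n₂) ^ 2 := by nlinarith
  have hp : (n₁ + n₂) ^ 2 ≤ 2 * (n₁ ^ 2 + n₂ ^ 2) := by nlinarith [sq_nonneg (n₁ - n₂)]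
  refine ⟨?_, ?_, ?_⟩ <;> linarith

section Regions

variable {s : ℝ} (μ : Profile s)

/-- All three frequencies have comparable size, and no two of them are transversal. -/
def regionEquilateral (lam : ℝ) : Set (Freq × Freq) :=
  ((regionInputs lam)ᶜ ∩ (regionFst lam)ᶜ) ∩ (regionSnd lam)ᶜ

theorem measurableSet_regionEquilateral (lam : ℝ) : MeasurableSet (regionEquilateral lam) :=
  ((measurableSet_regionInputs lam).compl.inter (measurableSet_regionFst lam).compl).inter
    (measurableSet_regionSnd lam).compl

theorem regionEquilateral_bounds {lam : ℝ} {p p₁ : Freq}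
    (hn : 1 ≤ modulus lam p₁ + modulus lam (p - p₁)) (h : (p, p₁) ∈ regionEquilateral lam) :
    inputSize lam p p₁ ^ 2 ≤ 20 * modulus lam p ^ 2 ∧
    inputSize lam p p₁ ^ 2 ≤ 20 * modulus lam p₁ ^ 2 ∧
    inputSize lam p p₁ ^ 2 ≤ 20 * modulus lam (p - p₁) ^ 2 :=
  equilateral_bounds (modulus_nonneg lam p₁) (modulus_nonneg lam _) hn (not_le.1 h.1.2)
    (not_le.1 h.2)

theorem le_six_mul_of_sq_le {M n : ℝ} (hn : 0 ≤ n) (h : M ^ 2 ≤ 20 * n ^ 2) :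
    M ≤ 6 * n := by
  refine abs_le_of_sq_le_sq' ?_ (by positivity) |>.2
  nlinarith [sq_nonneg n]

/-- The frequency weight on the equilateral region. -/
theorem kerWeight_sq_mul_le_of_equilateral (hs : 9 / 10 < s) {N lam : ℝ} (hN : 1 ≤ N)
    {p p₁ : Freq} (hn : 1 ≤ modulus lam p₁ + modulus lam (p - p₁))
    (h : (p, p₁) ∈ regionEquilateral lam) :
    kerWeight μ N lam p p₁ ^ 2 * inputSize lam p p₁ ^ (1 / 20 : ℝ) ≤
      936 ^ 2 * N ^ (-(1 / 5) : ℝ) * (p.1 0 ^ 2 * inputSize lam p p₁ ^ (-(7 / 4) : ℝ)) := by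
  obtain ⟨h0, h1, h2⟩ := regionEquilateral_bounds hn h
  have hw := multWeight_sq_le' μ hs hN (isTriangle lam p p₁)
    (le_six_mul_of_sq_le (modulus_nonneg _ _) h0) (le_six_mul_of_sq_le (modulus_nonneg _ _) h1)
    (le_six_mul_of_sq_le (modulus_nonneg _ _) h2)
  have hM := one_le_inputSize lam p p₁
  set M := inputSize lam p p₁ with hMdef
  change kerWeight μ N lam p p₁ ^ 2 ≤
    936 ^ 2 * (p.1 0 ^ 2 / M ^ 2 * (M / N) ^ (1 / 5 : ℝ)) at hw
  have hM0 : 0 < M := by linarith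
  have hN0 : 0 < N := by linarith
  refine (mul_le_mul_of_nonneg_right hw (by positivity)).trans (le_of_eq ?_)
  have e : M ^ (-(7 / 4) : ℝ) = (M ^ 2)⁻¹ * M ^ (1 / 5 : ℝ) * M ^ (1 / 20 : ℝ) := by
    rw [← rpow_natCast, ← rpow_neg hM0.le, ← rpow_add hM0, ← rpow_add hM0]
    norm_num
  rw [div_rpow hM0.le hN0.le, rpow_neg hN0.le, e]
  ring

theorem exists_convBound_snd (hs : 9 / 10 < s) {δ₁ δ₂ : ℝ} (h₁ : δ₁ ≤ 1 / 1000) (h₂ : 0 < δ₂)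
    (h₂' : δ₂ ≤ 1 / 1000) :
    ∃ A : ℝ≥0∞, A ≠ ⊤ ∧ ∀ lam N : ℝ, 1 < lam → 1 ≤ N →
      ConvBound (freqMeasure lam)
        (cut (((regionHigh lam)ᶜ ∩ (regionInputs lam)ᶜ) ∩ regionSnd lam) (kern μ N lam δ₁ δ₂))
        (A * ENNReal.ofReal (N ^ (-(1 / 5) : ℝ))) := by
  obtain ⟨A, hA, hfib⟩ := exists_fibre_le_transversal (p := 1 + 2 * δ₂) (by linarith)
  refine ⟨ENNReal.ofReal (180 ^ 2 * 6) * A, by finiteness, fun lam N hlam hN F₁ F₂ hF₁ hF₂ => ?_⟩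
  refine lintegral_sq_conv_le_of_snd _ (measurable_cut (((measurableSet_regionHigh lam).compl.inter
    (measurableSet_regionInputs lam).compl).inter (measurableSet_regionSnd lam))
    (measurable_kern μ N lam δ₁ δ₂)) hF₁ hF₂ fun P => ?_
  have hP := modulus_nonneg lam P
  calc _ ≤ ∫⁻ p', ENNReal.ofReal (180 ^ 2 * 6 * N ^ (-(1 / 5) : ℝ)) *
        (ENNReal.ofReal ((1 + modulus lam P) ^ (1 / 2 : ℝ)) *
        ({r : ℝ | |r| ≤ 6 * (1 + modulus lam P)}.indicator 1 (p'.2 / lam : ℝ) *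
        (transversalSet ((1 + modulus lam P) ^ 2 / 2000) (P.1 0) (P.2 / lam)
          (p'.2 / lam)).indicator 1 (p'.1 0)) * (jap (1 + 2 * δ₂) (modulation lam p') *
          jap (1 + 2 * δ₂) (modulation lam (P - p')))) ∂freqMeasure lam := by
        refine lintegral_mono fun p' => cut_sq_le fun hx => ?_
        obtain ⟨⟨hx1, hx2⟩, hx3⟩ := hx
        rcases le_or_gt (modulus lam P + modulus lam (p' - P)) N with hn | hn
        · rw [kern_eq_zero μ (by linarith) hn]; simp
        obtain ⟨hc1, hc2⟩ := comparable_of_notMem hN hn hx2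
        have hsize := le_inputSize lam p' P
        have hTM := hsize.2.1
        have hmem : p'.1 0 ∈ transversalSet ((1 + modulus lam P) ^ 2 / 2000) (P.1 0) (P.2 / lam)
            (p'.2 / lam) := by
          have hx' : inputSize lam p' P ^ 2 / 2000 ≤
            |modulus lam p' ^ 2 - modulus lam (p' - P) ^ 2| := hx3
          rw [modulus_sub_comm, modulus_sub_sq] at hx'
          refine le_trans ?_ hx'
          gcongr
        have hmem2 : (p'.2 / lam : ℝ) ∈ {r : ℝ | |r| ≤ 6 * (1 + modulus lam P)} := by
          have := abs_snd_le_modulus lam p'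
          rw [Set.mem_ofPred_eq]
          linarith [hsize.1]
        rw [Set.indicator_of_mem hmem, Set.indicator_of_mem hmem2, Pi.one_apply, Pi.one_apply,
          mul_one, mul_one, ← mul_assoc, ← ENNReal.ofReal_mul (by positivity),
          jap_modulation_sub_comm _ _ P]
        exact (kern_sq_le_of_notMem_high μ h₁ h₂ h₂' hx1
          (kerWeight_sq_mul_le μ hs hN hc1 hc2 (by linarith))).2
    _ ≤ _ := by
        rw [lintegral_const_mul' _ _ ENNReal.ofReal_ne_top, ENNReal.ofReal_mul (by norm_num),
          mul_right_comm]
        exact mul_le_mul_left (mul_le_mul_right (hfib lam hlam P) _) _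

theorem exists_convBound_equilateral_nondeg (hs : 9 / 10 < s) {δ₁ δ₂ : ℝ} (h₁ : δ₁ ≤ 1 / 1000)
    (h₂ : 0 < δ₂) :
    ∃ A : ℝ≥0∞, A ≠ ⊤ ∧ ∀ lam N : ℝ, 1 < lam → 1 ≤ N →
      ConvBound (freqMeasure lam)
        (cut (regionEquilateral lam ∩ regionNondeg lam) (kern μ N lam δ₁ δ₂))
        (A * ENNReal.ofReal (N ^ (-(1 / 5) : ℝ))) := by
  obtain ⟨A, hA, hfib⟩ := exists_fibre_le_nondegenerate (p := 1 + 2 * δ₂) (by linarith)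
  refine ⟨ENNReal.ofReal (936 ^ 2) * A, by finiteness, fun lam N hlam hN F₁ F₂ hF₁ hF₂ => ?_⟩
  refine lintegral_sq_conv_le_of_fst _ (measurable_cut ((measurableSet_regionEquilateral lam).inter
    (measurableSet_regionNondeg lam)) (measurable_kern μ N lam δ₁ δ₂)) hF₁ hF₂ fun P => ?_
  have hP := modulus_nonneg lam P
  have hgeom : ∀ p' : Freq, (P, p') ∈ regionEquilateral lam ∩ regionNondeg lam →
      N < modulus lam p' + modulus lam (P - p') →
      inputSize lam P p' ≤ 6 * modulus lam P ∧
      (1 + modulus lam P) ^ 2 / 1000 ≤ |3 * P.1 0 ^ 2 - (P.2 / lam : ℝ) ^ 2| := by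
    rintro p' ⟨hx1, hx2⟩ hn
    obtain ⟨h0, -, -⟩ := regionEquilateral_bounds (by linarith) hx1
    refine ⟨le_six_mul_of_sq_le hP h0, ?_⟩
    have hx' : modulus lam P ^ 2 / 10 ≤ |3 * P.1 0 ^ 2 - (P.2 / lam : ℝ) ^ 2| := hx2
    have : (1 + modulus lam P) ^ 2 ≤ inputSize lam P p' ^ 2 := by
      have := (le_inputSize lam P p').1
      gcongr
    linarith [sq_nonneg (modulus lam P)]
  -- If `P` itself is too close to the degenerate cone, no second frequency contributes and the
  -- fibre integral is zero.
  by_cases hE : (1 + modulus lam P) ^ 2 / 1000 ≤ |3 * P.1 0 ^ 2 - (P.2 / lam : ℝ) ^ 2|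
  swap
  · refine le_trans (lintegral_mono (g := fun _ => 0) fun p' => cut_sq_le fun hx => ?_) (by simp)
    rcases le_or_gt (modulus lam p' + modulus lam (P - p')) N with hn | hn
    · rw [kern_eq_zero μ (by linarith) hn]; simp
    · exact absurd (hgeom p' hx hn).2 hE
  calc _ ≤ ∫⁻ p', ENNReal.ofReal (936 ^ 2 * N ^ (-(1 / 5) : ℝ)) *
        (ENNReal.ofReal (P.1 0 ^ 2 * (1 + modulus lam P) ^ (-(7 / 4) : ℝ)) *
        {r : ℝ | |r| ≤ 6 * (1 + modulus lam P)}.indicator 1 (p'.2 / lam : ℝ) *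
        (jap (1 + 2 * δ₂) (modulation lam p') *
          jap (1 + 2 * δ₂) (modulation lam (P - p')))) ∂freqMeasure lam := by
        refine lintegral_mono fun p' => cut_sq_le fun hx => ?_
        rcases le_or_gt (modulus lam p' + modulus lam (P - p')) N with hn | hn
        · rw [kern_eq_zero μ (by linarith) hn]; simp
        have h6 := (hgeom p' hx hn).1
        have hsize := le_inputSize lam P p'
        have hone := one_le_inputSize lam P p'
        have hmem : (p'.2 / lam : ℝ) ∈ {r : ℝ | |r| ≤ 6 * (1 + modulus lam P)} := by
          have := abs_snd_le_modulus lam p'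
          rw [Set.mem_ofPred_eq]
          linarith [hsize.2.1]
        rw [kern_sq, Set.indicator_of_mem hmem, Pi.one_apply, mul_one,
          ← mul_assoc (ENNReal.ofReal (936 ^ 2 * _)),
          ← ENNReal.ofReal_mul (by positivity)]
        refine mul_le_mul_left (ENNReal.ofReal_le_ofReal ?_) _
        -- No exchange of modulation weights is needed with the output fixed; the factor M^{1/20} ≥
        -- 1 is inserted only to share the weight estimate with the degenerate case.
        calc _ ≤ kerWeight μ N lam P p' ^ 2 * inputSize lam P p' ^ (1 / 20 : ℝ) := by
              gcongr
              calc bracket (modulation lam P) ^ (-1 + 2 * δ₁) ≤ 1 :=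
                    rpow_le_one_of_one_le_of_nonpos (one_le_bracket _) (by linarith)
                _ ≤ _ := one_le_rpow hone (by norm_num)
          _ ≤ _ := kerWeight_sq_mul_le_of_equilateral μ hs hN (by linarith) hx.1
          _ ≤ _ := by
              refine mul_le_mul_of_nonneg_left (mul_le_mul_of_nonneg_left ?_ (by positivity))
                (by positivity)
              exact rpow_le_rpow_of_nonpos (by linarith) hsize.1 (by norm_num)
    _ ≤ _ := by
        rw [lintegral_const_mul' _ _ ENNReal.ofReal_ne_top, ENNReal.ofReal_mul (by norm_num),
          mul_right_comm]
        exact mul_le_mul_left (mul_le_mul_right (hfib lam hlam P hE) _) _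

/-- The output is near the degenerate cone, so the first input is held fixed instead; the triangle
geometry puts it far from the cone. It also gives ξ₀² ≤ 100 ξ₁², which moves the factor ξ² onto the
fixed frequency. Low output modulation is needed to make the modulation weights symmetric. -/
theorem exists_convBound_equilateral_deg (hs : 9 / 10 < s) {δ₁ δ₂ : ℝ} (h₁ : δ₁ ≤ 1 / 1000)
    (h₂ : 0 < δ₂) (h₂' : δ₂ ≤ 1 / 1000) :
    ∃ A : ℝ≥0∞, A ≠ ⊤ ∧ ∀ lam N : ℝ, 1 < lam → 1 ≤ N →
      ConvBound (freqMeasure lam)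
        (cut (((regionHigh lam)ᶜ ∩ regionEquilateral lam) ∩ (regionNondeg lam)ᶜ)
          (kern μ N lam δ₁ δ₂))
        (A * ENNReal.ofReal (N ^ (-(1 / 5) : ℝ))) := by
  obtain ⟨A, hA, hfib⟩ := exists_fibre_le_nondegenerate (p := 1 + 2 * δ₂) (by linarith)
  refine ⟨ENNReal.ofReal (936 ^ 2 * 100) * A, by finiteness,
    fun lam N hlam hN F₁ F₂ hF₁ hF₂ => ?_⟩
  refine lintegral_sq_conv_le_of_snd _ (measurable_cut (((measurableSet_regionHigh lam).compl.inter
    (measurableSet_regionEquilateral lam)).inter (measurableSet_regionNondeg lam).compl)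
    (measurable_kern μ N lam δ₁ δ₂)) hF₁ hF₂ fun P => ?_
  have hP := modulus_nonneg lam P
  have hgeom : ∀ p' : Freq,
      (p', P) ∈ ((regionHigh lam)ᶜ ∩ regionEquilateral lam) ∩ (regionNondeg lam)ᶜ →
      N < modulus lam P + modulus lam (p' - P) →
      (inputSize lam p' P ≤ 6 * modulus lam P ∧ p'.1 0 ^ 2 ≤ 100 * P.1 0 ^ 2) ∧
      (1 + modulus lam P) ^ 2 / 1000 ≤ |3 * P.1 0 ^ 2 - (P.2 / lam : ℝ) ^ 2| := by
    rintro p' ⟨⟨-, hx1⟩, hx2⟩ hn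
    obtain ⟨h0, h1, -⟩ := regionEquilateral_bounds (by linarith) hx1
    have hx' : |3 * p'.1 0 ^ 2 - (p'.2 / lam : ℝ) ^ 2| < modulus lam p' ^ 2 / 10 := not_le.1 hx2
    have hx3 : |modulus lam p' ^ 2 - modulus lam P ^ 2| < inputSize lam p' P ^ 2 / 2000 :=
      not_le.1 hx1.1.2
    have hx4 : |modulus lam p' ^ 2 - modulus lam (p' - P) ^ 2| < inputSize lam p' P ^ 2 / 2000 :=
      not_le.1 hx1.2
    have hone := one_le_inputSize lam p' P
    have hpos : 0 < modulus lam p' ^ 2 := by nlinarith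
    rw [abs_sub_comm] at hx3 hx4
    have hT : (1 + modulus lam P) ^ 2 ≤ inputSize lam p' P ^ 2 := by
      have := (le_inputSize lam p' P).2.1
      gcongr
    rw [modulus_sub_sq, absZ_sq] at hx4
    rw [modulus_sq lam p'] at h0 hx' hx3 hx4 hpos
    rw [modulus_sq lam P] at hx3
    obtain ⟨ha, hb⟩ := nondegenerate_of_equilateral (x₁ := P.1 0)
      (q₁ := (P.2 / lam : ℝ)) (by linarith) (by linarith) hx'.le hpos
    exact ⟨⟨le_six_mul_of_sq_le hP h1, by linarith [sq_nonneg (p'.2 / lam : ℝ)]⟩, by linarith⟩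
  by_cases hE : (1 + modulus lam P) ^ 2 / 1000 ≤ |3 * P.1 0 ^ 2 - (P.2 / lam : ℝ) ^ 2|
  swap
  · refine le_trans (lintegral_mono (g := fun _ => 0) fun p' => cut_sq_le fun hx => ?_) (by simp)
    rcases le_or_gt (modulus lam P + modulus lam (p' - P)) N with hn | hn
    · rw [kern_eq_zero μ (by linarith) hn]; simp
    · exact absurd (hgeom p' hx hn).2 hE
  calc _ ≤ ∫⁻ p', ENNReal.ofReal (936 ^ 2 * 100 * N ^ (-(1 / 5) : ℝ)) *
        (ENNReal.ofReal (P.1 0 ^ 2 * (1 + modulus lam P) ^ (-(7 / 4) : ℝ)) *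
        {r : ℝ | |r| ≤ 6 * (1 + modulus lam P)}.indicator 1 (p'.2 / lam : ℝ) *
        (jap (1 + 2 * δ₂) (modulation lam p') *
          jap (1 + 2 * δ₂) (modulation lam (P - p')))) ∂freqMeasure lam := by
        refine lintegral_mono fun p' => cut_sq_le fun hx => ?_
        rcases le_or_gt (modulus lam P + modulus lam (p' - P)) N with hn | hn
        · rw [kern_eq_zero μ (by linarith) hn]; simp
        obtain ⟨h6, h100⟩ := (hgeom p' hx hn).1
        have hsize := le_inputSize lam p' P
        have hone := one_le_inputSize lam p' P
        have hmem : (p'.2 / lam : ℝ) ∈ {r : ℝ | |r| ≤ 6 * (1 + modulus lam P)} := by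
          have := abs_snd_le_modulus lam p'
          rw [Set.mem_ofPred_eq]
          linarith [hsize.1]
        rw [Set.indicator_of_mem hmem, Pi.one_apply, mul_one, ← mul_assoc,
          ← ENNReal.ofReal_mul (by positivity), jap_modulation_sub_comm _ _ P]
        refine (kern_sq_le_of_notMem_high μ h₁ h₂ h₂' hx.1.1
          ((kerWeight_sq_mul_le_of_equilateral μ hs hN (by linarith) hx.1.2).trans ?_)).2
        rw [mul_right_comm _ (100 : ℝ), mul_assoc _ (100 : ℝ), ← mul_assoc (100 : ℝ)]
        refine mul_le_mul_of_nonneg_left ?_ (by positivity)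
        exact mul_le_mul h100 (rpow_le_rpow_of_nonpos (by linarith) hsize.2.1 (by norm_num))
          (by positivity) (by positivity)
    _ ≤ _ := by
        rw [lintegral_const_mul' _ _ ENNReal.ofReal_ne_top, ENNReal.ofReal_mul (by norm_num),
          mul_right_comm]
        exact mul_le_mul_left (mul_le_mul_right (hfib lam hlam P hE) _) _

theorem cut_of_mem {S : Set (Freq × Freq)} {K : Freq → Freq → ℝ≥0∞} {p p₁ : Freq}
    (h : (p, p₁) ∈ S) : cut S K p p₁ = K p p₁ := Set.indicator_of_mem h _

/-- The bilinear estimate. -/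
theorem exists_convBound_kern (hs : 9 / 10 < s) {δ₁ δ₂ : ℝ} (h₁ : δ₁ ≤ 1 / 1000) (h₂ : 0 < δ₂)
    (h₂' : δ₂ ≤ 1 / 1000) :
    ∃ A : ℝ≥0∞, A ≠ ⊤ ∧ ∀ lam N : ℝ, 1 < lam → 1 ≤ N →
      ConvBound (freqMeasure lam) (kern μ N lam δ₁ δ₂)
        (A * ENNReal.ofReal (N ^ (-(1 / 5) : ℝ))) := by
  obtain ⟨A₁, hA₁, H₁⟩ := exists_convBound_high μ hs h₁ h₂
  obtain ⟨A₂, hA₂, H₂⟩ := exists_convBound_inputs μ hs h₁ h₂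
  obtain ⟨A₃, hA₃, H₃⟩ := exists_convBound_fst μ hs h₁ h₂ h₂'
  obtain ⟨A₄, hA₄, H₄⟩ := exists_convBound_snd μ hs h₁ h₂ h₂'
  obtain ⟨A₅, hA₅, H₅⟩ := exists_convBound_equilateral_nondeg μ hs h₁ h₂
  obtain ⟨A₆, hA₆, H₆⟩ := exists_convBound_equilateral_deg μ hs h₁ h₂ h₂'
  refine ⟨2 * (A₁ + 2 * (A₂ + 2 * (A₃ + 2 * (A₄ + 2 * (A₅ + A₆))))), by finiteness,
    fun lam N hlam hN => ?_⟩
  have mH := measurableSet_regionHigh lam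
  have mI := measurableSet_regionInputs lam
  have mF := measurableSet_regionFst lam
  have mS := measurableSet_regionSnd lam
  have mE := measurableSet_regionEquilateral lam
  have mN := measurableSet_regionNondeg lam
  have mk := measurable_kern μ N lam δ₁ δ₂
  have h5 := (H₅ lam N hlam hN).add (H₆ lam N hlam hN) (measurable_cut (mE.inter mN) mk)
  have h4 := (H₄ lam N hlam hN).add h5 (measurable_cut ((mH.compl.inter mI.compl).inter mS) mk)
  have h3 := (H₃ lam N hlam hN).add h4 (measurable_cut ((mH.compl.inter mI.compl).inter mF) mk)
  have h2 := (H₂ lam N hlam hN).add h3 (measurable_cut mI mk)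
  have h1 := (H₁ lam N hlam hN).add h2 (measurable_cut mH mk)
  -- The six pieces cover everything: what is neither of high modulation nor transversal in any pair
  -- is equilateral, with nondegenerate or degenerate output.
  refine h1.mono (fun p p₁ => ?_) (le_of_eq (by ring))
  by_cases cH : (p, p₁) ∈ regionHigh lam
  · exact (cut_of_mem cH).symm.le.trans le_self_add
  refine le_add_left ?_
  by_cases cI : (p, p₁) ∈ regionInputs lam
  · exact (cut_of_mem cI).symm.le.trans le_self_add
  refine le_add_left ?_
  by_cases cF : (p, p₁) ∈ regionFst lam
  · exact (cut_of_mem (S := ((regionHigh lam)ᶜ ∩ (regionInputs lam)ᶜ) ∩ regionFst lam)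
      ⟨⟨cH, cI⟩, cF⟩).symm.le.trans le_self_add
  refine le_add_left ?_
  by_cases cS : (p, p₁) ∈ regionSnd lam
  · exact (cut_of_mem (S := ((regionHigh lam)ᶜ ∩ (regionInputs lam)ᶜ) ∩ regionSnd lam)
      ⟨⟨cH, cI⟩, cS⟩).symm.le.trans le_self_add
  refine le_add_left ?_
  have cE : (p, p₁) ∈ regionEquilateral lam := ⟨⟨cI, cF⟩, cS⟩
  by_cases cN : (p, p₁) ∈ regionNondeg lam
  · exact (cut_of_mem (S := regionEquilateral lam ∩ regionNondeg lam)
      ⟨cE, cN⟩).symm.le.trans le_self_add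
  · exact le_add_left (cut_of_mem
      (S := ((regionHigh lam)ᶜ ∩ regionEquilateral lam) ∩ (regionNondeg lam)ᶜ)
      ⟨⟨cH, cE⟩, cN⟩).symm.le

end Regions

/-! ### The Fourier transform of a product of square integrable functions on the plane -/

/-- The integral is the inner product with the conjugate of `h`. Its continuity makes the identity
below closed under L² limits. -/
theorem continuous_integral_mul {h : Plane → ℂ} (hh : MemLp h 2 volume) :
    Continuous fun g : L2Plane => ∫ z, h z * g z := by
  have hc : MemLp (fun z => (starRingEnd ℂ) (h z)) 2 (volume : Measure Plane) := hh.star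
  have heq : (fun g : L2Plane => ∫ z, h z * g z) = fun g => inner ℂ (hc.toLp) g := by
    funext g
    rw [L2.inner_def]
    refine integral_congr_ae ?_
    filter_upwards [hc.coeFn_toLp] with z hz
    rw [hz, RCLike.inner_apply, RingHomCompTriple.comp_apply, RingHom.id_apply, mul_comm]
  rw [heq]
  fun_prop

theorem memLp_sub_left (f : L2Plane) (η : Plane) : MemLp (fun η₁ => f (η - η₁)) 2 volume :=
  (Lp.memLp f).comp_measurePreserving (Measure.measurePreserving_sub_left volume η)

theorem memLp_fourierChar_mul (f : L2Plane) (η : Plane) :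
    MemLp (fun z => (Real.fourierChar (-inner ℝ z η) : ℂ) * f z) 2 volume := by
  refine (Lp.memLp f).of_le (AEStronglyMeasurable.mul ?_ (Lp.memLp f).1)
    (Filter.Eventually.of_forall fun z => by
      rw [norm_mul, Circle.norm_coe, one_mul])
  have : Continuous fun z : Plane => (Real.fourierChar (-inner ℝ z η) : ℂ) := by fun_prop
  exact this.aestronglyMeasurable

-- The convolution theorem is applied to the inverse transforms and evaluated at -η, where an
-- inverse transform becomes a forward one; a reflection and a translation then give the stated
-- form.
open SchwartzMap in
theorem SchwartzMap_fourier_mul (f g : SchwartzMap Plane ℂ) (η : Plane) :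
    ∫ z, (Real.fourierChar (-inner ℝ z η) : ℂ) * f z * g z =
      ∫ η₁, (𝓕 f) (η - η₁) * (𝓕 g) η₁ := by
  have h1 := convolution_apply (ContinuousLinearMap.mul ℂ ℂ) (𝓕⁻ f) (𝓕⁻ g) (-η)
  have h2 : SchwartzMap.convolution (ContinuousLinearMap.mul ℂ ℂ) (𝓕⁻ f) (𝓕⁻ g) =
      𝓕⁻ (pairing (ContinuousLinearMap.mul ℂ ℂ) f g) := by
    change 𝓕⁻ (pairing (ContinuousLinearMap.mul ℂ ℂ) (𝓕 (𝓕⁻ f)) (𝓕 (𝓕⁻ g))) = _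
    simp
  have h3 : ∀ (φ : SchwartzMap Plane ℂ) (x : Plane), (𝓕⁻ φ) x = (𝓕 φ) (-x) := fun φ x => by
    rw [fourierInv_coe, fourier_coe, Real.fourierInv_eq_fourier_neg]
  rw [h2, h3, neg_neg, MeasureTheory.convolution_def, fourier_coe, Real.fourier_eq] at h1
  refine Eq.trans ?_ (h1.trans ?_)
  · refine integral_congr_ae (Filter.Eventually.of_forall fun z => ?_)
    simp [pairing_apply_apply, Circle.smul_def, mul_assoc]
  · rw [← integral_neg_eq_self, ← integral_sub_left_eq_self _ _ η]
    refine integral_congr_ae (Filter.Eventually.of_forall fun z => ?_)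
    simp only [ContinuousLinearMap.mul_apply', h3]
    simp

theorem fourier_mul_eq (f g : L2Plane) (η : Plane) :
    ∫ z, (Real.fourierChar (-inner ℝ z η) : ℂ) * f z * g z =
      ∫ η₁, (𝓕 f : L2Plane) (η - η₁) * (𝓕 g : L2Plane) η₁ := by
  have hF : Continuous fun h : L2Plane => (𝓕 h : L2Plane) :=
    (Lp.fourierTransformₗᵢ Plane ℂ).continuous
  have hcongr : ∀ φ : SchwartzMap Plane ℂ,
      ((𝓕 (φ.toLp 2 volume) : L2Plane) : Plane → ℂ) =ᵐ[volume] (𝓕 φ : SchwartzMap Plane ℂ) := fun φ => by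
    rw [SchwartzMap.toLp_fourier_eq]; exact (𝓕 φ).coeFn_toLp 2 volume
  have hdense := SchwartzMap.denseRange_toLpCLM (E := Plane) (F := ℂ) (μ := volume)
    (p := 2) ENNReal.ofNat_ne_top
  have hfix : ∀ (φ : SchwartzMap Plane ℂ) (g : L2Plane),
      ∫ z, (Real.fourierChar (-inner ℝ z η) : ℂ) * (φ.toLp 2 volume : L2Plane) z * g z =
      ∫ η₁, (𝓕 (φ.toLp 2 volume) : L2Plane) (η - η₁) * (𝓕 g : L2Plane) η₁ := by
    intro φ g
    refine hdense.induction_on g (isClosed_eq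
      (continuous_integral_mul (memLp_fourierChar_mul (φ.toLp 2 volume) η))
      ((continuous_integral_mul (memLp_sub_left (𝓕 (φ.toLp 2 volume)) η)).comp hF))
      fun ψ => ?_
    change ∫ z, (Real.fourierChar (-inner ℝ z η) : ℂ) * (φ.toLp 2 volume : L2Plane) z *
      (ψ.toLp 2 volume : L2Plane) z = ∫ η₁, (𝓕 (φ.toLp 2 volume) : L2Plane) (η - η₁) *
        (𝓕 (ψ.toLp 2 volume) : L2Plane) η₁
    refine Eq.trans ?_ ((SchwartzMap_fourier_mul φ ψ η).trans ?_)
    · refine integral_congr_ae ?_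
      filter_upwards [φ.coeFn_toLp 2 volume, ψ.coeFn_toLp 2 volume] with z h1 h2
      rw [h1, h2]
    · refine integral_congr_ae ?_
      filter_upwards [(Measure.measurePreserving_sub_left volume η).quasiMeasurePreserving.ae_eq_comp
        (hcongr φ), hcongr ψ] with z h1 h2
      rw [h2]
      exact congrArg (· * _) h1.symm
  -- Density was used for `g` with `f` Schwartz. To let `f` vary, both sides are rewritten with the
  -- two factors exchanged, so that continuity in the last factor applies again.
  refine hdense.induction_on f ?_ fun φ => hfix φ g
  have e1 : ∀ f : L2Plane, ∫ z, (Real.fourierChar (-inner ℝ z η) : ℂ) * f z * g z =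
      ∫ z, (Real.fourierChar (-inner ℝ z η) : ℂ) * g z * f z := fun f => by
    simp only [mul_right_comm]
  have e2 : ∀ f : L2Plane, ∫ η₁, (𝓕 f : L2Plane) (η - η₁) * (𝓕 g : L2Plane) η₁ =
      ∫ η₁, (𝓕 g : L2Plane) (η - η₁) * (𝓕 f : L2Plane) η₁ := fun f => by
    rw [← integral_sub_left_eq_self _ _ η]
    simp only [sub_sub_cancel, mul_comm]
  simp only [e1, e2]
  exact isClosed_eq (continuous_integral_mul (memLp_fourierChar_mul g η))
    ((continuous_integral_mul (memLp_sub_left (𝓕 g) η)).comp hF)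

/-! ### The Fourier coefficients of a product -/

theorem integral_volume_eq_haar {T : ℝ} [hT : Fact (0 < T)] (f : AddCircle T → ℂ) :
    ∫ y, f y = (T : ℂ) * ∫ y, f y ∂AddCircle.haarAddCircle := by
  rw [AddCircle.volume_eq_smul_haarAddCircle, integral_smul_measure,
    ENNReal.toReal_ofReal hT.out.le, Complex.real_smul]

theorem memLp_haar {T : ℝ} [hT : Fact (0 < T)] {f : AddCircle T → ℂ} (hf : MemLp f 2 volume) :
    MemLp f 2 AddCircle.haarAddCircle := by
  refine hf.of_measure_le_smul (c := (ENNReal.ofReal T)⁻¹) (by simpa using hT.out) ?_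
  rw [AddCircle.volume_eq_smul_haarAddCircle, smul_smul, ENNReal.inv_mul_cancel
    (by simpa using hT.out) ENNReal.ofReal_ne_top, one_smul]

/-- The convolution formula for the Fourier coefficients of a product. -/
theorem hasSum_fourierCoeff_mul {T : ℝ} [hT : Fact (0 < T)] {a b : AddCircle T → ℂ}
    (ha : MemLp a 2 volume) (hb : MemLp b 2 volume) (k : ℤ) :
    HasSum (fun j : ℤ => (∫ y, (fourier (-j) y : ℂ) * a y) * ∫ y, (fourier (-(k - j)) y : ℂ) * b y)
      (T * ∫ y, (fourier (-k) y : ℂ) * (a y * b y)) := by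
  have ha' := memLp_haar ha
  have hc : MemLp (fun y => (starRingEnd ℂ) ((fourier (-k) y : ℂ) * b y)) 2
      (AddCircle.haarAddCircle (T := T)) := by
    have : MemLp (fun y => (fourier (-k) y : ℂ) * b y) 2 (AddCircle.haarAddCircle (T := T)) := by
      refine (memLp_haar hb).of_le (((map_continuous (fourier (-k))).aestronglyMeasurable).mul
        (memLp_haar hb).1) (Filter.Eventually.of_forall fun y => ?_)
      rw [norm_mul, norm_fourier_apply, one_mul]
    exact this.star
  -- Parseval for `a` against the conjugate of e_{-k} b: the exponential shifts the coefficients of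
  -- `b` and produces the convolution. The factor T² restores Lebesgue measure from Haar probability
  -- measure in both coefficients.
  have h := (fourierBasis (T := T)).hasSum_inner_mul_inner hc.toLp ha'.toLp
  have h1 : ∀ j, inner ℂ (fourierBasis (T := T) j) ha'.toLp =
      ∫ y, (fourier (-j) y : ℂ) * a y ∂AddCircle.haarAddCircle := fun j => by
    rw [← HilbertBasis.repr_apply_apply, fourierBasis_repr, fourierCoeff]
    refine integral_congr_ae ?_
    filter_upwards [ha'.coeFn_toLp] with y hy
    rw [hy, smul_eq_mul]
  have h2 : ∀ j, inner ℂ hc.toLp (fourierBasis (T := T) j) =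
      ∫ y, (fourier (-(k - j)) y : ℂ) * b y ∂AddCircle.haarAddCircle := fun j => by
    rw [L2.inner_def, coe_fourierBasis]
    refine integral_congr_ae ?_
    filter_upwards [hc.coeFn_toLp, coeFn_fourierLp 2 j] with y hy hj
    rw [hy, hj, RCLike.inner_apply, Complex.conj_conj, neg_sub, sub_eq_add_neg, fourier_add]
    ring
  have h3 : inner ℂ hc.toLp ha'.toLp =
      ∫ y, (fourier (-k) y : ℂ) * (a y * b y) ∂AddCircle.haarAddCircle := by
    rw [L2.inner_def]
    refine integral_congr_ae ?_
    filter_upwards [hc.coeFn_toLp, ha'.coeFn_toLp] with y hy hj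
    rw [hy, hj, RCLike.inner_apply, Complex.conj_conj]
    ring
  rw [h3] at h
  simp only [h1, h2] at h
  simp only [integral_volume_eq_haar]
  refine (congrArg₂ (HasSum · ·) (funext fun j => ?_) ?_).mp (h.mul_left ((T : ℂ) * T))
  · ring
  · ring

theorem integral_norm_sq_eq (f : L2Plane) : ∫ z, ‖f z‖ ^ 2 = ‖f‖ ^ 2 := by
  have h := congr_arg RCLike.re (L2.inner_def (𝕜 := ℂ) f f)
  rw [← integral_re (L2.integrable_inner f f)] at h
  simpa only [← norm_sq_eq_re_inner] using h.symm

theorem integrable_mul_L2 (f g : L2Plane) : Integrable fun z => f z * g z :=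
  (Lp.memLp f).integrable_mul (Lp.memLp g)

theorem integral_norm_mul_le (f g : L2Plane) :
    ∫ z, ‖f z * g z‖ ≤ (‖f‖ ^ 2 + ‖g‖ ^ 2) / 2 := by
  have hf : Integrable fun z => ‖f z‖ ^ 2 := (Lp.memLp f).integrable_norm_pow (by norm_num)
  have hg : Integrable fun z => ‖g z‖ ^ 2 := (Lp.memLp g).integrable_norm_pow (by norm_num)
  rw [← integral_norm_sq_eq, ← integral_norm_sq_eq, ← integral_add hf hg, ← integral_div]
  refine integral_mono (integrable_mul_L2 f g).norm ((hf.add hg).div_const 2) fun z => ?_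
  simp only [norm_mul]
  nlinarith [sq_nonneg (‖f z‖ - ‖g z‖)]

section Mode

variable {lam : ℝ} [hlam : Fact (0 < lam)]

theorem mode_coeFn (u : L2 lam) (k : ℤ) : mode lam u k =ᵐ[volume] modeFun lam u k :=
  (memLp_modeFun lam (Lp.memLp u) k).coeFn_toLp

theorem ae_memLp_fibre (u : L2 lam) :
    ∀ᵐ z : Plane, MemLp (fun y : Torus lam => u (z, y)) 2 volume := by
  have hm : AEStronglyMeasurable (u : SpaceTime lam → ℂ)
    ((volume : Measure Plane).prod (volume : Measure (Torus lam))) := (Lp.memLp u).1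
  have hi : Integrable (fun p : SpaceTime lam => ‖u p‖ ^ 2)
      ((volume : Measure Plane).prod (volume : Measure (Torus lam))) :=
    (Lp.memLp u).integrable_norm_pow (by norm_num)
  filter_upwards [hm.prodMk_left, hi.prod_right_ae] with z h1 h2
  exact (memLp_two_iff_integrable_sq_norm h1).2 h2

/-- The Fourier transform of a product of two functions on `ℝ × 𝕋_λ × ℝ`. -/
theorem hasSum_fourierInt_mul (u v : L2 lam) (w : Plane) (k : ℤ) :
    HasSum (fun j : ℤ => ((2 * π * lam : ℝ) : ℂ)⁻¹ *
      ∫ z, (Complex.exp (-Complex.I * ((z 0 * w 0 + z 1 * w 1 : ℝ) : ℂ))) *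
        mode lam u j z * mode lam v (k - j) z)
      (fourierInt lam (fun p => u p * v p) w k) := by
  have hT : (0 : ℝ) < 2 * π * lam := (torusPeriodPos lam).out
  have hT' : ((2 * π * lam : ℝ) : ℂ) ≠ 0 := by exact_mod_cast hT.ne'
  set e : Plane → ℂ := fun z => Complex.exp (-Complex.I * ((z 0 * w 0 + z 1 * w 1 : ℝ) : ℂ))
    with he
  have hec : Continuous e := by rw [he]; fun_prop
  have hen : ∀ z, ‖e z‖ = 1 := fun z => by
    rw [he]
    simp only []
    rw [Complex.norm_exp]
    simp
  have hint : ∀ j, Integrable fun z => e z * mode lam u j z * mode lam v (k - j) z := fun j => by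
    refine ((integrable_mul_L2 (mode lam u j) (mode lam v (k - j))).bdd_mul
      (c := 1) hec.aestronglyMeasurable (Filter.Eventually.of_forall fun z => (hen z).le)).congr
      (Filter.Eventually.of_forall fun z => ?_)
    simp only [mul_assoc]
  have hsum : Summable fun j => ∫ z, ‖e z * mode lam u j z * mode lam v (k - j) z‖ := by
    refine Summable.of_nonneg_of_le (fun j => by positivity) (fun j => ?_)
      (((summable_norm_sq_mode lam u).add ((summable_norm_sq_mode lam v).comp_injective
        (sub_right_injective (b := k)))).div_const 2)
    refine le_of_eq_of_le ?_ (integral_norm_mul_le _ _)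
    simp only [norm_mul, hen, one_mul]
  have h := (hasSum_integral_of_summable_integral_norm hint hsum).mul_left
    ((2 * π * lam : ℝ) : ℂ)⁻¹
  refine (congrArg (HasSum _ ·) ?_).mpr h
  rw [← integral_const_mul, fourierInt]
  have huv : Integrable (fun p : SpaceTime lam => e p.1 * (fourier (-k) p.2 : ℂ) * (u p * v p))
      ((volume : Measure Plane).prod (volume : Measure (Torus lam))) := by
    have : Integrable (fun p : SpaceTime lam => u p * v p) volume :=
      (Lp.memLp u).integrable_mul (Lp.memLp v)
    refine this.bdd_mul (c := 1) ?_ (Filter.Eventually.of_forall fun p => ?_)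
    · exact ((hec.comp continuous_fst).mul
        ((map_continuous (fourier (-k))).comp continuous_snd)).aestronglyMeasurable
    · rw [norm_mul, hen, norm_fourier_apply, one_mul]
  refine (integral_prod _ huv).trans (integral_congr_ae ?_)
  filter_upwards [ae_memLp_fibre u, ae_memLp_fibre v, ae_all_iff.2 (mode_coeFn u),
    ae_all_iff.2 (mode_coeFn v)] with z hu hv hmu hmv
  have hp := (hasSum_fourierCoeff_mul hu hv k).tsum_eq
  simp only [mul_assoc (e z)]
  rw [integral_const_mul, tsum_mul_left]
  have hq : ∑' j : ℤ, mode lam u j z * mode lam v (k - j) z =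
      (2 * π * lam : ℝ) * ∫ y, (fourier (-k) y : ℂ) * (u (z, y) * v (z, y)) := by
    rw [← hp]
    exact tsum_congr fun j => by rw [hmu, hmv, modeFun, modeFun]
  rw [hq]
  field_simp

end Mode

/-! ### Products as convolutions in frequency space. -/

section Transform

variable {lam : ℝ} [hlam : Fact (0 < lam)]

theorem measurable_fourierL2 (u : L2 lam) : Measurable fun p : Freq => fourierL2 lam u p.1 p.2 := by
  refine measurable_from_prod_countable_left fun k => ?_
  exact (Lp.stronglyMeasurable (𝓕 (mode lam u k) : L2Plane)).measurable.comp
    (measurable_const_smul _)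

theorem fourierL2_sub (v : L2 lam) (w w₁ : Plane) (k : ℤ) :
    fourierL2 lam v (w - w₁) k =
      (𝓕 (mode lam v k) : L2Plane) ((2 * π)⁻¹ • w - (2 * π)⁻¹ • w₁) := by
  rw [fourierL2, smul_sub]

theorem integrable_fourierL2_mul (u v : L2 lam) (w : Plane) (j k : ℤ) :
    Integrable fun w₁ => fourierL2 lam u w₁ j * fourierL2 lam v (w - w₁) k := by
  have h : Integrable fun η₁ => (𝓕 (mode lam u j) : L2Plane) η₁ *
      (𝓕 (mode lam v k) : L2Plane) ((2 * π)⁻¹ • w - η₁) :=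
    (Lp.memLp _).integrable_mul (memLp_sub_left _ _)
  refine (h.comp_smul (R := (2 * π)⁻¹) (by positivity)).congr
    (Filter.Eventually.of_forall fun w₁ => ?_)
  simp only [fourierL2_sub]
  rfl

theorem integral_exp_mode_mul (u v : L2 lam) (w : Plane) (j k : ℤ) :
    ∫ z, (Complex.exp (-Complex.I * ((z 0 * w 0 + z 1 * w 1 : ℝ) : ℂ))) *
        mode lam u j z * mode lam v k z =
      (((2 * π) ^ 2 : ℝ) : ℂ)⁻¹ * ∫ w₁, fourierL2 lam u w₁ j * fourierL2 lam v (w - w₁) k := by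
  have h := fourier_mul_eq (mode lam u j) (mode lam v k) ((2 * π)⁻¹ • w)
  have h' := integral_sub_left_eq_self (fun η₁ => (𝓕 (mode lam u j) : L2Plane) η₁ *
    (𝓕 (mode lam v k) : L2Plane) ((2 * π)⁻¹ • w - η₁)) volume ((2 * π)⁻¹ • w)
  simp only [sub_sub_cancel] at h'
  rw [h'] at h
  have h2 := Measure.integral_comp_smul (volume : Measure Plane) (fun η₁ =>
    (𝓕 (mode lam u j) : L2Plane) η₁ * (𝓕 (mode lam v k) : L2Plane) ((2 * π)⁻¹ • w - η₁))
    (2 * π)⁻¹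
  have h3 : ∫ w₁, fourierL2 lam u w₁ j * fourierL2 lam v (w - w₁) k =
      (((2 * π) ^ 2 : ℝ) : ℂ) * ∫ η₁,
        (𝓕 (mode lam u j) : L2Plane) η₁ * (𝓕 (mode lam v k) : L2Plane) ((2 * π)⁻¹ • w - η₁) := by
    simp only [fourierL2_sub]
    refine h2.trans ?_
    rw [finrank_euclideanSpace_fin, inv_pow, inv_inv, abs_of_pos (by positivity),
      Complex.real_smul]
  rw [h3, inv_mul_cancel_left₀ (by exact_mod_cast (by positivity : ((2 * π) ^ 2 : ℝ) ≠ 0)), ← h]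
  refine integral_congr_ae (Filter.Eventually.of_forall fun z => ?_)
  simp only []
  congr 2
  rw [Real.fourierChar_apply]
  congr 1
  have : inner ℝ z ((2 * π)⁻¹ • w) = (2 * π)⁻¹ * (z 0 * w 0 + z 1 * w 1) := by
    rw [inner_smul_right, PiLp.inner_apply, Fin.sum_univ_two]
    simp [mul_comm]
  rw [this]
  push_cast
  have hpi : (π : ℂ) ≠ 0 := by exact_mod_cast pi_ne_zero
  field_simp

/-- The constant collects 2πλ from the torus and (2π)² from rescaling the plane transform to angular
frequency. -/
theorem hasSum_fourierInt_mul' (u v : L2 lam) (w : Plane) (k : ℤ) :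
    HasSum (fun j : ℤ => (((2 * π) ^ 3 * lam : ℝ) : ℂ)⁻¹ *
      ∫ w₁, fourierL2 lam u w₁ j * fourierL2 lam v (w - w₁) (k - j))
      (fourierInt lam (fun p => u p * v p) w k) := by
  refine (congrArg (HasSum · _) (funext fun j => ?_)).mp (hasSum_fourierInt_mul u v w k)
  rw [integral_exp_mode_mul, ← mul_assoc, ← mul_inv, ← Complex.ofReal_mul]
  congr 3
  ring

end Transform

/-! ### From the commutator to the kernel. -/

section Commutator

variable {lam : ℝ} [hlam : Fact (0 < lam)] {s : ℝ} (μ : Profile s) (N : ℝ)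

theorem symb_pos (ξ q : ℝ) : 0 < symb μ N ξ q := μ.toFun_pos _

/-- The commutator symbol at a pair of frequencies. -/
def pairSymb (lam : ℝ) (p p₁ : Freq) : ℝ :=
  commSymb μ N (modulus lam p) (modulus lam p₁) (modulus lam (p - p₁))

theorem pairSymb_nonneg (lam : ℝ) (p p₁ : Freq) : 0 ≤ pairSymb μ N lam p p₁ :=
  commSymb_nonneg μ N _ _ _

theorem measurable_pairSymb (lam : ℝ) (p : Freq) : Measurable (pairSymb μ N lam p) := by
  have hμ : Measurable μ.toFun := μ.smooth.continuous.measurable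
  unfold pairSymb commSymb
  fun_prop

/-- The transforms of u and v are those of Iu and Iv divided by the positive symbol, so m₁m₂ - m₀
acting on u, v becomes the relative commutator acting on Iu, Iv. Both relations hold only almost
everywhere, the second after reflecting the plane variable. -/
theorem enorm_integral_commutator_le (u v : L2 lam) (w : Plane) (j k : ℤ) :
    ‖(∫ w₁, fourierL2 lam (opI μ N lam u) w₁ j * fourierL2 lam (opI μ N lam v) (w - w₁) (k - j)) -
      (symb μ N (w 0) (k / lam) : ℂ) *
        ∫ w₁, fourierL2 lam u w₁ j * fourierL2 lam v (w - w₁) (k - j)‖ₑ ≤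
    ∫⁻ w₁, ENNReal.ofReal (pairSymb μ N lam (w, k) (w₁, j)) *
      (‖fourierL2 lam (opI μ N lam u) w₁ j‖ₑ *
        ‖fourierL2 lam (opI μ N lam v) (w - w₁) (k - j)‖ₑ) := by
  rw [← integral_const_mul, ← integral_sub (integrable_fourierL2_mul _ _ _ _ _)
    ((integrable_fourierL2_mul _ _ _ _ _).const_mul _)]
  refine (enorm_integral_le_lintegral_enorm _).trans (lintegral_mono_ae ?_)
  filter_upwards [fourierL2_opI μ N lam u j,
    (Measure.measurePreserving_sub_left volume w).quasiMeasurePreserving.ae_eq_comp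
      (fourierL2_opI μ N lam v (k - j))] with w₁ h1 h2
  simp only [Function.comp_apply] at h2
  have hm₁ := symb_pos μ N (w₁ 0) (j / lam)
  have hm₂ := symb_pos μ N ((w - w₁) 0) ((k - j : ℤ) / lam)
  have hsymb : pairSymb μ N lam (w, k) (w₁, j) =
      |symb μ N (w₁ 0) (j / lam) * symb μ N ((w - w₁) 0) ((k - j : ℤ) / lam) -
        symb μ N (w 0) (k / lam)| /
        (symb μ N (w₁ 0) (j / lam) * symb μ N ((w - w₁) 0) ((k - j : ℤ) / lam)) := rfl
  rw [h1, h2, hsymb]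
  set m₁ := symb μ N (w₁ 0) (j / lam)
  set m₂ := symb μ N ((w - w₁) 0) ((k - j : ℤ) / lam)
  set m₀ := symb μ N (w 0) (k / lam)
  set a := fourierL2 lam u w₁ j
  set b := fourierL2 lam v (w - w₁) (k - j)
  refine le_of_eq ?_
  rw [← enorm_mul, ← Real.enorm_of_nonneg (by positivity), ← ofReal_norm, ← ofReal_norm,
    ← ofReal_norm, ← ENNReal.ofReal_mul (norm_nonneg _)]
  congr 1
  have e1 : (m₁ : ℂ) * a * (m₂ * b) - m₀ * (a * b) = ((m₁ * m₂ - m₀ : ℝ) : ℂ) * (a * b) := by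
    push_cast; ring
  rw [e1]
  simp only [norm_mul, Complex.norm_real, norm_div, norm_of_nonneg hm₁.le, norm_of_nonneg hm₂.le,
    Real.norm_eq_abs, abs_abs]
  field_simp

theorem enorm_commutatorHat_le (u v : L2 lam) (w : Plane) (k : ℤ) :
    ‖commutatorHat μ N lam u v w k‖ₑ ≤ ∫⁻ p₁, ENNReal.ofReal (|w 0| * pairSymb μ N lam (w, k) p₁) *
      (‖fourierL2 lam (opI μ N lam u) p₁.1 p₁.2‖ₑ *
        ‖fourierL2 lam (opI μ N lam v) ((w, k) - p₁ : Freq).1 ((w, k) - p₁ : Freq).2‖ₑ)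
          ∂freqMeasure lam := by
  have hl := hlam.out
  have hmu := measurable_fourierL2 (opI μ N lam u)
  have hmv := measurable_fourierL2 (opI μ N lam v)
  have hps := measurable_pairSymb μ N lam (w, k)
  have hmv' : Measurable fun p₁ : Freq =>
      fourierL2 lam (opI μ N lam v) ((w, k) - p₁ : Freq).1 ((w, k) - p₁ : Freq).2 :=
    hmv.comp (measurable_const.sub measurable_id)
  have hsum := (hasSum_fourierInt_mul' (opI μ N lam u) (opI μ N lam v) w k).sub
    ((hasSum_fourierInt_mul' u v w k).mul_left (symb μ N (w 0) (k / lam) : ℂ))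
  rw [commutatorHat, ← hsum.tsum_eq, enorm_mul, lintegral_freqMeasure lam (by fun_prop)]
  have hw : ‖Complex.I * (w 0 : ℂ)‖ₑ = ENNReal.ofReal |w 0| := by
    rw [← ofReal_norm]; simp
  -- Only λ⁻¹ is kept, the normalization of `freqMeasure`; the factor (2π)^{-3} ≤ 1 is discarded.
  -- This keeps the constants independent of λ.
  have hc : ‖((((2 * π) ^ 3 * lam : ℝ) : ℂ)⁻¹)‖ₑ ≤ ENNReal.ofReal lam⁻¹ := by
    rw [← ofReal_norm, norm_inv, Complex.norm_real, norm_of_nonneg (by positivity)]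
    refine ENNReal.ofReal_le_ofReal (inv_anti₀ hl ?_)
    refine le_mul_of_one_le_left hl.le (one_le_pow₀ ?_)
    linarith [pi_gt_three]
  calc _ ≤ ENNReal.ofReal |w 0| * ∑' j : ℤ, ENNReal.ofReal lam⁻¹ *
        ∫⁻ w₁, ENNReal.ofReal (pairSymb μ N lam (w, k) (w₁, j)) *
          (‖fourierL2 lam (opI μ N lam u) w₁ j‖ₑ *
          ‖fourierL2 lam (opI μ N lam v) (w - w₁) (k - j)‖ₑ) := by
        rw [hw]
        refine mul_le_mul_right ((enorm_tsum_le_tsum_enorm (ε := ℂ)).trans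
          (ENNReal.tsum_le_tsum fun j => ?_)) _
        rw [mul_left_comm, ← mul_sub, enorm_mul]
        exact mul_le_mul' hc (enorm_integral_commutator_le μ N u v w j k)
    _ = _ := by
        rw [ENNReal.tsum_mul_left, mul_left_comm, ← ENNReal.tsum_mul_left]
        congr 1
        refine tsum_congr fun j => ?_
        rw [← lintegral_const_mul' _ _ ENNReal.ofReal_ne_top]
        refine lintegral_congr fun w₁ => ?_
        rw [ENNReal.ofReal_mul (abs_nonneg _), mul_assoc, Prod.mk_sub_mk]

/-- The weighted Fourier transform whose `L²` norm is the Bourgain norm. -/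
def weightedHat (lam b : ℝ) (W : Freq → ℂ) (p : Freq) : ℝ≥0∞ :=
  ENNReal.ofReal (bracket (modulation lam p) ^ b * (1 + modulus lam p)) * ‖W p‖ₑ

theorem measurable_weightedHat (lam b : ℝ) {W : Freq → ℂ} (hW : Measurable W) :
    Measurable (weightedHat lam b W) := by
  unfold weightedHat bracket
  fun_prop

theorem weight_mul_enorm_sq (lam b : ℝ) (W : Plane → ℤ → ℂ) (w : Plane) (k : ℤ) :
    ENNReal.ofReal (bracket (w 1 - sigma (w 0) (k / lam)) ^ (2 * b) *
      bracket (absZ (w 0) (k / lam)) ^ (2 * (1 : ℝ))) * ‖W w k‖ₑ ^ 2 =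
    weightedHat lam b (fun p => W p.1 p.2) (w, k) ^ 2 := by
  have hb := bracket_pos (modulation lam (w, k))
  have hm := modulus_nonneg lam (w, k)
  rw [weightedHat, mul_pow, ← ENNReal.ofReal_pow (by positivity), mul_pow, ← rpow_natCast
    (_ ^ b), ← rpow_mul hb.le, mul_comm b]
  congr 3
  have : bracket (absZ (w 0) (k / lam)) = 1 + modulus lam (w, k) := by
    rw [bracket, abs_of_nonneg (absZ_nonneg _ _)]; rfl
  rw [this, mul_one, rpow_two]

theorem xNorm_opI_sq (b : ℝ) (u : L2 lam) :
    xNorm lam 1 b u = (∫⁻ p, weightedHat lam b (fun p => fourierL2 lam u p.1 p.2) p ^ 2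
      ∂freqMeasure lam) ^ (1 / 2 : ℝ) := by
  rw [xNorm, xNormHat, lintegral_freqMeasure lam
    ((measurable_weightedHat lam b (measurable_fourierL2 u)).pow_const 2)]
  simp only [weight_mul_enorm_sq]

/-- Multiplying and dividing by the input weights turns the pointwise commutator bound into the
convolution governed by `kern`. -/
theorem weightedHat_commutatorHat_le (δ₁ δ₂ : ℝ) (u v : L2 lam) (p : Freq) :
    weightedHat lam (-1 / 2 + δ₁) (fun p => commutatorHat μ N lam u v p.1 p.2) p ≤
    ∫⁻ p₁, kern μ N lam δ₁ δ₂ p p₁ *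
      (weightedHat lam (1 / 2 + δ₂) (fun p => fourierL2 lam (opI μ N lam u) p.1 p.2) p₁ *
      weightedHat lam (1 / 2 + δ₂) (fun p => fourierL2 lam (opI μ N lam v) p.1 p.2) (p - p₁))
      ∂freqMeasure lam := by
  refine (mul_le_mul_right (enorm_commutatorHat_le μ N u v p.1 p.2) _).trans (le_of_eq ?_)
  rw [← lintegral_const_mul' _ _ ENNReal.ofReal_ne_top]
  refine lintegral_congr fun p₁ => ?_
  simp only [weightedHat, kern, jap, Prod.mk.eta]
  have h0 := modulus_nonneg lam p
  have h1 := modulus_nonneg lam p₁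
  have h2 := modulus_nonneg lam (p - p₁)
  have hc := pairSymb_nonneg μ N lam p p₁
  have hk := kerWeight_nonneg μ N lam p p₁
  have hb0 := bracket_pos (modulation lam p)
  have hb1 := bracket_pos (modulation lam p₁)
  have hb2 := bracket_pos (modulation lam (p - p₁))
  set A := ‖fourierL2 lam (opI μ N lam u) p₁.1 p₁.2‖ₑ
  set B := ‖fourierL2 lam (opI μ N lam v) (p - p₁).1 (p - p₁).2‖ₑ
  have hreal : bracket (modulation lam p) ^ (-1 / 2 + δ₁) * (1 + modulus lam p) *
      (|p.1 0| * pairSymb μ N lam p p₁) =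
      kerWeight μ N lam p p₁ * bracket (modulation lam p) ^ (-1 / 2 + δ₁) *
      (bracket (modulation lam p₁) ^ (-(1 / 2 + δ₂)) *
        bracket (modulation lam (p - p₁)) ^ (-(1 / 2 + δ₂))) *
      (bracket (modulation lam p₁) ^ (1 / 2 + δ₂) * (1 + modulus lam p₁)) *
      (bracket (modulation lam (p - p₁)) ^ (1 / 2 + δ₂) * (1 + modulus lam (p - p₁))) := by
    rw [rpow_neg hb1.le, rpow_neg hb2.le, kerWeight, multWeight]
    change _ = |p.1 0| * (1 + modulus lam p) * pairSymb μ N lam p p₁ / _ * _ * _ * _ * _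
    have := (rpow_pos_of_pos hb1 (1 / 2 + δ₂)).ne'
    have := (rpow_pos_of_pos hb2 (1 / 2 + δ₂)).ne'
    field_simp
  rw [← mul_assoc, ← ENNReal.ofReal_mul (by positivity), hreal,
    ENNReal.ofReal_mul (by positivity), ENNReal.ofReal_mul (by positivity),
    ENNReal.ofReal_mul (by positivity), ENNReal.ofReal_mul (by positivity),
    ENNReal.ofReal_mul (by positivity)]
  ring

end Commutator

end ZKCylinder

end

/-! ### Conclusion. -/

open ZKCylinder in
theorem lemma4p1 (s : ℝ) (hs : 9 / 10 < s) (μ : Profile s) (ε : ℝ) (hε : 0 < ε) :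
    ∃ δ₀ : ℝ, 0 < δ₀ ∧ ∀ δ₁ δ₂ : ℝ, 0 < δ₁ → δ₁ ≤ δ₀ → 0 < δ₂ → δ₂ ≤ δ₀ →
      ∃ C : ℝ, 0 < C ∧
        ∀ (lam : ℝ) [Fact (0 < lam)], 1 < lam → ∀ (n : ℕ) (N : ℝ), N = 2 ^ n →
          ∀ u v : L2 lam,
            xNormHat lam 1 (-1 / 2 + δ₁) (commutatorHat μ N lam u v) ≤
              ENNReal.ofReal (C * N ^ (-1 / 10 + ε)) *
                xNorm lam 1 (1 / 2 + δ₂) (opI μ N lam u) *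
                xNorm lam 1 (1 / 2 + δ₂) (opI μ N lam v) := by
  -- A threshold independent of ε works: the exchange of modulation weights costs M^{1/20}, which
  -- the region estimates have to spare.
  refine ⟨1 / 1000, by norm_num, fun δ₁ δ₂ _ h₁ h₂ h₂' => ?_⟩
  obtain ⟨A, hA, H⟩ := exists_convBound_kern μ hs h₁ h₂ h₂'
  have hA2 : A ^ (1 / 2 : ℝ) ≠ ⊤ := ENNReal.rpow_ne_top_of_nonneg (by norm_num) hA
  -- The added 1 only guarantees positivity of the constant.
  refine ⟨(A ^ (1 / 2 : ℝ)).toReal + 1, by positivity, fun lam _ hlam n N hN u v => ?_⟩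
  have hN1 : 1 ≤ N := by rw [hN]; exact one_le_pow₀ (by norm_num)
  have hN0 : 0 < N := by linarith
  have hmu := measurable_weightedHat lam (1 / 2 + δ₂) (measurable_fourierL2 (opI μ N lam u))
  have hmv := measurable_weightedHat lam (1 / 2 + δ₂) (measurable_fourierL2 (opI μ N lam v))
  have hmk := measurable_kern μ N lam δ₁ δ₂
  have hmeas : Measurable fun x : Freq × Freq => kern μ N lam δ₁ δ₂ x.1 x.2 *
      (weightedHat lam (1 / 2 + δ₂) (fun p => fourierL2 lam (opI μ N lam u) p.1 p.2) x.2 *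
      weightedHat lam (1 / 2 + δ₂) (fun p => fourierL2 lam (opI μ N lam v) p.1 p.2)
        (x.1 - x.2)) :=
    hmk.mul ((hmu.comp measurable_snd).mul (hmv.comp (measurable_fst.sub measurable_snd)))
  have hconv := H lam N hlam hN1 _ _ hmu hmv
  rw [lintegral_freqMeasure lam (hmeas.lintegral_prod_right'.pow_const 2)] at hconv
  rw [xNorm_opI_sq, xNorm_opI_sq, xNormHat]
  set U := ∫⁻ p, weightedHat lam (1 / 2 + δ₂) (fun p => fourierL2 lam (opI μ N lam u) p.1 p.2) p ^ 2
    ∂freqMeasure lam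
  set V := ∫⁻ p, weightedHat lam (1 / 2 + δ₂) (fun p => fourierL2 lam (opI μ N lam v) p.1 p.2) p ^ 2
    ∂freqMeasure lam
  have hle : ENNReal.ofReal lam⁻¹ * ∑' k : ℤ, ∫⁻ w : Plane,
      ENNReal.ofReal (bracket (w 1 - sigma (w 0) (k / lam)) ^ (2 * (-1 / 2 + δ₁)) *
        bracket (absZ (w 0) (k / lam)) ^ (2 * (1 : ℝ))) * ‖commutatorHat μ N lam u v w k‖ₑ ^ 2 ≤
      A * ENNReal.ofReal (N ^ (-(1 / 5) : ℝ)) * (U * V) := by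
    refine le_trans (mul_le_mul_right (ENNReal.tsum_le_tsum fun k =>
      lintegral_mono fun w => ?_) _) hconv
    rw [weight_mul_enorm_sq]
    exact pow_le_pow_left' (weightedHat_commutatorHat_le μ N δ₁ δ₂ u v (w, k)) 2
  refine (ENNReal.rpow_le_rpow hle (by norm_num)).trans ?_
  rw [ENNReal.mul_rpow_of_nonneg _ _ (by norm_num), ENNReal.mul_rpow_of_nonneg _ _ (by norm_num),
    ENNReal.mul_rpow_of_nonneg _ _ (by norm_num), ← mul_assoc,
    ENNReal.ofReal_rpow_of_nonneg (by positivity) (by norm_num), ← rpow_mul hN0.le,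
    ENNReal.ofReal_mul (by positivity)]
  refine mul_le_mul_left (mul_le_mul_left (mul_le_mul' ?_ (ENNReal.ofReal_le_ofReal ?_)) _) _
  · rw [← ENNReal.ofReal_toReal hA2]
    exact ENNReal.ofReal_le_ofReal (by simp)
  -- The square root of N^{-1/5} is N^{-1/10}, without loss; ε enters only through N ≥ 1.
  · exact rpow_le_rpow_of_exponent_le hN1 (by linarith)
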